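/- Let $d\ge 2$ and let $\Omega\subset\mathbb R^d$ be open and bounded. Let $g(s)=\sum_{i=0}^N a_i s^{\alpha_i}$ for $s\ge 0$, where $N\ge 1$, $0=\alpha_0<\alpha_1<\dots<\alpha_N$, $a_i\ge 0$, $a_0>0$, $a_N>0$. For $\xi\ge 0$ put $K(\xi)=1/g(s(\xi))$, where $s(\xi)\ge 0$ is the unique non-negative solution of $s\,g(s)=\xi$. Let $$a=\frac{\alpha_N}{\alpha_N+1},\qquad \beta=2-a,\qquad \lambda=\frac{2-a}{1-a},$$ and assume the degree condition $a\le \frac{4}{d+2}$. Let $\mathcal T_h$ be a triangulation of $\Omega$ (possibly with curved cells) with mesh size $h$, the maximal diameter of a cell, belonging to a globally quasi-uniform family: every cell is star-shaped with respect to a ball of radius $\sigma h$, with a fixed $\sigma>0$. Let $W_h$ be the space of discontinuous piecewise polynomials of degree at most $r\ge 0$ over $\mathcal T_h$, and let $\pi$ be the $L^2(\Omega)$-orthogonal projection onto $W_h$. Gradients of elements of $W_h$ are taken elementwise. Write $(\cdot,\cdot)$ and $\|\cdot\|$ for the inner product and norm of $L^2(\Omega)$, $\|\cdot\|_1$ for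 the norm of $H^1(\Omega)$, and $\|v\|_{0,\beta}^\beta=\int_\Omega |v|^\beta\,dx$. Let $\rho^0\in L^2(\Omega)$, $f\in C([0,\infty);L^2(\Omega))$ and $\phi\in C^1([0,\infty);H^1(\Omega))$; here $\phi$ is an extension to $\Omega$ of the Dirichlet boundary data. Put $\tilde f=f-\phi_t$ and $\tilde\rho^0=\rho^0-\phi(\cdot,0)$. Let $\tilde\rho_h=\rho_h-\pi\phi:[0,\infty)\to W_h$ be continuous on $[0,\infty)$ and differentiable on $(0,\infty)$, with $\tilde\rho_h(0)=\pi\tilde\rho^0$ and $$(\tilde\rho_{h,t},w_h)+(K(|\nabla\rho_h|)\nabla\rho_h,\nabla w_h)=(\tilde f,w_h)\qquad\text{for all } w_h\in W_h,\ t>0.$$ Then there is a constant $C>0$, depending only on $d$, $\Omega$, the exponents and coefficients of $g$, the polynomial degree $r$ and the quasi-uniformity constant $\sigma$ (and not on $h$, on the triangulation, on $\rho^0,f,\phi$, on the solution or on $t$), such that the following hold, the integrals on the left-hand sides being finite. (i) For all $t\ge 1$, $$\int_{t-1}^t\|\nabla\rho_h(\tau)\|_{0,\beta}^\beta\,d\tau\le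 C\Big(1+\|\tilde\rho_h(t-1)\|^2+\int_{t-1}^t\big(\|\phi(\tau)\|_1^2+\|\tilde f(\tau)\|^\lambda\big)d\tau\Big).$$ (ii) For all $t\ge 1$, $$\int_{t-\frac12}^t\|\tilde\rho_{h,t}(\tau)\|^2d\tau+\|\nabla\rho_h(t)\|_{0,\beta}^\beta\le C\|\tilde\rho_h(t-1)\|^2+C\Big(1+\int_{t-1}^t\big(\|\phi(\tau)\|_1^2+\|\phi_t(\tau)\|_1^2+\|\tilde f(\tau)\|^\lambda\big)d\tau\Big).$$ (iii) Let $G(t)=\|\tilde f(t)\|^\lambda+\|\phi(t)\|_1^2$. For every continuous, non-decreasing function $\mathrm{Env}\,G$ on $[0,\infty)$ with $\mathrm{Env}\,G\ge G$, and for all $t\ge 1$, $$\|\nabla\rho_h(t)\|_{0,\beta}^\beta\le C\Big(1+\|\tilde\rho^0\|^2+\big(\mathrm{Env}\,G(t)\big)^{2/\beta}+\int_{t-1}^t\|\phi_t(\tau)\|_1^2\,d\tau\Big).$$ -/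

import Mathlib

open MeasureTheory Set
open scoped ContDiff RealInnerProductSpace

noncomputable section

/-- Euclidean `d`-space. -/
abbrev Euc (d : ℕ) : Type := EuclideanSpace ℝ (Fin d)

/-- The data of a generalized Forchheimer polynomial
`g(s) = a₀ s^{α₀} + a₁ s^{α₁} + ⋯ + a_N s^{α_N}`. -/
structure ForchheimerPoly where
  N : ℕ
  one_le_N : 1 ≤ N
  alpha : Fin (N + 1) → ℝ
  alpha_zero : alpha 0 = 0
  alpha_strictMono : StrictMono alpha
  coeff : Fin (N + 1) → ℝ
  coeff_nonneg : ∀ i, 0 ≤ coeff i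
  coeff_zero_pos : 0 < coeff 0
  coeff_last_pos : 0 < coeff (Fin.last N)

namespace ForchheimerPoly

/-- The function `g(s) = ∑ aᵢ s^{αᵢ}` (used for `s ≥ 0`). -/
def eval (g : ForchheimerPoly) (s : ℝ) : ℝ := ∑ i, g.coeff i * s ^ g.alpha i

lemma alpha_nonneg (g : ForchheimerPoly) (i : Fin (g.N + 1)) : 0 ≤ g.alpha i := by
  rw [← g.alpha_zero]
  exact g.alpha_strictMono.monotone (Fin.zero_le i)

lemma eval_mono (g : ForchheimerPoly) {s t : ℝ} (hs : 0 ≤ s) (hst : s ≤ t) :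
    g.eval s ≤ g.eval t :=
  Finset.sum_le_sum fun i _ => mul_le_mul_of_nonneg_left
    (Real.rpow_le_rpow hs hst (g.alpha_nonneg i)) (g.coeff_nonneg i)

lemma coeff_zero_le_eval (g : ForchheimerPoly) {s : ℝ} (hs : 0 ≤ s) :
    g.coeff 0 ≤ g.eval s := by
  have h := Finset.single_le_sum (f := fun i => g.coeff i * s ^ g.alpha i)
    (fun i _ => mul_nonneg (g.coeff_nonneg i) (Real.rpow_nonneg hs _)) (Finset.mem_univ 0)
  simpa [eval, g.alpha_zero] using h

lemma continuous_eval (g : ForchheimerPoly) : Continuous g.eval := by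
  unfold eval
  exact continuous_finsetSum _ fun i _ =>
    continuous_const.mul (Real.continuous_rpow_const (g.alpha_nonneg i))

/-- For every `ξ ≥ 0` the equation `s g(s) = ξ` has exactly one non-negative solution. -/
lemma existsUnique_root (g : ForchheimerPoly) {ξ : ℝ} (hξ : 0 ≤ ξ) :
    ∃! s : ℝ, 0 ≤ s ∧ s * g.eval s = ξ := by
  have h0 := g.coeff_zero_pos
  have hb : 0 ≤ ξ / g.coeff 0 := div_nonneg hξ h0.le
  have hc : ContinuousOn (fun s => s * g.eval s) (Icc 0 (ξ / g.coeff 0)) :=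
    (continuous_id.mul g.continuous_eval).continuousOn
  have hmem : ξ ∈ Icc ((fun s => s * g.eval s) 0)
      ((fun s => s * g.eval s) (ξ / g.coeff 0)) := by
    refine ⟨by simpa using hξ, ?_⟩
    calc ξ = ξ / g.coeff 0 * g.coeff 0 := by field_simp
      _ ≤ _ := mul_le_mul_of_nonneg_left (g.coeff_zero_le_eval hb) hb
  obtain ⟨s, hs, hsξ⟩ := intermediate_value_Icc hb hc hmem
  have key : ∀ x y : ℝ, 0 ≤ x → x < y → x * g.eval x < y * g.eval y := by
    intro x y hx hxy
    have h1 := g.eval_mono hx hxy.le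
    have h2 : 0 < g.eval y := h0.trans_le (g.coeff_zero_le_eval (hx.trans hxy.le))
    calc x * g.eval x ≤ x * g.eval y := mul_le_mul_of_nonneg_left h1 hx
      _ < y * g.eval y := mul_lt_mul_of_pos_right hxy h2
  refine ⟨s, ⟨hs.1, hsξ⟩, ?_⟩
  rintro t ⟨ht, htξ⟩
  rcases lt_trichotomy t s with h | h | h
  · have := key t s ht h
    simp only at hsξ
    linarith
  · exact h
  · have := key s t hs.1 h
    simp only at hsξ
    linarith

/-- `s(ξ)`: the unique non-negative solution `s` of `s g(s) = ξ`, for `ξ ≥ 0`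
(see `existsUnique_root`). -/
def root (g : ForchheimerPoly) (ξ : ℝ) : ℝ :=
  Classical.epsilon fun s : ℝ => 0 ≤ s ∧ s * g.eval s = ξ

lemma root_spec (g : ForchheimerPoly) {ξ : ℝ} (hξ : 0 ≤ ξ) :
    0 ≤ g.root ξ ∧ g.root ξ * g.eval (g.root ξ) = ξ :=
  Classical.epsilon_spec (g.existsUnique_root hξ).exists

/-- The conductivity `K(ξ) = 1 / g(s(ξ))`, for `ξ ≥ 0`. -/
def K (g : ForchheimerPoly) (ξ : ℝ) : ℝ := 1 / g.eval (g.root ξ)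

/-- The degree `α_N` of `g`. -/
def deg (g : ForchheimerPoly) : ℝ := g.alpha (Fin.last g.N)

/-- `a = deg g / (deg g + 1)`. -/
def a (g : ForchheimerPoly) : ℝ := g.deg / (g.deg + 1)

/-- `β = 2 - a`. -/
def beta (g : ForchheimerPoly) : ℝ := 2 - g.a

/-- `λ = (2 - a) / (1 - a)`, the conjugate exponent of `β`. -/
def lam (g : ForchheimerPoly) : ℝ := (2 - g.a) / (1 - g.a)

end ForchheimerPoly

/-- A triangulation of the open set `Ω`: finitely many compact cells with non-empty, pairwise
disjoint interiors contained in `Ω`, which cover `Ω`.  Cells may be curved, so that domains with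
a smooth boundary can be triangulated as well as polyhedra.  (For the quasi-uniform triangulations
below, each cell is star-shaped with respect to a ball, hence is a topological simplex.) -/
structure Triangulation {d : ℕ} (Ω : Set (Euc d)) where
  cells : Finset (Set (Euc d))
  isCompact : ∀ T ∈ cells, IsCompact T
  interior_nonempty : ∀ T ∈ cells, (interior T).Nonempty
  interior_subset : ∀ T ∈ cells, interior T ⊆ Ω
  covers : Ω ⊆ ⋃ T ∈ cells, T
  disjoint : ∀ T ∈ cells, ∀ T' ∈ cells, T ≠ T' → Disjoint (interior T) (interior T')

namespace Triangulation

variable {d : ℕ} {Ω : Set (Euc d)}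

/-- The mesh size `h`, the maximal diameter of a cell. -/
def meshSize (𝒯 : Triangulation Ω) : ℝ := sSup (Metric.diam '' (𝒯.cells : Set (Set (Euc d))))

/-- Global quasi-uniformity with constant `σ`: every cell is star-shaped with respect to a ball of
radius `σ h`.  A family of triangulations is globally quasi-uniform when its members satisfy this
with a common `σ > 0`. -/
def IsQuasiUniform (𝒯 : Triangulation Ω) (σ : ℝ) : Prop :=
  ∀ T ∈ 𝒯.cells, ∃ c : Euc d, Metric.closedBall c (σ * 𝒯.meshSize) ⊆ T ∧
    ∀ y ∈ Metric.closedBall c (σ * 𝒯.meshSize), StarConvex ℝ y T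

/-- The space `W_h` of discontinuous piecewise polynomials of degree at most `r`: on the interior
of each cell the function is a polynomial of total degree at most `r`.  No condition relates
different cells, and the values on the (null) skeleton are irrelevant. -/
def space (𝒯 : Triangulation Ω) (r : ℕ) : Submodule ℝ (Euc d → ℝ) where
  carrier := {w | ∀ T ∈ 𝒯.cells, ∃ p : MvPolynomial (Fin d) ℝ, p.totalDegree ≤ r ∧
    ∀ x ∈ interior T, w x = MvPolynomial.eval (fun i => x i) p}
  add_mem' := by
    intro u v hu hv T hT
    obtain ⟨p, hp, hpu⟩ := hu T hT
    obtain ⟨q, hq, hqv⟩ := hv T hT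
    refine ⟨p + q, (MvPolynomial.totalDegree_add p q).trans (max_le hp hq), fun x hx => ?_⟩
    simp [hpu x hx, hqv x hx]
  zero_mem' := fun T _ => ⟨0, by simp, fun x _ => by simp⟩
  smul_mem' := by
    intro c u hu T hT
    obtain ⟨p, hp, hpu⟩ := hu T hT
    refine ⟨c • p, (MvPolynomial.totalDegree_smul_le c p).trans hp, fun x hx => ?_⟩
    simp [hpu x hx, MvPolynomial.smul_eval]

/-- `p` is the `L²(Ω)`-projection `π u` of `u` onto `W_h`:
`p ∈ W_h` and `(p, v) = (u, v)` for all `v ∈ W_h`. -/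
def IsL2Proj (𝒯 : Triangulation Ω) (r : ℕ) (u p : Euc d → ℝ) : Prop :=
  p ∈ 𝒯.space r ∧ ∀ v ∈ 𝒯.space r, ∫ x in Ω, p x * v x = ∫ x in Ω, u x * v x

end Triangulation

/-- The scalar space `L²(Ω)`. -/
abbrev L2 {d : ℕ} (Ω : Set (Euc d)) : Type := Lp ℝ 2 (volume.restrict Ω)

/-- The space `L²(Ω)^d` of vector fields. -/
abbrev L2Vec {d : ℕ} (Ω : Set (Euc d)) : Type := Lp (Euc d) 2 (volume.restrict Ω)

/-- `G` is the weak gradient on `Ω` of `u`; thus `u ∈ H¹(Ω)`, with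
`‖u‖₁² = ‖u‖² + ‖G‖²`. -/
def IsWeakGradient {d : ℕ} (Ω : Set (Euc d)) (u : L2 Ω) (G : L2Vec Ω) : Prop :=
  ∀ η : Euc d → ℝ, ContDiff ℝ ∞ η → HasCompactSupport η → tsupport η ⊆ Ω →
    ∀ v : Euc d, ∫ x in Ω, u x * fderiv ℝ η x v = - ∫ x in Ω, η x * ⟪G x, v⟫

/-- The data of the initial boundary value problem: an initial density `ρ⁰ ∈ L²(Ω)`, a source
`f ∈ C([0,∞); L²(Ω))`, and the extension `φ ∈ C¹([0,∞); H¹(Ω))` of the boundary values. Here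
`phi_t` is the time derivative of `phi`, and `grad_phi`, `grad_phi_t` are spatial gradients. -/
structure ProblemData {d : ℕ} (Ω : Set (Euc d)) where
  rho0 : L2 Ω
  f : ℝ → L2 Ω
  phi : ℝ → L2 Ω
  grad_phi : ℝ → L2Vec Ω
  phi_t : ℝ → L2 Ω
  grad_phi_t : ℝ → L2Vec Ω
  isWeakGradient_phi : ∀ t, 0 ≤ t → IsWeakGradient Ω (phi t) (grad_phi t)
  isWeakGradient_phi_t : ∀ t, 0 ≤ t → IsWeakGradient Ω (phi_t t) (grad_phi_t t)
  hasDeriv_phi : ∀ t, 0 ≤ t → HasDerivWithinAt phi (phi_t t) (Ici 0) t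
  continuousOn_f : ContinuousOn f (Ici 0)
  continuousOn_grad_phi : ContinuousOn grad_phi (Ici 0)
  continuousOn_phi_t : ContinuousOn phi_t (Ici 0)
  continuousOn_grad_phi_t : ContinuousOn grad_phi_t (Ici 0)

namespace ProblemData

variable {d : ℕ} {Ω : Set (Euc d)}

/-- `f̃ = f - φ_t`. -/
def fTilde (D : ProblemData Ω) (t : ℝ) : L2 Ω := D.f t - D.phi_t t

/-- `ρ̃⁰ = ρ⁰ - φ(·, 0)`. -/
def rhoTilde0 (D : ProblemData Ω) : L2 Ω := D.rho0 - D.phi 0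

/-- `‖φ(t)‖₁²`, the squared `H¹(Ω)`-norm. -/
def phiH1Sq (D : ProblemData Ω) (t : ℝ) : ℝ := ‖D.phi t‖ ^ 2 + ‖D.grad_phi t‖ ^ 2

/-- `‖φ_t(t)‖₁²`, the squared `H¹(Ω)`-norm. -/
def phitH1Sq (D : ProblemData Ω) (t : ℝ) : ℝ := ‖D.phi_t t‖ ^ 2 + ‖D.grad_phi_t t‖ ^ 2

/-- `g(t) = ‖f̃(t)‖^λ + ‖φ(t)‖₁²`. -/
def gFun (D : ProblemData Ω) (g : ForchheimerPoly) (t : ℝ) : ℝ :=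
  ‖D.fTilde t‖ ^ g.lam + D.phiH1Sq t

end ProblemData

/-- `E` is a continuous, increasing (upper) envelope of `F` on `[0, ∞)`. -/
structure IsEnvelope (F E : ℝ → ℝ) : Prop where
  continuousOn : ContinuousOn E (Ici 0)
  monotoneOn : MonotoneOn E (Ici 0)
  le : ∀ t, 0 ≤ t → F t ≤ E t

/-- The time derivative `u_t(t, x)`. -/
def timeDeriv {d : ℕ} (u : ℝ → Euc d → ℝ) (t : ℝ) (x : Euc d) : ℝ := deriv (fun s => u s x) t

/-- `‖u‖²`, the squared `L²(Ω)`-norm. -/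
def normSqL2 {d : ℕ} (Ω : Set (Euc d)) (u : Euc d → ℝ) : ℝ := ∫ x in Ω, u x ^ 2

/-- `‖∇u‖_{0,β}^β = ∫_Ω |∇u|^β`. For a piecewise polynomial `u`, the pointwise gradient exists
in the interior of every cell, hence almost everywhere, and is the elementwise gradient. -/
def gradPow {d : ℕ} (Ω : Set (Euc d)) (β : ℝ) (u : Euc d → ℝ) : ℝ :=
  ∫ x in Ω, ‖gradient u x‖ ^ β

/-- The semidiscrete Galerkin problem: `ρ̃_h = ρ_h - π φ : [0,∞) → W_h` is continuous on `[0,∞)`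
and differentiable on `(0,∞)`, starts from `π ρ̃⁰`, and
`(ρ̃_{h,t}, w) + (K(|∇ρ_h|) ∇ρ_h, ∇w) = (f̃, w)` for all `w ∈ W_h`, with elementwise gradients.
Here `rhoT` stands for `ρ̃_h` and `rho` for `ρ_h`. (As `W_h` is finite dimensional, pointwise
continuity and differentiability in time inside the cells amount to those of a curve in `W_h`.) -/
structure IsSemidiscreteSolution {d : ℕ} {Ω : Set (Euc d)} (g : ForchheimerPoly)
    (𝒯 : Triangulation Ω) (r : ℕ) (D : ProblemData Ω) (rhoT rho : ℝ → Euc d → ℝ) : Prop where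
  mem : ∀ t, 0 ≤ t → rhoT t ∈ 𝒯.space r
  proj : ∀ t, 0 ≤ t → 𝒯.IsL2Proj r (D.phi t) (rho t - rhoT t)
  init : 𝒯.IsL2Proj r D.rhoTilde0 (rhoT 0)
  continuousOn : ∀ T ∈ 𝒯.cells, ∀ x ∈ interior T, ContinuousOn (fun s => rhoT s x) (Ici 0)
  differentiableAt : ∀ T ∈ 𝒯.cells, ∀ x ∈ interior T, ∀ t, 0 < t →
    DifferentiableAt ℝ (fun s => rhoT s x) t
  equation : ∀ t, 0 < t → ∀ w ∈ 𝒯.space r,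
    (∫ x in Ω, timeDeriv rhoT t x * w x) +
      (∫ x in Ω, ⟪g.K ‖gradient (rho t) x‖ • gradient (rho t) x, gradient w x⟫) =
    ∫ x in Ω, D.fTilde t x * w x

end

noncomputable section

/-! The scheme contains no jump terms, so the flux controls elementwise gradients only and does not
see piecewise constants. Two inequalities with constants uniform in the mesh make up for this. The
first is a broken Sobolev–Poincaré inequality on `W_h` (`exists_broken_poincare`): modulo functions
of zero elementwise gradient, `‖w‖^β ≤ S ∫|∇w|^β`. Scaling from a reference ball produces the factor
`h^((d+2)β/2 - d)`; the degree condition says exactly that this exponent is non-negative, and `h` is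
bounded in terms of `Ω` and `σ`. The second is the elementwise stability `∫|∇πφ|² ≤ B ‖∇φ‖²`
(`exists_projection_stability`), which combines an inverse inequality for polynomials with a
Poincaré inequality for `H¹` functions on star-shaped cells.

Given `S` and `B`, the rest is an argument about a curve in a finite-dimensional space
(`GalerkinFlow`). Let `A = ∫|∇ρ_h|^β`, `F = ‖f̃‖^λ + ‖φ‖₁²`, and let `y = ‖Qρ̃_h‖²`, where `Q` is
the `L²`-orthogonal projection onto the complement of the functions with zero elementwise gradient.
The bounds `c ξ^β - C ≤ K(ξ) ξ²` and `K(ξ) ξ ≤ C ξ^(β-1)` together with Young's inequality give the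
following.

Testing with `Qρ̃_h` yields `y' ≤ -cA + C(1 + F)` (`exists_dissipation`), and integration over
`[t-1, t]` gives (i). Testing with `ρ̃_{h,t}` yields, for an energy comparable with `A` up to
additive constants, a derivative at most `-‖ρ̃_{h,t}‖² + C(A + 1 + F + ‖φ_t‖₁²)`
(`exists_energy_deriv_le`). Integrating from `s` to `t`, averaging over `s` in `(t-1, t-1/2)` and
inserting (i) gives (ii). Both estimates involve the past only through `y(t-1)`, which is at most
`‖ρ̃_h(t-1)‖²`.

For (iii), the broken Poincaré inequality gives `y^(β/2) ≤ C(A + 1 + F)`. Once `y` exceeds a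
multiple of `(1 + Env G(t))^(2/β)`, `A` is so large that `y' ≤ 0`. Hence `y(t-1)` is at most the
maximum of `y(0)` and that level, and (ii) in terms of `y` concludes. -/

lemma rpow_eq_rpow_sub_one_mul {b : ℝ} (hb : 1 < b) {x : ℝ} (hx : 0 ≤ x) :
    x ^ b = x ^ (b - 1) * x := by
  calc x ^ b = x ^ (b - 1 + 1) := by rw [sub_add_cancel]
    _ = x ^ (b - 1) * x := by
      rw [Real.rpow_add_of_nonneg hx (by linarith) (by norm_num), Real.rpow_one]

/-! ### Growth of the conductivity and of its potential. -/

namespace ForchheimerPoly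

variable (g : ForchheimerPoly)

lemma deg_pos : 0 < g.deg := by
  rw [deg, ← g.alpha_zero]
  apply g.alpha_strictMono
  rw [Fin.lt_def]
  have := g.one_le_N
  simp only [Fin.val_zero, Fin.val_last]
  omega

lemma beta_sub_one : g.beta - 1 = 1 / (g.deg + 1) := by
  have := g.deg_pos
  rw [beta, a]
  field_simp
  ring

lemma one_lt_beta : 1 < g.beta := by
  have h := g.beta_sub_one
  have : 0 < 1 / (g.deg + 1) := by have := g.deg_pos; positivity
  linarith

lemma beta_lt_two : g.beta < 2 := by
  have : 0 < g.a := div_pos g.deg_pos (by linarith [g.deg_pos])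
  rw [beta]; linarith

lemma lam_eq : g.lam = g.beta / (g.beta - 1) := by
  rw [lam, beta]
  congr 1
  ring

lemma two_le_lam : 2 ≤ g.lam := by
  have h1 := g.one_lt_beta
  have h2 := g.beta_lt_two
  rw [lam_eq, le_div_iff₀ (by linarith)]
  linarith

lemma root_nonneg {ξ : ℝ} (hξ : 0 ≤ ξ) : 0 ≤ g.root ξ := (g.root_spec hξ).1

lemma eval_pos {s : ℝ} (hs : 0 ≤ s) : 0 < g.eval s :=
  g.coeff_zero_pos.trans_le (g.coeff_zero_le_eval hs)

lemma K_pos {ξ : ℝ} (hξ : 0 ≤ ξ) : 0 < g.K ξ :=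
  one_div_pos.2 (g.eval_pos (g.root_nonneg hξ))

lemma K_mul_self {ξ : ℝ} (hξ : 0 ≤ ξ) : g.K ξ * ξ = g.root ξ := by
  have h := g.root_spec hξ
  have h2 := g.eval_pos h.1
  rw [K, one_div_mul_eq_div, div_eq_iff h2.ne', h.2]

lemma root_mono {x y : ℝ} (hx : 0 ≤ x) (hxy : x ≤ y) : g.root x ≤ g.root y := by
  by_contra! h
  have h1 := g.root_spec hx
  have h2 := g.root_spec (hx.trans hxy)
  have h3 := g.eval_mono h2.1 h.le
  have h4 : g.root y * g.eval (g.root y) < g.root x * g.eval (g.root x) :=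
    calc _ < g.root x * g.eval (g.root y) := mul_lt_mul_of_pos_right h (g.eval_pos h2.1)
      _ ≤ _ := mul_le_mul_of_nonneg_left h3 h1.1
  linarith

lemma K_antitone {x y : ℝ} (hx : 0 ≤ x) (hxy : x ≤ y) : g.K y ≤ g.K x :=
  one_div_le_one_div_of_le (g.eval_pos (g.root_nonneg hx))
    (g.eval_mono (g.root_nonneg hx) (g.root_mono hx hxy))

/-- Since `g` is non-decreasing and at least `a₀`, the map `s ↦ s g(s)` grows at rate at least `a₀`,
so its inverse is Lipschitz. The continuity of `K` rests on this. -/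
lemma root_sub_le {x y : ℝ} (hx : 0 ≤ x) (hxy : x ≤ y) :
    g.root y - g.root x ≤ (y - x) / g.coeff 0 := by
  have h1 := g.root_spec hx
  have h2 := g.root_spec (hx.trans hxy)
  have h := g.root_mono hx hxy
  rw [le_div_iff₀ g.coeff_zero_pos]
  have h3 := g.eval_mono h1.1 h
  have h4 := g.coeff_zero_le_eval h2.1
  nlinarith [mul_nonneg h1.1 (sub_nonneg.2 h3), mul_nonneg (sub_nonneg.2 h) (sub_nonneg.2 h4)]

lemma continuousOn_root : ContinuousOn g.root (Ici 0) := by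
  have : LipschitzOnWith (Real.toNNReal (1 / g.coeff 0)) g.root (Ici 0) := by
    refine LipschitzOnWith.of_dist_le_mul fun x hx y hy => ?_
    have hc : 0 ≤ 1 / g.coeff 0 := (one_div_pos.2 g.coeff_zero_pos).le
    rw [Real.coe_toNNReal _ hc]
    wlog hxy : x ≤ y generalizing x y
    · rw [dist_comm, dist_comm x]
      exact this y hy x hx (le_of_not_ge hxy)
    rw [dist_comm, dist_comm x, Real.dist_eq, Real.dist_eq, abs_of_nonneg (sub_nonneg.2 hxy),
      abs_of_nonneg (sub_nonneg.2 (g.root_mono hx hxy))]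
    have := g.root_sub_le hx hxy
    rwa [one_div_mul_eq_div]
  exact this.continuousOn

lemma continuous_K_comp {Y : Type*} [TopologicalSpace Y] {φ : Y → ℝ} (hφ : Continuous φ)
    (h0 : ∀ y, 0 ≤ φ y) : Continuous fun y => g.K (φ y) := by
  have h1 : Continuous fun y => g.root (φ y) :=
    g.continuousOn_root.comp_continuous hφ h0
  unfold K
  exact continuous_const.div (g.continuous_eval.comp h1)
    fun y => (g.eval_pos (g.root_nonneg (h0 y))).ne'

/-- Keeping only the leading term of `g` gives `a_N s^(deg+1) ≤ ξ`, and `1/(deg+1) = β - 1`. As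
`K(ξ) ξ = s(ξ)`, this is the growth bound for the flux. -/
lemma exists_root_le : ∃ C : ℝ, 0 < C ∧ ∀ ξ, 0 ≤ ξ → g.root ξ ≤ C * ξ ^ (g.beta - 1) := by
  have hd := g.deg_pos
  have hN := g.coeff_last_pos
  refine ⟨(1 / g.coeff (Fin.last g.N)) ^ (g.beta - 1), by positivity, fun ξ hξ => ?_⟩
  rw [← Real.mul_rpow (by positivity) hξ]
  obtain ⟨h1, h2⟩ := g.root_spec hξ
  set s := g.root ξ
  have h3 : g.coeff (Fin.last g.N) * s ^ g.deg ≤ g.eval s :=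
    Finset.single_le_sum (f := fun i => g.coeff i * s ^ g.alpha i)
      (fun i _ => mul_nonneg (g.coeff_nonneg i) (Real.rpow_nonneg h1 _))
      (Finset.mem_univ (Fin.last g.N))
  have h4 : s ^ (g.deg + 1) = s * s ^ g.deg := by
    rw [add_comm, Real.rpow_add_of_nonneg h1 (by norm_num) hd.le, Real.rpow_one]
  have h5 : s ^ (g.deg + 1) ≤ 1 / g.coeff (Fin.last g.N) * ξ := by
    rw [h4, one_div_mul_eq_div, le_div_iff₀ hN]
    calc s * s ^ g.deg * g.coeff (Fin.last g.N)
        = s * (g.coeff (Fin.last g.N) * s ^ g.deg) := by ring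
      _ ≤ s * g.eval s := mul_le_mul_of_nonneg_left h3 h1
      _ = ξ := h2
  calc s = (s ^ (g.deg + 1)) ^ (g.beta - 1) := by
        rw [g.beta_sub_one, ← Real.rpow_mul h1, mul_one_div_cancel (by positivity), Real.rpow_one]
    _ ≤ _ := Real.rpow_le_rpow (by positivity) h5 (by linarith [g.one_lt_beta])

/-- For `s ≥ 1` all powers in `g` are dominated by `s^deg`, so `ξ ≤ g(1) s^(deg+1)` and `K(ξ) ξ² = s
ξ` dominates a multiple of `ξ^β`. For `s ≤ 1` one has `ξ ≤ g(1)`, and the additive constant takes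
over. -/
lemma exists_le_K_mul_sq : ∃ c C : ℝ, 0 < c ∧ 0 < C ∧
    ∀ ξ, 0 ≤ ξ → c * ξ ^ g.beta ≤ g.K ξ * ξ ^ 2 + C := by
  have hd := g.deg_pos
  have hb := g.one_lt_beta
  set S := g.eval 1 with hS
  have hS0 : 0 < S := g.eval_pos (by norm_num)
  refine ⟨(1 / S) ^ (g.beta - 1), (1 / S) ^ (g.beta - 1) * S ^ g.beta, by positivity,
    by positivity, fun ξ hξ => ?_⟩
  obtain ⟨h1, h2⟩ := g.root_spec hξ
  have hK : g.K ξ * ξ ^ 2 = g.root ξ * ξ := by rw [← g.K_mul_self hξ]; ring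
  rw [hK]
  set s := g.root ξ
  rcases le_total s 1 with hs | hs
  · have h3 : ξ ≤ S := by
      rw [← h2]
      calc s * g.eval s ≤ 1 * S := mul_le_mul hs (g.eval_mono h1 hs) (g.eval_pos h1).le zero_le_one
        _ = S := one_mul _
    have h4 : ξ ^ g.beta ≤ S ^ g.beta := Real.rpow_le_rpow hξ h3 (by linarith)
    have h5 := mul_le_mul_of_nonneg_left h4 (show 0 ≤ (1 / S) ^ (g.beta - 1) by positivity)
    nlinarith [mul_nonneg h1 hξ]
  · have h3 : g.eval s ≤ S * s ^ g.deg := by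
      rw [hS, eval, eval, Finset.sum_mul]
      refine Finset.sum_le_sum fun i _ => ?_
      rw [Real.one_rpow, mul_one]
      exact mul_le_mul_of_nonneg_left (Real.rpow_le_rpow_of_exponent_le hs
        (g.alpha_strictMono.monotone (Fin.le_last i))) (g.coeff_nonneg i)
    have h4 : s ^ (g.deg + 1) = s * s ^ g.deg := by
      rw [add_comm, Real.rpow_add_of_nonneg h1 (by norm_num) hd.le, Real.rpow_one]
    have h5 : 1 / S * ξ ≤ s ^ (g.deg + 1) := by
      rw [h4, one_div_mul_eq_div, div_le_iff₀ hS0, ← h2]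
      calc s * g.eval s ≤ s * (S * s ^ g.deg) := mul_le_mul_of_nonneg_left h3 h1
        _ = _ := by ring
    have h6 : (1 / S) ^ (g.beta - 1) * ξ ^ (g.beta - 1) ≤ s := by
      rw [← Real.mul_rpow (by positivity) hξ]
      calc _ ≤ (s ^ (g.deg + 1)) ^ (g.beta - 1) :=
            Real.rpow_le_rpow (by positivity) h5 (by linarith)
        _ = s := by
          rw [g.beta_sub_one, ← Real.rpow_mul h1, mul_one_div_cancel (by positivity),
            Real.rpow_one]
    calc (1 / S) ^ (g.beta - 1) * ξ ^ g.beta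
        = (1 / S) ^ (g.beta - 1) * ξ ^ (g.beta - 1) * ξ := by rw [rpow_eq_rpow_sub_one_mul hb hξ]; ring
      _ ≤ s * ξ := mul_le_mul_of_nonneg_right h6 hξ
      _ ≤ _ := le_add_of_nonneg_right (by positivity)

/-- The primitive of `K ∘ √`, whose composition with `‖·‖²` is twice the potential of the flux. -/
def potential (y : ℝ) : ℝ := ∫ s in (0 : ℝ)..y, g.K (Real.sqrt s)

lemma continuous_K_sqrt : Continuous fun s => g.K (Real.sqrt s) :=
  g.continuous_K_comp Real.continuous_sqrt Real.sqrt_nonneg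

lemma hasDerivAt_potential (y : ℝ) : HasDerivAt g.potential (g.K (Real.sqrt y)) y :=
  intervalIntegral.integral_hasDerivAt_right (g.continuous_K_sqrt.intervalIntegrable _ _)
    g.continuous_K_sqrt.stronglyMeasurable.stronglyMeasurableAtFilter
    g.continuous_K_sqrt.continuousAt

/-- `K` is non-increasing, so the integrand over `[0, ξ²]` is at least its value at the right
endpoint. -/
lemma K_mul_sq_le_potential {ξ : ℝ} (hξ : 0 ≤ ξ) : g.K ξ * ξ ^ 2 ≤ g.potential (ξ ^ 2) := by
  have h := intervalIntegral.integral_mono_on (μ := volume) (a := 0) (b := ξ ^ 2) (by positivity)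
    (f := fun _ => g.K ξ) (g := fun s => g.K (Real.sqrt s)) (by simp)
    (g.continuous_K_sqrt.intervalIntegrable _ _) (fun s hs => by
      refine g.K_antitone (Real.sqrt_nonneg s) ?_
      rw [← Real.sqrt_sq hξ]
      exact Real.sqrt_le_sqrt hs.2)
  rw [intervalIntegral.integral_const] at h
  simpa [potential, mul_comm] using h

/-- The integrand is at most `C s^(β/2 - 1)`, whose singularity at zero is integrable because `β >
0`. -/
lemma exists_potential_le : ∃ C : ℝ, 0 < C ∧
    ∀ ξ, 0 ≤ ξ → g.potential (ξ ^ 2) ≤ C * ξ ^ g.beta := by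
  obtain ⟨C, hC, h⟩ := g.exists_root_le
  have h1 := g.one_lt_beta
  have h2 := g.beta_lt_two
  refine ⟨C / (g.beta / 2), by positivity, fun ξ hξ => ?_⟩
  have hi : IntervalIntegrable (fun s : ℝ => C * s ^ (g.beta / 2 - 1)) volume 0 (ξ ^ 2) :=
    (intervalIntegral.intervalIntegrable_rpow' (by linarith)).const_mul C
  have hle := intervalIntegral.integral_mono_on_of_le_Ioo (μ := volume) (a := 0) (b := ξ ^ 2)
    (by positivity) (g.continuous_K_sqrt.intervalIntegrable _ _) hi (fun s hs => by
      have hs0 : 0 < Real.sqrt s := Real.sqrt_pos.2 hs.1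
      have h3 := h _ hs0.le
      rw [← g.K_mul_self hs0.le] at h3
      have h4 : s ^ (g.beta / 2 - 1) = Real.sqrt s ^ (g.beta - 1) / Real.sqrt s := by
        rw [Real.sqrt_eq_rpow, ← Real.rpow_mul hs.1.le, ← Real.rpow_sub hs.1]
        congr 1; ring
      rw [h4, ← mul_div_assoc, le_div_iff₀ hs0]
      exact h3)
  rw [intervalIntegral.integral_const_mul, integral_rpow (Or.inl (by linarith))] at hle
  rw [potential]
  refine hle.trans (le_of_eq ?_)
  rw [sub_add_cancel, Real.zero_rpow (by linarith), sub_zero, ← Real.rpow_natCast,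
    ← Real.rpow_mul hξ]
  push_cast
  rw [mul_div_cancel₀ _ (two_ne_zero)]
  ring

end ForchheimerPoly

/-! ### Elementary inequalities for real powers. -/

/-- Young's inequality with a small constant, for the exponents `b` and `b / (b - 1)`. -/
lemma exists_rpow_mul_le {b : ℝ} (hb : 1 < b) {ε : ℝ} (hε : 0 < ε) :
    ∃ C : ℝ, 0 < C ∧ ∀ x y : ℝ, 0 ≤ x → 0 ≤ y → x ^ (b - 1) * y ≤ ε * x ^ b + C * y ^ b := by
  have hpow := fun x : ℝ => rpow_eq_rpow_sub_one_mul hb (x := x)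
  refine ⟨(1 / ε) ^ (b - 1), by positivity, fun x y hx hy => ?_⟩
  have hxp : 0 ≤ x ^ b := Real.rpow_nonneg hx _
  have hyp : 0 ≤ y ^ b := Real.rpow_nonneg hy _
  -- If `y ≤ ε x`, the first term alone suffices; otherwise `x ≤ y/ε`, which produces the constant
  -- `(1/ε)^(b-1)`.
  rcases le_total y (ε * x) with h | h
  · have h1 : x ^ (b - 1) * y ≤ ε * x ^ b := by
      rw [hpow x hx]
      calc _ ≤ x ^ (b - 1) * (ε * x) := mul_le_mul_of_nonneg_left h (Real.rpow_nonneg hx _)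
        _ = _ := by ring
    have : 0 ≤ (1 / ε) ^ (b - 1) * y ^ b := by positivity
    linarith
  · have h1 : x ≤ 1 / ε * y := by
      rw [one_div_mul_eq_div, le_div_iff₀ hε]; linarith
    have h2 : x ^ (b - 1) ≤ (1 / ε) ^ (b - 1) * y ^ (b - 1) := by
      rw [← Real.mul_rpow (by positivity) hy]
      exact Real.rpow_le_rpow hx h1 (by linarith)
    have h3 := mul_le_mul_of_nonneg_right h2 hy
    rw [mul_assoc, ← hpow y hy] at h3
    have : 0 ≤ ε * x ^ b := by positivity
    linarith

lemma rpow_le_one_add_rpow {x p q : ℝ} (hx : 0 ≤ x) (hp : 0 ≤ p) (hpq : p ≤ q) :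
    x ^ p ≤ 1 + x ^ q := by
  rcases le_total x 1 with h | h
  · have := Real.rpow_le_one hx h hp
    have := Real.rpow_nonneg hx q
    linarith
  · have := Real.rpow_le_rpow_of_exponent_le h hpq
    linarith

lemma add_rpow_le {x y b : ℝ} (hx : 0 ≤ x) (hy : 0 ≤ y) (hb : 0 ≤ b) :
    (x + y) ^ b ≤ 2 ^ b * (x ^ b + y ^ b) := by
  have h2 : (0 : ℝ) ≤ 2 ^ b := by positivity
  rcases le_total x y with h | h
  · calc (x + y) ^ b ≤ (2 * y) ^ b := Real.rpow_le_rpow (by positivity) (by linarith) hb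
      _ = 2 ^ b * y ^ b := Real.mul_rpow (by norm_num) hy
      _ ≤ _ := mul_le_mul_of_nonneg_left (le_add_of_nonneg_left (Real.rpow_nonneg hx _)) h2
  · calc (x + y) ^ b ≤ (2 * x) ^ b := Real.rpow_le_rpow (by positivity) (by linarith) hb
      _ = 2 ^ b * x ^ b := Real.mul_rpow (by norm_num) hx
      _ ≤ _ := mul_le_mul_of_nonneg_left (le_add_of_nonneg_right (Real.rpow_nonneg hy _)) h2

/-! ### Regularity of curves in a finite-dimensional space from separating functionals. -/

section FiniteDimensionalCurves

variable {V ι : Type*} [NormedAddCommGroup V] [NormedSpace ℝ V] [FiniteDimensional ℝ V]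

/-- A separating family has trivial common kernel; counting dimensions, its span is the whole dual.
-/
lemma span_range_eq_top_of_separating (ℓ : ι → Module.Dual ℝ V)
    (hℓ : ∀ v, (∀ i, ℓ i v = 0) → v = 0) : Submodule.span ℝ (range ℓ) = ⊤ := by
  have h := Subspace.finrank_add_finrank_dualCoannihilator_eq (Submodule.span ℝ (range ℓ))
  have h0 : (Submodule.span ℝ (range ℓ)).dualCoannihilator = ⊥ := by
    rw [eq_bot_iff]
    intro v hv
    rw [Submodule.mem_dualCoannihilator] at hv
    exact hℓ v fun i => hv _ (Submodule.subset_span ⟨i, rfl⟩)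
  rw [h0, finrank_bot, add_zero, ← Subspace.dual_finrank_eq] at h
  exact Submodule.eq_top_of_finrank_eq h

/-- A closure property of real functions passes from a separating family of linear functionals to
all of them. -/
lemma separating_induction {Y : Type*} (ℓ : ι → Module.Dual ℝ V)
    (hℓ : ∀ v, (∀ i, ℓ i v = 0) → v = 0) {p : (Y → ℝ) → Prop} {γ : Y → V}
    (h0 : p fun _ => 0) (hadd : ∀ a b : Y → ℝ, p a → p b → p fun s => a s + b s)
    (hsmul : ∀ (c : ℝ) (a : Y → ℝ), p a → p fun s => c * a s)
    (h : ∀ i, p fun s => ℓ i (γ s)) (φ : Module.Dual ℝ V) : p fun s => φ (γ s) := by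
  have hφ : φ ∈ Submodule.span ℝ (range ℓ) := by
    rw [span_range_eq_top_of_separating ℓ hℓ]; trivial
  induction hφ using Submodule.span_induction with
  | mem x hx => obtain ⟨i, rfl⟩ := hx; exact h i
  | zero => simpa using h0
  | add x y _ _ hx hy => simpa using hadd _ _ hx hy
  | smul c x _ hx => simpa using hsmul c _ hx

/-- Time regularity is known for point values and for `L²` pairings only; this transfers it to the
coefficient vectors. -/
lemma continuousOn_of_separating {Y : Type*} [TopologicalSpace Y] (ℓ : ι → Module.Dual ℝ V)
    (hℓ : ∀ v, (∀ i, ℓ i v = 0) → v = 0) {γ : Y → V} {s : Set Y}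
    (h : ∀ i, ContinuousOn (fun y => ℓ i (γ y)) s) : ContinuousOn γ s := by
  have key := separating_induction ℓ hℓ (p := fun f => ContinuousOn f s) (γ := γ)
    continuousOn_const (fun _ _ ha hb => ha.add hb) (fun c _ ha => continuousOn_const.mul ha) h
  set b := Module.finBasis ℝ V
  have : γ = fun y => ∑ i, b.coord i (γ y) • b i := by
    funext y; simp
  rw [this]
  exact continuousOn_finsetSum _ fun i _ => (key (b.coord i)).smul continuousOn_const

lemma differentiableAt_of_separating (ℓ : ι → Module.Dual ℝ V)
    (hℓ : ∀ v, (∀ i, ℓ i v = 0) → v = 0) {γ : ℝ → V} {t : ℝ}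
    (h : ∀ i, DifferentiableAt ℝ (fun y => ℓ i (γ y)) t) : DifferentiableAt ℝ γ t := by
  have key := separating_induction ℓ hℓ (p := fun f => DifferentiableAt ℝ f t) (γ := γ)
    (differentiableAt_const _) (fun _ _ ha hb => ha.add hb) (fun c _ ha => ha.const_mul c) h
  set b := Module.finBasis ℝ V
  have : γ = fun y => ∑ i, b.coord i (γ y) • b i := by
    funext y; simp
  rw [this]
  exact DifferentiableAt.fun_sum fun i _ => (key (b.coord i)).smul_const _

end FiniteDimensionalCurves

lemma norm_le_norm_add_of_inner_eq_zero {H : Type*} [NormedAddCommGroup H] [InnerProductSpace ℝ H]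
    {a b : H} (h : ⟪a, b⟫ = 0) : ‖a‖ ≤ ‖a + b‖ := by
  have := norm_add_sq_real a b
  rw [h] at this
  exact le_of_sq_le_sq (by nlinarith [sq_nonneg ‖b‖]) (norm_nonneg _)

/-- If `y' ≤ 0` wherever `y > M`, then `y` stays below `max (y 0) M`. -/
lemma le_max_of_deriv_nonpos_of_lt {y y' : ℝ → ℝ} {t M : ℝ} (ht : 0 ≤ t)
    (hc : ContinuousOn y (Icc 0 t)) (hd : ∀ s ∈ Ioo 0 t, HasDerivAt y (y' s) s)
    (hM : ∀ s ∈ Ioo 0 t, M < y s → y' s ≤ 0) : y t ≤ max (y 0) M := by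
  by_contra! hlt
  set S := Icc 0 t ∩ y ⁻¹' Iic (max (y 0) M)
  have hSc : IsCompact S := isCompact_Icc.of_isClosed_subset
    (hc.preimage_isClosed_of_isClosed isClosed_Icc isClosed_Iic) inter_subset_left
  -- `s` is the last time at which `y` does not exceed `max (y 0) M`. After `s` the hypothesis makes
  -- `y` non-increasing, so it cannot end above that level.
  obtain ⟨s, hs, hmax⟩ := hSc.exists_isGreatest ⟨0, ⟨le_rfl, ht⟩, le_max_left (y 0) M⟩
  have hst : s ≤ t := hs.1.2
  have hab : ∀ τ ∈ Ioo s t, M < y τ := fun τ hτ => by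
    by_contra! h
    exact absurd (hmax ⟨⟨hs.1.1.trans hτ.1.le, hτ.2.le⟩, h.trans (le_max_right _ _)⟩)
      (not_le.2 hτ.1)
  have hanti : AntitoneOn y (Icc s t) := by
    refine antitoneOn_of_deriv_nonpos (convex_Icc s t) (hc.mono (Icc_subset_Icc_left hs.1.1))
      (fun τ hτ => ?_) (fun τ hτ => ?_)
    all_goals
      rw [interior_Icc] at hτ
      have hτ' : τ ∈ Ioo 0 t := ⟨hs.1.1.trans_lt hτ.1, hτ.2⟩
    · exact (hd τ hτ').differentiableAt.differentiableWithinAt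
    · rw [(hd τ hτ').deriv]; exact hM τ hτ' (hab τ hτ)
  have := hanti ⟨le_rfl, hst⟩ ⟨hst, le_rfl⟩ hst
  exact absurd (this.trans hs.2) (not_le.2 hlt)

/-- Taking the potential as a function of `‖·‖²` avoids the non-differentiability of the norm at
zero. The derivative is twice the flux. -/
lemma ForchheimerPoly.hasFDerivAt_potential_norm_sq {E W : Type*}
    [NormedAddCommGroup E] [InnerProductSpace ℝ E] [NormedAddCommGroup W] [NormedSpace ℝ W]
    (g : ForchheimerPoly) (L : W →L[ℝ] E) (w : W) :
    HasFDerivAt (fun w => g.potential (‖L w‖ ^ 2))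
      ((2 * g.K ‖L w‖) • (innerSL ℝ (L w)).comp L) w := by
  have h1 : HasFDerivAt (fun w => ‖L w‖ ^ 2) (2 • (innerSL ℝ (L w)).comp L) w :=
    L.hasFDerivAt.norm_sq
  have h2 := (g.hasDerivAt_potential (‖L w‖ ^ 2)).comp_hasFDerivAt w h1
  rw [Real.sqrt_sq (norm_nonneg _)] at h2
  refine h2.congr_fderiv ?_
  ext v
  simp [smul_eq_mul]
  ring

/-! ### Integrals of functions of `D x w`: continuity and differentiability in `w`. -/

section ParametricIntegrals

variable {X E W F : Type*} [MeasurableSpace X] {μ : Measure X} [IsFiniteMeasure μ]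
  [NormedAddCommGroup E] [InnerProductSpace ℝ E] [FiniteDimensional ℝ E]
  [NormedAddCommGroup W] [NormedSpace ℝ W] [FiniteDimensional ℝ W]
  [NormedAddCommGroup F] [NormedSpace ℝ F]
  {D : X → W →L[ℝ] E}

/-- The operators `D x` lie in a fixed compact ball, where `ψ` is bounded. The same compactness
supplies the dominating constants in the next two lemmas. -/
lemma integrable_continuous_comp {G : Type*} [NormedAddCommGroup G] (hD : StronglyMeasurable D)
    {M : ℝ} (hM : ∀ x, ‖D x‖ ≤ M) {ψ : (W →L[ℝ] E) → G} (hψ : Continuous ψ) : Integrable (fun x => ψ (D x)) μ := by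
  have : ProperSpace (W →L[ℝ] E) := FiniteDimensional.proper ℝ _
  obtain ⟨C, hC⟩ := (isCompact_closedBall (0 : W →L[ℝ] E) M).exists_bound_of_continuousOn
    hψ.continuousOn
  exact Integrable.of_bound (hψ.comp_stronglyMeasurable hD).aestronglyMeasurable C
    (ae_of_all _ fun x => hC _ (by simpa using hM x))

lemma continuous_integral_continuous_comp (hD : StronglyMeasurable D) {M : ℝ}
    (hM : ∀ x, ‖D x‖ ≤ M) {ψ : W → (W →L[ℝ] E) → F} (hψ : Continuous (Function.uncurry ψ)) :
    Continuous fun w => ∫ x, ψ w (D x) ∂μ := by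
  have : ProperSpace (W →L[ℝ] E) := FiniteDimensional.proper ℝ _
  have : ProperSpace W := FiniteDimensional.proper ℝ _
  rw [continuous_iff_continuousAt]
  intro w₀
  obtain ⟨C, hC⟩ := ((isCompact_closedBall w₀ 1).prod
    (isCompact_closedBall (0 : W →L[ℝ] E) M)).exists_bound_of_continuousOn hψ.continuousOn
  refine continuousAt_of_dominated (bound := fun _ => C) ?_ ?_ (integrable_const _) ?_
  · exact Filter.Eventually.of_forall fun w =>
      ((hψ.comp (Continuous.prodMk_right w)).comp_stronglyMeasurable hD).aestronglyMeasurable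
  · filter_upwards [Metric.closedBall_mem_nhds w₀ one_pos] with w hw
    exact ae_of_all _ fun x => hC (w, D x) ⟨hw, by simpa using hM x⟩
  · exact ae_of_all _ fun x => (hψ.comp (Continuous.prodMk_left (D x))).continuousAt

lemma ForchheimerPoly.hasFDerivAt_integral_potential (g : ForchheimerPoly)
    (hD : StronglyMeasurable D) {M : ℝ} (hM : ∀ x, ‖D x‖ ≤ M) (w₀ : W) :
    HasFDerivAt (fun w => ∫ x, g.potential (‖D x w‖ ^ 2) ∂μ)
      (∫ x, (2 * g.K ‖D x w₀‖) • (innerSL ℝ (D x w₀)).comp (D x) ∂μ) w₀ := by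
  have : ProperSpace (W →L[ℝ] E) := FiniteDimensional.proper ℝ _
  have : ProperSpace W := FiniteDimensional.proper ℝ _
  have hpot : Continuous g.potential :=
    continuous_iff_continuousAt.2 fun y => (g.hasDerivAt_potential y).continuousAt
  have hψ : Continuous (fun z : W × (W →L[ℝ] E) =>
      (2 * g.K ‖z.2 z.1‖) • (innerSL ℝ (z.2 z.1)).comp z.2) := by
    have hev : Continuous fun z : W × (W →L[ℝ] E) => z.2 z.1 := by fun_prop
    refine (continuous_const.mul (g.continuous_K_comp hev.norm fun _ => norm_nonneg _)).smul ?_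
    exact ((innerSL ℝ).continuous.comp hev).clm_comp continuous_snd
  obtain ⟨C, hC⟩ := ((isCompact_closedBall w₀ 1).prod
    (isCompact_closedBall (0 : W →L[ℝ] E) M)).exists_bound_of_continuousOn hψ.continuousOn
  refine hasFDerivAt_integral_of_dominated_of_fderiv_le (bound := fun _ => C)
    (F' := fun w x => (2 * g.K ‖D x w‖) • (innerSL ℝ (D x w)).comp (D x))
    (Metric.closedBall_mem_nhds w₀ one_pos) ?_ ?_ ?_ ?_ (integrable_const _) ?_
  · refine Filter.Eventually.of_forall fun w => ?_
    have : Continuous fun L : W →L[ℝ] E => g.potential (‖L w‖ ^ 2) := by fun_prop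
    exact (this.comp_stronglyMeasurable hD).aestronglyMeasurable
  · have : Continuous fun L : W →L[ℝ] E => g.potential (‖L w₀‖ ^ 2) := by fun_prop
    exact integrable_continuous_comp hD hM this
  · exact ((hψ.comp (Continuous.prodMk_right w₀)).comp_stronglyMeasurable hD).aestronglyMeasurable
  · exact ae_of_all _ fun x w hw => hC (w, D x) ⟨hw, by simpa using hM x⟩
  · exact ae_of_all _ fun x w _ => g.hasFDerivAt_potential_norm_sq (D x) w

end ParametricIntegrals

/-! ### Pointwise bounds for the flux. -/

section PointwiseFlux

variable {E : Type*} [NormedAddCommGroup E] [InnerProductSpace ℝ E]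

/-- Young's inequality is applied to `K(|ξ|)|ξ| |η| ≤ C |ξ|^(β-1) |η|`. Replacing `|η|^β` by `1 +
|η|²`, possible since `β < 2`, is what lets the boundary data enter through Hilbert norms. -/
lemma ForchheimerPoly.exists_abs_flux_le (g : ForchheimerPoly) {ε : ℝ} (hε : 0 < ε) :
    ∃ C : ℝ, 0 < C ∧ ∀ ξ η : E,
      |g.K ‖ξ‖ * ⟪ξ, η⟫| ≤ ε * ‖ξ‖ ^ g.beta + C * (1 + ‖η‖ ^ 2) := by
  obtain ⟨C₀, hC₀, h₀⟩ := g.exists_root_le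
  obtain ⟨C, hC, h⟩ := exists_rpow_mul_le g.one_lt_beta (ε := ε / C₀) (by positivity)
  refine ⟨C₀ * C, by positivity, fun ξ η => ?_⟩
  have hK := (g.K_pos (norm_nonneg ξ)).le
  rw [abs_mul, abs_of_nonneg hK]
  have h2 : ‖η‖ ^ g.beta ≤ 1 + ‖η‖ ^ 2 := by
    have := rpow_le_one_add_rpow (norm_nonneg η) (by linarith [g.one_lt_beta]) g.beta_lt_two.le
    simpa using this
  calc g.K ‖ξ‖ * |⟪ξ, η⟫| ≤ g.K ‖ξ‖ * (‖ξ‖ * ‖η‖) :=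
        mul_le_mul_of_nonneg_left (abs_real_inner_le_norm ξ η) hK
    _ = g.root ‖ξ‖ * ‖η‖ := by rw [← mul_assoc, g.K_mul_self (norm_nonneg _)]
    _ ≤ C₀ * ‖ξ‖ ^ (g.beta - 1) * ‖η‖ :=
        mul_le_mul_of_nonneg_right (h₀ _ (norm_nonneg _)) (norm_nonneg _)
    _ = C₀ * (‖ξ‖ ^ (g.beta - 1) * ‖η‖) := by ring
    _ ≤ C₀ * (ε / C₀ * ‖ξ‖ ^ g.beta + C * ‖η‖ ^ g.beta) :=
        mul_le_mul_of_nonneg_left (h _ _ (norm_nonneg _) (norm_nonneg _)) hC₀.le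
    _ = ε * ‖ξ‖ ^ g.beta + C₀ * C * ‖η‖ ^ g.beta := by field_simp
    _ ≤ _ := by gcongr

/-- Half of the lower bound for `K(|ξ|)|ξ|²` absorbs the cross term with `η`. -/
lemma ForchheimerPoly.exists_flux_coercive (g : ForchheimerPoly) :
    ∃ c C : ℝ, 0 < c ∧ 0 < C ∧ ∀ ξ η : E,
      c * ‖ξ‖ ^ g.beta ≤ g.K ‖ξ‖ * ⟪ξ, ξ - η⟫ + C * (1 + ‖η‖ ^ 2) := by
  obtain ⟨c, C, hc, hC, h⟩ := g.exists_le_K_mul_sq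
  obtain ⟨C', hC', h'⟩ := g.exists_abs_flux_le (E := E) (ε := c / 2) (by positivity)
  refine ⟨c / 2, C + C', by positivity, by positivity, fun ξ η => ?_⟩
  have h1 := h _ (norm_nonneg ξ)
  have h2 := (abs_le.1 (h' ξ η)).2
  rw [inner_sub_right, real_inner_self_eq_norm_sq]
  nlinarith [sq_nonneg ‖η‖]

end PointwiseFlux

/-! ### Abstract Galerkin flows: integrability, projection and coercivity. -/

/-- The Galerkin system in a finite-dimensional space `W`, embedded into a Hilbert space by `j`,
with the gradient of `w : W` at the point `x` given by `D x w`. The solution is `u`, and `p` is the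
projection of the extended boundary values. -/
structure GalerkinFlow (g : ForchheimerPoly) {X : Type*} [MeasurableSpace X] (μ : Measure X)
    (E H W : Type*) [NormedAddCommGroup E] [InnerProductSpace ℝ E]
    [NormedAddCommGroup H] [InnerProductSpace ℝ H] [NormedAddCommGroup W] [NormedSpace ℝ W]
    (S B : ℝ) where
  D : X → W →L[ℝ] E
  bound : ℝ
  j : W →L[ℝ] H
  u : ℝ → W
  u_t : ℝ → W
  p : ℝ → W
  p_t : ℝ → W
  f : ℝ → H
  P : ℝ → ℝ
  P_t : ℝ → ℝ
  stronglyMeasurable_D : StronglyMeasurable D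
  norm_D_le : ∀ x, ‖D x‖ ≤ bound
  j_injective : Function.Injective j
  poincare : ∀ w, ∃ n, (∀ x, D x n = 0) ∧ ‖j (w - n)‖ ^ g.beta ≤ S * ∫ x, ‖D x w‖ ^ g.beta ∂μ
  continuousOn_u : ContinuousOn u (Ici 0)
  hasDerivAt_u : ∀ t, 0 < t → HasDerivAt u (u_t t) t
  continuousOn_p : ContinuousOn p (Ici 0)
  hasDerivAt_p : ∀ t, 0 < t → HasDerivAt p (p_t t) t
  continuousOn_f : ContinuousOn f (Ici 0)
  continuousOn_P : ContinuousOn P (Ici 0)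
  continuousOn_P_t : ContinuousOn P_t (Ici 0)
  P_nonneg : ∀ t, 0 ≤ P t
  P_t_nonneg : ∀ t, 0 ≤ P_t t
  integral_p_le : ∀ t, 0 ≤ t → ∫ x, ‖D x (p t)‖ ^ 2 ∂μ ≤ B * P t
  integral_p_t_le : ∀ t, 0 < t → ∫ x, ‖D x (p_t t)‖ ^ 2 ∂μ ≤ B * P_t t
  equation : ∀ t, 0 < t → ∀ w, ⟪j (u_t t), j w⟫ +
    ∫ x, g.K ‖D x (u t + p t)‖ * ⟪D x (u t + p t), D x w⟫ ∂μ = ⟪f t, j w⟫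

namespace GalerkinFlow

variable {g : ForchheimerPoly} {X : Type*} [MeasurableSpace X] {μ : Measure X} [IsFiniteMeasure μ]
  {E H W : Type*} [NormedAddCommGroup E] [InnerProductSpace ℝ E] [FiniteDimensional ℝ E]
  [NormedAddCommGroup H] [InnerProductSpace ℝ H]
  [NormedAddCommGroup W] [NormedSpace ℝ W] [FiniteDimensional ℝ W] {S B : ℝ}

section Static

variable (𝓕 : GalerkinFlow g μ E H W S B)

lemma integrable_comp {ψ : (W →L[ℝ] E) → ℝ} (hψ : Continuous ψ) :
    Integrable (fun x => ψ (𝓕.D x)) μ :=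
  integrable_continuous_comp 𝓕.stronglyMeasurable_D 𝓕.norm_D_le hψ

lemma integrable_rpow (w : W) : Integrable (fun x => ‖𝓕.D x w‖ ^ g.beta) μ := by
  have hb := g.one_lt_beta
  refine 𝓕.integrable_comp (ψ := fun L => ‖L w‖ ^ g.beta) ?_
  exact (Real.continuous_rpow_const (by linarith)).comp (by fun_prop)

lemma integrable_sq (w : W) : Integrable (fun x => ‖𝓕.D x w‖ ^ 2) μ :=
  𝓕.integrable_comp (ψ := fun L => ‖L w‖ ^ 2) (by fun_prop)

lemma integrable_flux (w v : W) :
    Integrable (fun x => g.K ‖𝓕.D x w‖ * ⟪𝓕.D x w, 𝓕.D x v⟫) μ := by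
  refine 𝓕.integrable_comp (ψ := fun L => g.K ‖L w‖ * ⟪L w, L v⟫) ?_
  exact (g.continuous_K_comp (by fun_prop) fun _ => norm_nonneg _).mul (by fun_prop)

lemma integrable_potential (w : W) : Integrable (fun x => g.potential (‖𝓕.D x w‖ ^ 2)) μ := by
  have hpot : Continuous g.potential :=
    continuous_iff_continuousAt.2 fun y => (g.hasDerivAt_potential y).continuousAt
  exact 𝓕.integrable_comp (ψ := fun L => g.potential (‖L w‖ ^ 2)) (by fun_prop)

lemma continuous_integral_rpow : Continuous fun w => ∫ x, ‖𝓕.D x w‖ ^ g.beta ∂μ := by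
  have hb := g.one_lt_beta
  refine continuous_integral_continuous_comp 𝓕.stronglyMeasurable_D 𝓕.norm_D_le
    (ψ := fun w L => ‖L w‖ ^ g.beta) ?_
  exact (Real.continuous_rpow_const (by linarith)).comp
    (show Continuous fun z : W × (W →L[ℝ] E) => ‖z.2 z.1‖ by fun_prop)

lemma continuous_integral_flux (v : W) :
    Continuous fun w => ∫ x, g.K ‖𝓕.D x w‖ * ⟪𝓕.D x w, 𝓕.D x v⟫ ∂μ := by
  refine continuous_integral_continuous_comp 𝓕.stronglyMeasurable_D 𝓕.norm_D_le
    (ψ := fun w L => g.K ‖L w‖ * ⟪L w, L v⟫) ?_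
  have h : Continuous fun z : W × (W →L[ℝ] E) => z.2 z.1 := by fun_prop
  have h' : Continuous fun z : W × (W →L[ℝ] E) => z.2 v := by fun_prop
  exact (g.continuous_K_comp h.norm fun _ => norm_nonneg _).mul (h.inner h')

lemma integral_rpow_nonneg (w : W) : 0 ≤ ∫ x, ‖𝓕.D x w‖ ^ g.beta ∂μ :=
  integral_nonneg fun _ => Real.rpow_nonneg (norm_nonneg _) _

lemma integral_one_add_sq (q : W) :
    ∫ x, (1 + ‖𝓕.D x q‖ ^ 2) ∂μ = μ.real univ + ∫ x, ‖𝓕.D x q‖ ^ 2 ∂μ := by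
  rw [integral_add (integrable_const _) (𝓕.integrable_sq q)]
  simp

lemma integral_sub_rpow_le (w q : W) : ∫ x, ‖𝓕.D x (w - q)‖ ^ g.beta ∂μ ≤
    4 * (∫ x, ‖𝓕.D x w‖ ^ g.beta ∂μ + (μ.real univ + ∫ x, ‖𝓕.D x q‖ ^ 2 ∂μ)) := by
  have hb := g.one_lt_beta
  have hb2 := g.beta_lt_two
  have hq : Integrable (fun x => 1 + ‖𝓕.D x q‖ ^ 2) μ :=
    (integrable_const _).add (𝓕.integrable_sq q)
  rw [← integral_one_add_sq, ← integral_add (𝓕.integrable_rpow w) hq, ← integral_const_mul]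
  refine integral_mono (𝓕.integrable_rpow _) (((𝓕.integrable_rpow w).add hq).const_mul 4)
    fun x => ?_
  have h1 : ‖𝓕.D x (w - q)‖ ≤ ‖𝓕.D x w‖ + ‖𝓕.D x q‖ := by
    rw [map_sub]; exact norm_sub_le _ _
  have h2 : ‖𝓕.D x q‖ ^ g.beta ≤ 1 + ‖𝓕.D x q‖ ^ 2 := by
    have := rpow_le_one_add_rpow (norm_nonneg (𝓕.D x q)) (by linarith) hb2.le
    simpa using this
  have h3 : (2 : ℝ) ^ g.beta ≤ 4 := by
    calc (2 : ℝ) ^ g.beta ≤ 2 ^ (2 : ℝ) :=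
          Real.rpow_le_rpow_of_exponent_le (by norm_num) hb2.le
      _ = 4 := by norm_num
  calc ‖𝓕.D x (w - q)‖ ^ g.beta ≤ (‖𝓕.D x w‖ + ‖𝓕.D x q‖) ^ g.beta :=
        Real.rpow_le_rpow (norm_nonneg _) h1 (by linarith)
    _ ≤ 2 ^ g.beta * (‖𝓕.D x w‖ ^ g.beta + ‖𝓕.D x q‖ ^ g.beta) :=
        add_rpow_le (norm_nonneg _) (norm_nonneg _) (by linarith)
    _ ≤ 4 * (‖𝓕.D x w‖ ^ g.beta + (1 + ‖𝓕.D x q‖ ^ 2)) := by gcongr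

/-- The `L²`-orthogonal projection onto the complement of the piecewise constants. -/
lemma exists_complement : ∃ Q : W →L[ℝ] W, (∀ x w, 𝓕.D x (Q w) = 𝓕.D x w) ∧
    (∀ w v, ⟪𝓕.j (w - Q w), 𝓕.j (Q v)⟫ = 0) ∧
    ∀ w, ‖𝓕.j (Q w)‖ ^ g.beta ≤ S * ∫ x, ‖𝓕.D x w‖ ^ g.beta ∂μ := by
  set N : Submodule ℝ W := ⨅ x, LinearMap.ker (𝓕.D x : W →ₗ[ℝ] E) with hN
  have hNmem : ∀ n, n ∈ N ↔ ∀ x, 𝓕.D x n = 0 := fun n => by simp [hN]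
  set K : Submodule ℝ H := N.map (𝓕.j : W →ₗ[ℝ] H) with hK
  obtain ⟨L, hL⟩ := LinearMap.exists_leftInverse_of_injective (𝓕.j : W →ₗ[ℝ] H)
    (LinearMap.ker_eq_bot.2 𝓕.j_injective)
  have hLj : ∀ w, L (𝓕.j w) = w := fun w => LinearMap.congr_fun hL w
  -- `T` is the orthogonal projection of `H` onto the image of the gradient kernel `N`, pulled back
  -- to `W` by the left inverse `L` of `j`; the operator sought is `id - T`.
  set T : W →ₗ[ℝ] W := L ∘ₗ (K.starProjection : H →ₗ[ℝ] H) ∘ₗ (𝓕.j : W →ₗ[ℝ] H) with hT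
  have hTN : ∀ w, T w ∈ N := fun w => by
    obtain ⟨n, hn, hnj⟩ := (Submodule.mem_map).1 (K.starProjection_apply_mem (𝓕.j w))
    have : T w = n := by
      change L (K.starProjection (𝓕.j w)) = n
      rw [← hnj]; exact hLj n
    rwa [this]
  have hjT : ∀ w, 𝓕.j (T w) = K.starProjection (𝓕.j w) := fun w => by
    obtain ⟨n, hn, hnj⟩ := (Submodule.mem_map).1 (K.starProjection_apply_mem (𝓕.j w))
    change 𝓕.j (L (K.starProjection (𝓕.j w))) = _
    rw [← hnj]
    exact congrArg 𝓕.j (hLj n)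
  have horth : ∀ n ∈ N, ∀ v, ⟪𝓕.j (v - T v), 𝓕.j n⟫ = 0 := fun n hn v => by
    rw [map_sub, hjT]
    exact K.starProjection_inner_eq_zero _ _ ⟨n, hn, rfl⟩
  refine ⟨LinearMap.toContinuousLinearMap (LinearMap.id - T), fun x w => ?_, fun w v => ?_,
    fun w => ?_⟩
  · simp [(hNmem _).1 (hTN w) x]
  · have := horth _ (hTN w) v
    rw [real_inner_comm]
    simpa using this
  · obtain ⟨n, hn, hle⟩ := 𝓕.poincare w
    refine le_trans (Real.rpow_le_rpow (norm_nonneg _) ?_ (by linarith [g.one_lt_beta])) hle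
    -- `T w` is the best approximation of `w` in `N`, so the bound known for some `n` passes to `T
    -- w`.
    have h0 := horth (T w - n) (N.sub_mem (hTN w) ((hNmem n).2 hn)) w
    have := norm_le_norm_add_of_inner_eq_zero h0
    rw [← map_add, sub_add_sub_cancel] at this
    simpa using this

end Static

/-- Integrated `ForchheimerPoly.exists_flux_coercive`. The constants are fixed before the measure
space and the flow, hence cannot depend on the mesh. It will be used with `w = u + p` and `q = p`,
so that the test gradient is that of `u`. -/
lemma exists_coercive (g : ForchheimerPoly) (E : Type*) [NormedAddCommGroup E]
    [InnerProductSpace ℝ E] [FiniteDimensional ℝ E] :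
    ∃ c C : ℝ, 0 < c ∧ 0 < C ∧ ∀ {X : Type*} [MeasurableSpace X] {μ : Measure X}
      [IsFiniteMeasure μ] {H : Type*} [NormedAddCommGroup H] [InnerProductSpace ℝ H] {W : Type*}
      [NormedAddCommGroup W] [NormedSpace ℝ W] [FiniteDimensional ℝ W] {S B : ℝ}
      (𝓕 : GalerkinFlow g μ E H W S B) (w q : W),
      c * ∫ x, ‖𝓕.D x w‖ ^ g.beta ∂μ ≤
        ∫ x, g.K ‖𝓕.D x w‖ * ⟪𝓕.D x w, 𝓕.D x (w - q)⟫ ∂μ +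
          C * (μ.real univ + ∫ x, ‖𝓕.D x q‖ ^ 2 ∂μ) := by
  obtain ⟨c, C, hc, hC, h⟩ := g.exists_flux_coercive (E := E)
  refine ⟨c, C, hc, hC, ?_⟩
  intro X _ μ _ H _ _ W _ _ _ S B 𝓕 w q
  have hq : Integrable (fun x => C * (1 + ‖𝓕.D x q‖ ^ 2)) μ :=
    ((integrable_const _).add (𝓕.integrable_sq q)).const_mul C
  rw [← integral_one_add_sq, ← integral_const_mul, ← integral_const_mul,
    ← integral_add (𝓕.integrable_flux _ _) hq]
  refine integral_mono ((𝓕.integrable_rpow w).const_mul c)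
    ((𝓕.integrable_flux _ _).add hq) fun x => ?_
  simpa using h (𝓕.D x w) (𝓕.D x q)

/-- Bounds the term with the gradient of `p_t` that remains after testing with `u_t`. The
coefficient of the first integral need not be small, since that integral is already controlled in
time mean. -/
lemma exists_flux_le (g : ForchheimerPoly) (E : Type*) [NormedAddCommGroup E]
    [InnerProductSpace ℝ E] [FiniteDimensional ℝ E] :
    ∃ C : ℝ, 0 < C ∧ ∀ {X : Type*} [MeasurableSpace X] {μ : Measure X}
      [IsFiniteMeasure μ] {H : Type*} [NormedAddCommGroup H] [InnerProductSpace ℝ H] {W : Type*}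
      [NormedAddCommGroup W] [NormedSpace ℝ W] [FiniteDimensional ℝ W] {S B : ℝ}
      (𝓕 : GalerkinFlow g μ E H W S B) (w q : W),
      ∫ x, g.K ‖𝓕.D x w‖ * ⟪𝓕.D x w, 𝓕.D x q⟫ ∂μ ≤
        ∫ x, ‖𝓕.D x w‖ ^ g.beta ∂μ + C * (μ.real univ + ∫ x, ‖𝓕.D x q‖ ^ 2 ∂μ) := by
  obtain ⟨C, hC, h⟩ := g.exists_abs_flux_le (E := E) one_pos
  refine ⟨C, hC, ?_⟩
  intro X _ μ _ H _ _ W _ _ _ S B 𝓕 w q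
  have hq : Integrable (fun x => C * (1 + ‖𝓕.D x q‖ ^ 2)) μ :=
    ((integrable_const _).add (𝓕.integrable_sq q)).const_mul C
  rw [← integral_one_add_sq, ← integral_const_mul, ← integral_add (𝓕.integrable_rpow w) hq]
  refine integral_mono (𝓕.integrable_flux _ _) ((𝓕.integrable_rpow w).add hq) fun x => ?_
  have := (abs_le.1 (h (𝓕.D x w) (𝓕.D x q))).2
  simpa using this

/-- The energy and `∫|∇ρ_h|^β` are comparable up to a multiple of the total mass, which translates
energy bounds into gradient bounds and back. -/
lemma exists_potential_bounds (g : ForchheimerPoly) :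
    ∃ c C : ℝ, 0 < c ∧ 0 < C ∧ ∀ {X : Type*} [MeasurableSpace X] {μ : Measure X}
      [IsFiniteMeasure μ] {E : Type*} [NormedAddCommGroup E] [InnerProductSpace ℝ E]
      [FiniteDimensional ℝ E] {H : Type*} [NormedAddCommGroup H] [InnerProductSpace ℝ H] {W : Type*}
      [NormedAddCommGroup W] [NormedSpace ℝ W] [FiniteDimensional ℝ W] {S B : ℝ}
      (𝓕 : GalerkinFlow g μ E H W S B) (w : W),
      c * ∫ x, ‖𝓕.D x w‖ ^ g.beta ∂μ ≤
        ∫ x, g.potential (‖𝓕.D x w‖ ^ 2) ∂μ + C * μ.real univ ∧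
      ∫ x, g.potential (‖𝓕.D x w‖ ^ 2) ∂μ ≤ C * ∫ x, ‖𝓕.D x w‖ ^ g.beta ∂μ := by
  obtain ⟨c, C, hc, hC, h⟩ := g.exists_le_K_mul_sq
  obtain ⟨C', hC', h'⟩ := g.exists_potential_le
  refine ⟨c, max C C', hc, lt_max_of_lt_left hC, ?_⟩
  intro X _ μ _ E _ _ _ H _ _ W _ _ _ S B 𝓕 w
  constructor
  · have h0 : C * μ.real univ ≤ max C C' * μ.real univ :=
      mul_le_mul_of_nonneg_right (le_max_left _ _) measureReal_nonneg
    have h1 : C * μ.real univ = ∫ _, C ∂μ := by simp [mul_comm]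
    refine le_trans ?_ (add_le_add le_rfl h0)
    rw [h1, ← integral_const_mul, ← integral_add (𝓕.integrable_potential w) (integrable_const _)]
    refine integral_mono ((𝓕.integrable_rpow w).const_mul c)
      ((𝓕.integrable_potential w).add (integrable_const _)) fun x => ?_
    exact (h _ (norm_nonneg _)).trans
      (add_le_add (g.K_mul_sq_le_potential (norm_nonneg _)) le_rfl)
  · rw [← integral_const_mul]
    refine integral_mono (𝓕.integrable_potential w) ((𝓕.integrable_rpow w).const_mul _) fun x => ?_
    exact (h' _ (norm_nonneg _)).trans
      (mul_le_mul_of_nonneg_right (le_max_right _ _) (Real.rpow_nonneg (norm_nonneg _) _))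

end GalerkinFlow

/-! ### Differential inequalities for Galerkin flows. -/

namespace GalerkinFlow

variable {g : ForchheimerPoly} {X : Type*} [MeasurableSpace X] {μ : Measure X} [IsFiniteMeasure μ]
  {E H W : Type*} [NormedAddCommGroup E] [InnerProductSpace ℝ E] [FiniteDimensional ℝ E]
  [NormedAddCommGroup H] [InnerProductSpace ℝ H]
  [NormedAddCommGroup W] [NormedSpace ℝ W] [FiniteDimensional ℝ W] {S B : ℝ}

/-- The integral of `|∇ρ_h|^β` at time `t`. -/
def gradInt (𝓕 : GalerkinFlow g μ E H W S B) (t : ℝ) : ℝ :=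
  ∫ x, ‖𝓕.D x (𝓕.u t + 𝓕.p t)‖ ^ g.beta ∂μ

/-- The potential energy at time `t`. -/
def energy (𝓕 : GalerkinFlow g μ E H W S B) (t : ℝ) : ℝ :=
  ∫ x, g.potential (‖𝓕.D x (𝓕.u t + 𝓕.p t)‖ ^ 2) ∂μ

/-- The forcing `‖f̃‖^λ + ‖φ‖₁²`. -/
def forcing (𝓕 : GalerkinFlow g μ E H W S B) (t : ℝ) : ℝ := ‖𝓕.f t‖ ^ g.lam + 𝓕.P t

section Regularity

variable (𝓕 : GalerkinFlow g μ E H W S B)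

lemma gradInt_nonneg (t : ℝ) : 0 ≤ 𝓕.gradInt t := 𝓕.integral_rpow_nonneg _

lemma forcing_nonneg (t : ℝ) : 0 ≤ 𝓕.forcing t :=
  add_nonneg (Real.rpow_nonneg (norm_nonneg _) _) (𝓕.P_nonneg t)

lemma continuousOn_gradInt : ContinuousOn 𝓕.gradInt (Ici 0) :=
  𝓕.continuous_integral_rpow.comp_continuousOn (𝓕.continuousOn_u.add 𝓕.continuousOn_p)

lemma continuousOn_forcing : ContinuousOn 𝓕.forcing (Ici 0) := by
  refine ContinuousOn.add ?_ 𝓕.continuousOn_P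
  exact 𝓕.continuousOn_f.norm.rpow_const fun _ _ => Or.inr (by linarith [g.two_le_lam])

/-- Only differentiability of `u` is given. The equation, however, writes each pairing of `j u_t`
with `j w` as a continuous function of time, and these pairings separate points because `j` is
injective. -/
lemma continuousOn_u_t : ContinuousOn 𝓕.u_t (Ioi 0) := by
  refine continuousOn_of_separating
    (fun w : W => ((innerSL ℝ (𝓕.j w)).comp 𝓕.j : W →ₗ[ℝ] ℝ)) (fun v hv => ?_) fun w => ?_
  · have := hv v
    simp only [ContinuousLinearMap.coe_coe, ContinuousLinearMap.comp_apply, innerSL_apply_apply,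
      inner_self_eq_zero] at this
    exact 𝓕.j_injective (by rw [this, map_zero])
  · have h : ContinuousOn (fun t => ⟪𝓕.f t, 𝓕.j w⟫ -
        ∫ x, g.K ‖𝓕.D x (𝓕.u t + 𝓕.p t)‖ * ⟪𝓕.D x (𝓕.u t + 𝓕.p t), 𝓕.D x w⟫ ∂μ) (Ioi 0) := by
      refine ContinuousOn.mono ?_ Ioi_subset_Ici_self
      exact (𝓕.continuousOn_f.inner continuousOn_const).sub
        ((𝓕.continuous_integral_flux w).comp_continuousOn (𝓕.continuousOn_u.add 𝓕.continuousOn_p))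
    refine h.congr fun t ht => ?_
    have := 𝓕.equation t ht w
    simp only [ContinuousLinearMap.coe_coe, ContinuousLinearMap.comp_apply, innerSL_apply_apply]
    rw [real_inner_comm]
    linarith

lemma continuousOn_normSq_u_t : ContinuousOn (fun t => ‖𝓕.j (𝓕.u_t t)‖ ^ 2) (Ioi 0) :=
  ((𝓕.j.continuous.comp_continuousOn 𝓕.continuousOn_u_t).norm).pow 2

/-- Chain rule for the integrated potential along `u + p`; the derivative is twice the flux term
tested with `u_t + p_t`. -/
lemma hasDerivAt_energy {t : ℝ} (ht : 0 < t) : HasDerivAt 𝓕.energy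
    (2 * ∫ x, g.K ‖𝓕.D x (𝓕.u t + 𝓕.p t)‖ *
      ⟪𝓕.D x (𝓕.u t + 𝓕.p t), 𝓕.D x (𝓕.u_t t + 𝓕.p_t t)⟫ ∂μ) t := by
  have h1 := (g.hasFDerivAt_integral_potential (μ := μ) 𝓕.stronglyMeasurable_D 𝓕.norm_D_le
    (𝓕.u t + 𝓕.p t)).comp_hasDerivAt t ((𝓕.hasDerivAt_u t ht).add (𝓕.hasDerivAt_p t ht))
  refine h1.congr_deriv ?_
  rw [ContinuousLinearMap.integral_apply]
  · rw [← integral_const_mul]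
    refine integral_congr_ae (ae_of_all _ fun x => ?_)
    simp only [_root_.smul_apply, ContinuousLinearMap.comp_apply,
      innerSL_apply_apply, smul_eq_mul, mul_assoc]
  · refine integrable_continuous_comp 𝓕.stronglyMeasurable_D 𝓕.norm_D_le
      (ψ := fun L => (2 * g.K ‖L (𝓕.u t + 𝓕.p t)‖) • (innerSL ℝ (L (𝓕.u t + 𝓕.p t))).comp L) ?_
    have hev : Continuous fun L : W →L[ℝ] E => L (𝓕.u t + 𝓕.p t) := by fun_prop
    refine (continuous_const.mul (g.continuous_K_comp hev.norm fun _ => norm_nonneg _)).smul ?_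
    exact ((innerSL ℝ).continuous.comp hev).clm_comp continuous_id

lemma continuousOn_energy : ContinuousOn 𝓕.energy (Ioi 0) := fun _ ht =>
  (𝓕.hasDerivAt_energy ht).continuousAt.continuousWithinAt

end Regularity

lemma intervalIntegrable_of_Ici {F : ℝ → ℝ} (hF : ContinuousOn F (Ici 0)) {s t : ℝ} (hs : 0 ≤ s)
    (ht : 0 ≤ t) : IntervalIntegrable F volume s t :=
  (hF.mono (by
    intro x hx
    rcases le_total s t with h | h
    · rw [uIcc_of_le h] at hx; exact hs.trans hx.1
    · rw [uIcc_of_ge h] at hx; exact ht.trans hx.1)).intervalIntegrable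

lemma normSq_le_one_add_rpow_lam (g : ForchheimerPoly) {x : ℝ} (hx : 0 ≤ x) :
    x ^ 2 ≤ 1 + x ^ g.lam := by
  have := rpow_le_one_add_rpow hx (p := 2) (by norm_num) g.two_le_lam
  simpa using this

/-- Testing with the fluctuation of the solution. -/
lemma exists_dissipation (g : ForchheimerPoly) (E : Type*) [NormedAddCommGroup E]
    [InnerProductSpace ℝ E] [FiniteDimensional ℝ E] {X : Type*} [MeasurableSpace X]
    (μ : Measure X) [IsFiniteMeasure μ] {S B : ℝ} (hS : 0 < S) (hB : 0 < B) :
    ∃ c C : ℝ, 0 < c ∧ 0 < C ∧ ∀ {H : Type*} [NormedAddCommGroup H] [InnerProductSpace ℝ H]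
      {W : Type*} [NormedAddCommGroup W] [NormedSpace ℝ W] [FiniteDimensional ℝ W]
      (𝓕 : GalerkinFlow g μ E H W S B) (Q : W →L[ℝ] W) (_ : ∀ x w, 𝓕.D x (Q w) = 𝓕.D x w)
      (_ : ∀ w v, ⟪𝓕.j (w - Q w), 𝓕.j (Q v)⟫ = 0)
      (_ : ∀ w, ‖𝓕.j (Q w)‖ ^ g.beta ≤ S * ∫ x, ‖𝓕.D x w‖ ^ g.beta ∂μ) (t : ℝ) (_ : 0 < t),
      HasDerivAt (fun s => ‖𝓕.j (Q (𝓕.u s))‖ ^ 2) (2 * ⟪𝓕.j (𝓕.u_t t), 𝓕.j (Q (𝓕.u t))⟫) t ∧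
      2 * ⟪𝓕.j (𝓕.u_t t), 𝓕.j (Q (𝓕.u t))⟫ ≤ -c * 𝓕.gradInt t + C * (1 + 𝓕.forcing t) ∧
      ‖𝓕.j (Q (𝓕.u t))‖ ^ g.beta ≤ C * (𝓕.gradInt t + (1 + 𝓕.forcing t)) := by
  obtain ⟨c, C₁, hc, hC₁, hco⟩ := exists_coercive g E
  have hb := g.one_lt_beta
  have hlam : 1 < g.lam := by linarith [g.two_le_lam]
  -- The bound for the fluctuation carries the factor `4 S`, so `ε = c/(8S)` costs half of the
  -- coercivity constant `c`.
  obtain ⟨C₂, hC₂, hyo⟩ := exists_rpow_mul_le hlam (ε := c / (8 * S)) (by positivity)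
  set V := μ.real univ with hV
  have hV0 : 0 ≤ V := measureReal_nonneg
  set C₃ := 4 * S * (V + B + 1) with hC₃
  refine ⟨c, C₃ + 2 * C₁ * (V + B) + c * (V + B) + 2 * C₂, hc, by positivity, ?_⟩
  intro H _ _ W _ _ _ 𝓕 Q hDQ hQ hP t ht
  have hA := 𝓕.gradInt_nonneg t
  have hF := 𝓕.forcing_nonneg t
  have hPt := 𝓕.P_nonneg t
  have hft : 0 ≤ ‖𝓕.f t‖ ^ g.lam := Real.rpow_nonneg (norm_nonneg _) _
  have hp := 𝓕.integral_p_le t ht.le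
  set Z := ‖𝓕.j (Q (𝓕.u t))‖ with hZ
  have hZ0 : 0 ≤ Z := norm_nonneg _
  have hZle : Z ^ g.beta ≤ 4 * S * (𝓕.gradInt t + (V + B * 𝓕.P t)) := by
    have h1 := 𝓕.integral_sub_rpow_le (𝓕.u t + 𝓕.p t) (𝓕.p t)
    rw [add_sub_cancel_right] at h1
    calc Z ^ g.beta ≤ S * ∫ x, ‖𝓕.D x (𝓕.u t)‖ ^ g.beta ∂μ := hP _
      _ ≤ S * (4 * (𝓕.gradInt t + (V + ∫ x, ‖𝓕.D x (𝓕.p t)‖ ^ 2 ∂μ))) :=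
          mul_le_mul_of_nonneg_left h1 hS.le
      _ ≤ S * (4 * (𝓕.gradInt t + (V + B * 𝓕.P t))) := by gcongr
      _ = _ := by ring
  have hVB : V + B * 𝓕.P t ≤ (V + B) * (1 + 𝓕.P t) := by nlinarith [mul_nonneg hV0 hPt]
  have hFP : 1 + 𝓕.P t ≤ 1 + 𝓕.forcing t := by rw [forcing]; linarith
  refine ⟨?_, ?_, ?_⟩
  · have h1 : HasDerivAt (fun s => 𝓕.j (Q (𝓕.u s))) (𝓕.j (Q (𝓕.u_t t))) t :=
      (𝓕.j.comp Q).hasFDerivAt.comp_hasDerivAt t (𝓕.hasDerivAt_u t ht)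
    refine h1.norm_sq.congr_deriv ?_
    -- Orthogonality of `u_t - Q u_t` to `Q u` permits replacing `Q u_t` by `u_t`, which is the
    -- quantity in the equation.
    have h2 := hQ (𝓕.u_t t) (𝓕.u t)
    rw [map_sub, inner_sub_left] at h2
    rw [real_inner_comm]
    linarith
  · have h1 := 𝓕.equation t ht (Q (𝓕.u t))
    have h2 := hco 𝓕 (𝓕.u t + 𝓕.p t) (𝓕.p t)
    rw [add_sub_cancel_right] at h2
    simp only [hDQ] at h1
    have h3 : ⟪𝓕.f t, 𝓕.j (Q (𝓕.u t))⟫ ≤ Z * ‖𝓕.f t‖ := by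
      rw [mul_comm]; exact real_inner_le_norm _ _
    -- Young's inequality with exponent `λ` is applied to `Z^(β-1)`: by conjugacy `(β-1)(λ-1) = 1`
    -- and `(β-1)λ = β`, so it bounds `Z ‖f‖` by `Z^β` and `‖f‖^λ`.
    have h4 := hyo (Z ^ (g.beta - 1)) ‖𝓕.f t‖ (Real.rpow_nonneg hZ0 _) (norm_nonneg _)
    have h5 : (Z ^ (g.beta - 1)) ^ (g.lam - 1) = Z := by
      rw [← Real.rpow_mul hZ0, g.lam_eq]
      have : (g.beta - 1) * (g.beta / (g.beta - 1) - 1) = 1 := by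
        have : g.beta - 1 ≠ 0 := by linarith
        field_simp
        ring
      rw [this, Real.rpow_one]
    have h6 : (Z ^ (g.beta - 1)) ^ g.lam = Z ^ g.beta := by
      rw [← Real.rpow_mul hZ0, g.lam_eq, mul_div_cancel₀ _ (by linarith)]
    rw [h5, h6] at h4
    have h7 : c / (8 * S) * Z ^ g.beta ≤ c / 2 * (𝓕.gradInt t + (V + B * 𝓕.P t)) := by
      calc _ ≤ c / (8 * S) * (4 * S * (𝓕.gradInt t + (V + B * 𝓕.P t))) :=
            mul_le_mul_of_nonneg_left hZle (by positivity)
        _ = _ := by field_simp; ring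
    have h8 : c * 𝓕.gradInt t ≤ ∫ x, g.K ‖𝓕.D x (𝓕.u t + 𝓕.p t)‖ *
        ⟪𝓕.D x (𝓕.u t + 𝓕.p t), 𝓕.D x (𝓕.u t)⟫ ∂μ + C₁ * (V + B * 𝓕.P t) := by
      refine h2.trans (add_le_add le_rfl (mul_le_mul_of_nonneg_left ?_ hC₁.le))
      linarith
    have h9 : ⟪𝓕.j (𝓕.u_t t), 𝓕.j (Q (𝓕.u t))⟫ ≤ -(c / 2) * 𝓕.gradInt t +
        (C₁ + c / 2) * (V + B * 𝓕.P t) + C₂ * ‖𝓕.f t‖ ^ g.lam := by linarith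
    have h10 : (C₁ + c / 2) * (V + B * 𝓕.P t) ≤ (C₁ + c / 2) * ((V + B) * (1 + 𝓕.forcing t)) :=
      mul_le_mul_of_nonneg_left (hVB.trans (mul_le_mul_of_nonneg_left hFP (by positivity)))
        (by positivity)
    have h11 : C₂ * ‖𝓕.f t‖ ^ g.lam ≤ C₂ * (1 + 𝓕.forcing t) :=
      mul_le_mul_of_nonneg_left (by rw [forcing]; linarith) hC₂.le
    have h12 : 0 ≤ C₃ * (1 + 𝓕.forcing t) := by positivity
    linarith
  · have h1 : V + B * 𝓕.P t ≤ (V + B) * (1 + 𝓕.forcing t) :=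
      hVB.trans (mul_le_mul_of_nonneg_left hFP (by positivity))
    have h2 : 0 ≤ 2 * C₁ * (V + B) + c * (V + B) + 2 * C₂ := by positivity
    calc Z ^ g.beta ≤ 4 * S * (𝓕.gradInt t + (V + B) * (1 + 𝓕.forcing t)) :=
          hZle.trans (by gcongr)
      _ ≤ 4 * S * ((V + B + 1) * (𝓕.gradInt t + (1 + 𝓕.forcing t))) := by
          refine mul_le_mul_of_nonneg_left ?_ (by positivity)
          nlinarith [mul_nonneg (add_nonneg hV0 hB.le) hA]
      _ = C₃ * (𝓕.gradInt t + (1 + 𝓕.forcing t)) := by rw [hC₃]; ring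
      _ ≤ _ := by
          refine mul_le_mul_of_nonneg_right ?_ (by positivity)
          linarith

/-- Testing with the time derivative of the solution. -/
lemma exists_energy_deriv_le (g : ForchheimerPoly) (E : Type*) [NormedAddCommGroup E]
    [InnerProductSpace ℝ E] [FiniteDimensional ℝ E] {X : Type*} [MeasurableSpace X]
    (μ : Measure X) [IsFiniteMeasure μ] {S B : ℝ} (hB : 0 < B) :
    ∃ C : ℝ, 0 < C ∧ ∀ {H : Type*} [NormedAddCommGroup H] [InnerProductSpace ℝ H]
      {W : Type*} [NormedAddCommGroup W] [NormedSpace ℝ W] [FiniteDimensional ℝ W]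
      (𝓕 : GalerkinFlow g μ E H W S B) (t : ℝ) (_ : 0 < t),
      2 * ∫ x, g.K ‖𝓕.D x (𝓕.u t + 𝓕.p t)‖ *
        ⟪𝓕.D x (𝓕.u t + 𝓕.p t), 𝓕.D x (𝓕.u_t t + 𝓕.p_t t)⟫ ∂μ ≤
      -‖𝓕.j (𝓕.u_t t)‖ ^ 2 + C * (𝓕.gradInt t + (1 + 𝓕.forcing t + 𝓕.P_t t)) := by
  obtain ⟨C₁, hC₁, hfl⟩ := exists_flux_le g E
  set V := μ.real univ with hV
  have hV0 : 0 ≤ V := measureReal_nonneg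
  refine ⟨2 + 1 + 2 * C₁ * (V + B), by positivity, ?_⟩
  intro H _ _ W _ _ _ 𝓕 t ht
  have hA := 𝓕.gradInt_nonneg t
  have hPt := 𝓕.P_t_nonneg t
  have hP := 𝓕.P_nonneg t
  have hF := 𝓕.forcing_nonneg t
  have hp := 𝓕.integral_p_t_le t ht
  have h1 := 𝓕.equation t ht (𝓕.u_t t)
  have h2 := hfl 𝓕 (𝓕.u t + 𝓕.p t) (𝓕.p_t t)
  have h3 : ∫ x, g.K ‖𝓕.D x (𝓕.u t + 𝓕.p t)‖ *
      ⟪𝓕.D x (𝓕.u t + 𝓕.p t), 𝓕.D x (𝓕.u_t t + 𝓕.p_t t)⟫ ∂μ =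
      ∫ x, g.K ‖𝓕.D x (𝓕.u t + 𝓕.p t)‖ * ⟪𝓕.D x (𝓕.u t + 𝓕.p t), 𝓕.D x (𝓕.u_t t)⟫ ∂μ +
      ∫ x, g.K ‖𝓕.D x (𝓕.u t + 𝓕.p t)‖ * ⟪𝓕.D x (𝓕.u t + 𝓕.p t), 𝓕.D x (𝓕.p_t t)⟫ ∂μ := by
    rw [← integral_add (𝓕.integrable_flux _ _) (𝓕.integrable_flux _ _)]
    refine integral_congr_ae (ae_of_all _ fun x => ?_)
    simp only [map_add, inner_add_right]
    ring
  rw [real_inner_self_eq_norm_sq] at h1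
  -- After doubling, this absorbs one of the two copies of `‖u_t‖²` and leaves the other with a
  -- negative sign.
  have h4 : ⟪𝓕.f t, 𝓕.j (𝓕.u_t t)⟫ ≤ ‖𝓕.f t‖ ^ 2 / 2 + ‖𝓕.j (𝓕.u_t t)‖ ^ 2 / 2 := by
    have := real_inner_le_norm (𝓕.f t) (𝓕.j (𝓕.u_t t))
    nlinarith [sq_nonneg (‖𝓕.f t‖ - ‖𝓕.j (𝓕.u_t t)‖)]
  have h5 : ‖𝓕.f t‖ ^ 2 ≤ 1 + 𝓕.forcing t := by
    have := normSq_le_one_add_rpow_lam g (norm_nonneg (𝓕.f t))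
    rw [forcing]; linarith
  have h6 : C₁ * (V + ∫ x, ‖𝓕.D x (𝓕.p_t t)‖ ^ 2 ∂μ) ≤
      C₁ * (V + B) * (1 + 𝓕.forcing t + 𝓕.P_t t) := by
    rw [mul_assoc]
    refine mul_le_mul_of_nonneg_left ?_ hC₁.le
    nlinarith [mul_nonneg hV0 hPt, mul_nonneg hV0 hF, mul_nonneg hB.le hF]
  have h7 : ∫ x, ‖𝓕.D x (𝓕.u t + 𝓕.p t)‖ ^ g.beta ∂μ = 𝓕.gradInt t := rfl
  have h8 : 0 ≤ C₁ * (V + B) * 𝓕.gradInt t := by positivity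
  rw [h7] at h2
  rw [h3]
  nlinarith

end GalerkinFlow

/-! ### A priori estimates for Galerkin flows. -/

namespace GalerkinFlow

variable {g : ForchheimerPoly} {X : Type*} [MeasurableSpace X] {μ : Measure X} [IsFiniteMeasure μ]
  {E H W : Type*} [NormedAddCommGroup E] [InnerProductSpace ℝ E] [FiniteDimensional ℝ E]
  [NormedAddCommGroup H] [InnerProductSpace ℝ H]
  [NormedAddCommGroup W] [NormedSpace ℝ W] [FiniteDimensional ℝ W] {S B : ℝ}

section Integrated

variable (𝓕 : GalerkinFlow g μ E H W S B)

/-- Integrated form of the dissipation inequality. -/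
lemma integral_gradInt_le_of_dissipation {y y' : ℝ → ℝ} {c C : ℝ}
    (hy : ContinuousOn y (Ici 0)) (hy0 : ∀ t, 0 ≤ y t) (hd : ∀ t, 0 < t → HasDerivAt y (y' t) t)
    (hle : ∀ t, 0 < t → y' t ≤ -c * 𝓕.gradInt t + C * (1 + 𝓕.forcing t)) {t : ℝ} (ht : 1 ≤ t) :
    c * ∫ τ in (t - 1)..t, 𝓕.gradInt τ ≤
      y (t - 1) + C * (1 + ∫ τ in (t - 1)..t, 𝓕.forcing τ) := by
  have h0 : 0 ≤ t - 1 := by linarith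
  have hsub : Icc (t - 1) t ⊆ Ici 0 := fun x hx => h0.trans hx.1
  have hA := intervalIntegrable_of_Ici 𝓕.continuousOn_gradInt h0 (by linarith : (0 : ℝ) ≤ t)
  have hF := intervalIntegrable_of_Ici 𝓕.continuousOn_forcing h0 (by linarith : (0 : ℝ) ≤ t)
  have h1 := intervalIntegral.sub_le_integral_of_hasDeriv_right_of_le (a := t - 1) (b := t)
    (g := y) (g' := y') (φ := fun τ => -c * 𝓕.gradInt τ + C * (1 + 𝓕.forcing τ))
    (by linarith) (hy.mono hsub)
    (fun x hx => (hd x (h0.trans_lt hx.1)).hasDerivWithinAt)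
    (by
      refine ContinuousOn.integrableOn_Icc (ContinuousOn.mono ?_ hsub)
      exact (continuousOn_const.mul 𝓕.continuousOn_gradInt).add
        (continuousOn_const.mul (continuousOn_const.add 𝓕.continuousOn_forcing)))
    (fun x hx => hle x (h0.trans_lt hx.1))
  rw [intervalIntegral.integral_add (hA.const_mul _)
    ((intervalIntegrable_const.add hF).const_mul _), intervalIntegral.integral_const_mul,
    intervalIntegral.integral_const_mul, intervalIntegral.integral_add intervalIntegrable_const hF,
    intervalIntegral.integral_const] at h1
  have h2 := hy0 t
  simp only [smul_eq_mul, mul_one, sub_sub_cancel] at h1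
  linarith

/-- Integrated form of the energy inequality, averaged over the initial time. -/
lemma integral_u_t_add_energy_le {C : ℝ} (hC : 0 ≤ C)
    (hle : ∀ t, 0 < t → 2 * ∫ x, g.K ‖𝓕.D x (𝓕.u t + 𝓕.p t)‖ *
        ⟪𝓕.D x (𝓕.u t + 𝓕.p t), 𝓕.D x (𝓕.u_t t + 𝓕.p_t t)⟫ ∂μ ≤
      -‖𝓕.j (𝓕.u_t t)‖ ^ 2 + C * (𝓕.gradInt t + (1 + 𝓕.forcing t + 𝓕.P_t t)))
    {C' : ℝ} (hC' : 0 ≤ C') (hen : ∀ t, 𝓕.energy t ≤ C' * 𝓕.gradInt t) {t : ℝ} (ht : 1 ≤ t) :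
    (∫ τ in (t - 1 / 2)..t, ‖𝓕.j (𝓕.u_t τ)‖ ^ 2) + 𝓕.energy t ≤
      (2 * C' + C) * (∫ τ in (t - 1)..t, 𝓕.gradInt τ) +
        C * (1 + ∫ τ in (t - 1)..t, (𝓕.forcing τ + 𝓕.P_t τ)) := by
  have h0 : 0 ≤ t - 1 := by linarith
  have ht0 : 0 ≤ t := by linarith
  have hA := intervalIntegrable_of_Ici 𝓕.continuousOn_gradInt h0 ht0
  have hFc : ContinuousOn (fun τ => 𝓕.forcing τ + 𝓕.P_t τ) (Ici 0) :=
    𝓕.continuousOn_forcing.add 𝓕.continuousOn_P_t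
  have hF := intervalIntegrable_of_Ici hFc h0 ht0
  have hRc : ContinuousOn (fun τ => C * (𝓕.gradInt τ + (1 + 𝓕.forcing τ + 𝓕.P_t τ))) (Ici 0) :=
    continuousOn_const.mul (𝓕.continuousOn_gradInt.add
      ((continuousOn_const.add 𝓕.continuousOn_forcing).add 𝓕.continuousOn_P_t))
  have hR0 : ∀ τ, 0 ≤ C * (𝓕.gradInt τ + (1 + 𝓕.forcing τ + 𝓕.P_t τ)) := fun τ => by
    have := 𝓕.gradInt_nonneg τ
    have := 𝓕.forcing_nonneg τ
    have := 𝓕.P_t_nonneg τ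
    positivity
  set J := ∫ τ in (t - 1)..t, C * (𝓕.gradInt τ + (1 + 𝓕.forcing τ + 𝓕.P_t τ)) with hJ
  set L := (∫ τ in (t - 1 / 2)..t, ‖𝓕.j (𝓕.u_t τ)‖ ^ 2) + 𝓕.energy t with hL
  -- Energy inequality on `[s, t]`. The interval of starting times is open because the energy is
  -- differentiated only at positive times, while `t - 1` may be zero.
  have key : ∀ s ∈ Ioo (t - 1) (t - 1 / 2), L - J ≤ C' * 𝓕.gradInt s := by
    intro s hs
    have hs0 : 0 < s := h0.trans_lt hs.1
    have hst : s ≤ t := by linarith [hs.2]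
    have hsub : Icc s t ⊆ Ioi 0 := fun x hx => hs0.trans_le hx.1
    have hU : IntervalIntegrable (fun τ => ‖𝓕.j (𝓕.u_t τ)‖ ^ 2) volume s t :=
      ContinuousOn.intervalIntegrable_of_Icc hst (𝓕.continuousOn_normSq_u_t.mono hsub)
    have hR := intervalIntegrable_of_Ici hRc hs0.le ht0
    have h1 := intervalIntegral.sub_le_integral_of_hasDeriv_right_of_le hst
      (g := 𝓕.energy) (φ := fun τ => -‖𝓕.j (𝓕.u_t τ)‖ ^ 2 +
        C * (𝓕.gradInt τ + (1 + 𝓕.forcing τ + 𝓕.P_t τ))) (𝓕.continuousOn_energy.mono hsub)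
      (fun x hx => (𝓕.hasDerivAt_energy (hs0.trans hx.1)).hasDerivWithinAt)
      (by
        refine ContinuousOn.integrableOn_Icc (ContinuousOn.mono ?_ hsub)
        exact 𝓕.continuousOn_normSq_u_t.neg.add (hRc.mono Ioi_subset_Ici_self))
      (fun x hx => hle x (hs0.trans hx.1))
    have hadd := intervalIntegral.integral_add hU.neg hR
    simp only [Pi.neg_apply] at hadd
    rw [hadd, intervalIntegral.integral_neg] at h1
    have h2 : ∫ τ in (t - 1 / 2)..t, ‖𝓕.j (𝓕.u_t τ)‖ ^ 2 ≤ ∫ τ in s..t, ‖𝓕.j (𝓕.u_t τ)‖ ^ 2 :=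
      intervalIntegral.integral_mono_interval hs.2.le (by linarith) le_rfl
        (ae_of_all _ fun _ => by positivity) hU
    have h3 : ∫ τ in s..t, C * (𝓕.gradInt τ + (1 + 𝓕.forcing τ + 𝓕.P_t τ)) ≤ J :=
      intervalIntegral.integral_mono_interval hs.1.le hst le_rfl
        (ae_of_all _ fun τ => hR0 τ) (intervalIntegrable_of_Ici hRc h0 ht0)
    have h4 := hen s
    linarith
  have hAs : IntervalIntegrable 𝓕.gradInt volume (t - 1) (t - 1 / 2) :=
    intervalIntegrable_of_Ici 𝓕.continuousOn_gradInt h0 (by linarith)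
  -- Averaging over starting times in an interval of length `1/2` replaces the initial energy by a
  -- time integral; this is the origin of `2 * C'`.
  have h5 := intervalIntegral.integral_mono_on_of_le_Ioo (by linarith : t - 1 ≤ t - 1 / 2)
    intervalIntegrable_const (hAs.const_mul C') key
  rw [intervalIntegral.integral_const, intervalIntegral.integral_const_mul] at h5
  have h6 : ∫ τ in (t - 1)..(t - 1 / 2), 𝓕.gradInt τ ≤ ∫ τ in (t - 1)..t, 𝓕.gradInt τ :=
    intervalIntegral.integral_mono_interval le_rfl (by linarith) (by linarith)
      (ae_of_all _ fun τ => 𝓕.gradInt_nonneg τ) hA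
  have h7 := mul_le_mul_of_nonneg_left h6 hC'
  have h8 : J = C * (∫ τ in (t - 1)..t, 𝓕.gradInt τ) +
      C * (1 + ∫ τ in (t - 1)..t, (𝓕.forcing τ + 𝓕.P_t τ)) := by
    simp only [hJ, add_assoc]
    rw [intervalIntegral.integral_const_mul, intervalIntegral.integral_add hA
      (intervalIntegrable_const.add hF), intervalIntegral.integral_add intervalIntegrable_const hF,
      intervalIntegral.integral_const]
    simp
    ring
  simp only [smul_eq_mul] at h5
  linarith

end Integrated

/-- The three a priori estimates for Galerkin flows. -/
theorem exists_estimates (g : ForchheimerPoly) (E : Type*) [NormedAddCommGroup E]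
    [InnerProductSpace ℝ E] [FiniteDimensional ℝ E] {X : Type*} [MeasurableSpace X]
    (μ : Measure X) [IsFiniteMeasure μ] {S B : ℝ} (hS : 0 < S) (hB : 0 < B) :
    ∃ C : ℝ, 0 < C ∧ ∀ {H : Type*} [NormedAddCommGroup H] [InnerProductSpace ℝ H]
      {W : Type*} [NormedAddCommGroup W] [NormedSpace ℝ W] [FiniteDimensional ℝ W]
      (𝓕 : GalerkinFlow g μ E H W S B) (t : ℝ) (_ : 1 ≤ t),
      (∫ τ in (t - 1)..t, 𝓕.gradInt τ ≤
        C * (1 + ‖𝓕.j (𝓕.u (t - 1))‖ ^ 2 + ∫ τ in (t - 1)..t, 𝓕.forcing τ)) ∧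
      ((∫ τ in (t - 1 / 2)..t, ‖𝓕.j (𝓕.u_t τ)‖ ^ 2) + 𝓕.gradInt t ≤
        C * (1 + ‖𝓕.j (𝓕.u (t - 1))‖ ^ 2 + ∫ τ in (t - 1)..t, (𝓕.forcing τ + 𝓕.P_t τ))) ∧
      (∀ e : ℝ, (∀ s ∈ Icc 0 t, 𝓕.forcing s ≤ e) →
        𝓕.gradInt t ≤ C * (1 + ‖𝓕.j (𝓕.u 0)‖ ^ 2 + e ^ (2 / g.beta) +
          ∫ τ in (t - 1)..t, 𝓕.P_t τ)) := by
  obtain ⟨c, C₁, hc, hC₁, hdiss⟩ := exists_dissipation g E μ hS hB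
  obtain ⟨C₂, hC₂, hener⟩ := exists_energy_deriv_le g E μ (S := S) hB
  obtain ⟨c₃, C₃, hc₃, hC₃, hpot⟩ := exists_potential_bounds g
  set V := μ.real univ with hV
  have hV0 : 0 ≤ V := measureReal_nonneg
  have hb := g.one_lt_beta
  have hb2 := g.beta_lt_two
  -- constants of the first two estimates, in terms of the fluctuation
  set A₁ := (1 + C₁) / c with hA₁
  have hA₁0 : 0 < A₁ := by positivity
  set m := min 1 c₃ with hm
  have hm0 : 0 < m := lt_min one_pos hc₃
  set A₂ := ((2 * C₃ + C₂) * A₁ + C₂ + C₃ * V) / m with hA₂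
  have hA₂0 : 0 < A₂ := by positivity
  -- `k` bounds the barrier level for `y` by `k (1 + e^(2/β))`; the second factor comes from
  -- `add_rpow_le`.
  set k := (C₁ * (1 + C₁ / c)) ^ (2 / g.beta) * 2 ^ (2 / g.beta) with hk
  have hk0 : 0 < k := by positivity
  set A₃ := A₂ * (3 + k) with hA₃
  have hA₃0 : 0 < A₃ := by positivity
  refine ⟨A₁ + A₂ + A₃, by positivity, ?_⟩
  intro H _ _ W _ _ _ 𝓕 t ht
  have h0 : 0 ≤ t - 1 := by linarith
  have ht0 : 0 ≤ t := by linarith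
  obtain ⟨Q, hDQ, hQ, hP⟩ := 𝓕.exists_complement
  set y : ℝ → ℝ := fun s => ‖𝓕.j (Q (𝓕.u s))‖ ^ 2 with hy
  -- By Pythagoras the fluctuation is no larger than the solution. The estimates are proved in terms
  -- of `y` first, because only `y` obeys a closed differential inequality.
  have hyle : ∀ s, y s ≤ ‖𝓕.j (𝓕.u s)‖ ^ 2 := fun s => by
    have h1 : ⟪𝓕.j (Q (𝓕.u s)), 𝓕.j (𝓕.u s - Q (𝓕.u s))⟫ = 0 := by
      rw [real_inner_comm]; exact hQ _ _
    have h2 := norm_le_norm_add_of_inner_eq_zero h1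
    rw [← map_add, add_sub_cancel] at h2
    exact pow_le_pow_left₀ (norm_nonneg _) h2 2
  have hy0 : ∀ s, 0 ≤ y s := fun s => by positivity
  have hyc : ContinuousOn y (Ici 0) :=
    (((𝓕.j.comp Q).continuous.comp_continuousOn 𝓕.continuousOn_u).norm).pow 2
  have hdis := hdiss 𝓕 Q hDQ hQ hP
  have hFi := intervalIntegrable_of_Ici 𝓕.continuousOn_forcing h0 ht0
  have hPi := intervalIntegrable_of_Ici 𝓕.continuousOn_P_t h0 ht0
  have hFn : 0 ≤ ∫ τ in (t - 1)..t, 𝓕.forcing τ :=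
    intervalIntegral.integral_nonneg (by linarith) fun τ _ => 𝓕.forcing_nonneg τ
  have hPn : 0 ≤ ∫ τ in (t - 1)..t, 𝓕.P_t τ :=
    intervalIntegral.integral_nonneg (by linarith) fun τ _ => 𝓕.P_t_nonneg τ
  have hUn : 0 ≤ ∫ τ in (t - 1 / 2)..t, ‖𝓕.j (𝓕.u_t τ)‖ ^ 2 :=
    intervalIntegral.integral_nonneg (by linarith) fun τ _ => by positivity
  have hsum : ∫ τ in (t - 1)..t, (𝓕.forcing τ + 𝓕.P_t τ) =
      (∫ τ in (t - 1)..t, 𝓕.forcing τ) + ∫ τ in (t - 1)..t, 𝓕.P_t τ :=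
    intervalIntegral.integral_add hFi hPi
  have est1 : ∫ τ in (t - 1)..t, 𝓕.gradInt τ ≤
      A₁ * (1 + y (t - 1) + ∫ τ in (t - 1)..t, 𝓕.forcing τ) := by
    have h1 := 𝓕.integral_gradInt_le_of_dissipation hyc hy0 (fun s hs => (hdis s hs).1)
      (fun s hs => (hdis s hs).2.1) ht
    rw [hA₁, div_mul_eq_mul_div, le_div_iff₀ hc, mul_comm _ c]
    have := mul_nonneg hC₁.le (hy0 (t - 1))
    linarith
  have est2 : (∫ τ in (t - 1 / 2)..t, ‖𝓕.j (𝓕.u_t τ)‖ ^ 2) + 𝓕.gradInt t ≤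
      A₂ * (1 + y (t - 1) + ∫ τ in (t - 1)..t, (𝓕.forcing τ + 𝓕.P_t τ)) := by
    have h1 := 𝓕.integral_u_t_add_energy_le hC₂.le (fun s hs => hener 𝓕 s hs) hC₃.le
      (fun s => (hpot 𝓕 _).2) ht
    have h2 : c₃ * 𝓕.gradInt t ≤ 𝓕.energy t + C₃ * V := (hpot 𝓕 _).1
    have h3 : m * (∫ τ in (t - 1 / 2)..t, ‖𝓕.j (𝓕.u_t τ)‖ ^ 2) ≤
        1 * ∫ τ in (t - 1 / 2)..t, ‖𝓕.j (𝓕.u_t τ)‖ ^ 2 :=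
      mul_le_mul_of_nonneg_right (min_le_left _ _) hUn
    have h4 : m * 𝓕.gradInt t ≤ c₃ * 𝓕.gradInt t :=
      mul_le_mul_of_nonneg_right (min_le_right _ _) (𝓕.gradInt_nonneg t)
    have h5 := mul_le_mul_of_nonneg_left est1 (show 0 ≤ 2 * C₃ + C₂ by positivity)
    rw [hA₂, div_mul_eq_mul_div, le_div_iff₀ hm0, hsum]
    rw [hsum] at h1
    have h6 : 0 ≤ ((2 * C₃ + C₂) * A₁) * ∫ τ in (t - 1)..t, 𝓕.P_t τ := by positivity
    have h7 : 0 ≤ C₂ * y (t - 1) := mul_nonneg hC₂.le (hy0 _)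
    have h8 : 0 ≤ (C₃ * V) * (y (t - 1) +
        ((∫ τ in (t - 1)..t, 𝓕.forcing τ) + ∫ τ in (t - 1)..t, 𝓕.P_t τ)) :=
      mul_nonneg (by positivity) (add_nonneg (hy0 _) (add_nonneg hFn hPn))
    linarith
  refine ⟨?_, ?_, ?_⟩
  · refine est1.trans ?_
    have := hyle (t - 1)
    have := hy0 (t - 1)
    gcongr
    linarith
  · refine est2.trans ?_
    have := hyle (t - 1)
    have := hy0 (t - 1)
    rw [hsum]
    gcongr
    linarith
  · intro e he
    have he0 : 0 ≤ e := (𝓕.forcing_nonneg 0).trans (he 0 ⟨le_rfl, ht0⟩)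
    have hee : 0 ≤ e ^ (2 / g.beta) := Real.rpow_nonneg he0 _
    -- Above this level the Poincaré bound forces `c * gradInt > C₁ (1 + e)`, and dissipation
    -- outweighs the forcing.
    have hbar : y (t - 1) ≤ max (y 0) ((C₁ * (1 + C₁ / c) * (1 + e)) ^ (2 / g.beta)) := by
      refine le_max_of_deriv_nonpos_of_lt h0 (hyc.mono fun x hx => hx.1)
        (fun s hs => (hdis s hs.1).1) fun s hs hlt => ?_
      obtain ⟨-, h1, h2⟩ := hdis s hs.1
      have hFe := he s ⟨hs.1.le, by linarith [hs.2]⟩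
      have hbase : 0 ≤ C₁ * (1 + C₁ / c) * (1 + e) := by positivity
      have h3 : C₁ * (1 + C₁ / c) * (1 + e) < ‖𝓕.j (Q (𝓕.u s))‖ ^ g.beta := by
        have h4 := Real.rpow_lt_rpow (Real.rpow_nonneg hbase _) hlt
          (show 0 < g.beta / 2 by linarith)
        rw [← Real.rpow_mul hbase, div_mul_div_cancel₀ (by linarith), div_self two_ne_zero,
          Real.rpow_one] at h4
        simp only [hy] at h4
        rw [← Real.rpow_natCast, ← Real.rpow_mul (norm_nonneg _)] at h4
        push_cast at h4
        rwa [mul_div_cancel₀ _ two_ne_zero] at h4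
      have h5 : C₁ * (1 + C₁ / c) * (1 + e) < C₁ * (𝓕.gradInt s + (1 + e)) :=
        h3.trans_le (h2.trans (by gcongr))
      have h6 : C₁ / c * (1 + e) < 𝓕.gradInt s := by
        rw [mul_assoc] at h5
        have := lt_of_mul_lt_mul_left h5 hC₁.le
        linarith
      rw [div_mul_eq_mul_div, div_lt_iff₀ hc] at h6
      have h7 : C₁ * (1 + 𝓕.forcing s) ≤ C₁ * (1 + e) := by gcongr
      linarith
    have hMle : (C₁ * (1 + C₁ / c) * (1 + e)) ^ (2 / g.beta) ≤ k * (1 + e ^ (2 / g.beta)) := by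
      rw [Real.mul_rpow (by positivity) (by positivity), hk, mul_assoc]
      refine mul_le_mul_of_nonneg_left ?_ (by positivity)
      simpa using add_rpow_le zero_le_one he0 (show 0 ≤ 2 / g.beta by positivity)
    have hyb : y (t - 1) ≤ ‖𝓕.j (𝓕.u 0)‖ ^ 2 + k * (1 + e ^ (2 / g.beta)) := by
      refine hbar.trans (max_le ?_ ?_)
      · exact (hyle 0).trans (le_add_of_nonneg_right (by positivity))
      · exact hMle.trans (le_add_of_nonneg_left (by positivity))
    -- The window has length one, and `e ≤ 1 + e^(2/β)` because `2/β ≥ 1`.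
    have hFint : ∫ τ in (t - 1)..t, 𝓕.forcing τ ≤ 1 + e ^ (2 / g.beta) := by
      have h1 := intervalIntegral.integral_mono_on (by linarith : t - 1 ≤ t) hFi
        (intervalIntegrable_const (c := e)) fun s hs => he s ⟨h0.trans hs.1, hs.2⟩
      rw [intervalIntegral.integral_const] at h1
      have h2 : e ≤ 1 + e ^ (2 / g.beta) := by
        have := rpow_le_one_add_rpow he0 zero_le_one
          (show 1 ≤ 2 / g.beta by rw [le_div_iff₀ (by linarith)]; linarith)
        rwa [Real.rpow_one] at this
      simp only [sub_sub_cancel, one_smul] at h1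
      linarith
    set U := ‖𝓕.j (𝓕.u 0)‖ ^ 2 with hU
    have hU0 : 0 ≤ U := by positivity
    set I := ∫ τ in (t - 1)..t, 𝓕.P_t τ with hI
    set ee := e ^ (2 / g.beta) with hee'
    have h9 : 𝓕.gradInt t ≤ A₃ * (1 + U + ee + I) := by
      calc 𝓕.gradInt t ≤ A₂ * (1 + y (t - 1) + ∫ τ in (t - 1)..t, (𝓕.forcing τ + 𝓕.P_t τ)) := by
            linarith
        _ ≤ A₂ * (1 + (U + k * (1 + ee)) + ((1 + ee) + I)) := by
            rw [hsum]; gcongr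
        _ ≤ A₂ * ((3 + k) * (1 + U + ee + I)) := by
            refine mul_le_mul_of_nonneg_left ?_ hA₂0.le
            nlinarith [mul_nonneg hk0.le hU0, mul_nonneg hk0.le hPn]
        _ = _ := by rw [hA₃]; ring
    refine h9.trans (mul_le_mul_of_nonneg_right (by linarith) (by positivity))

end GalerkinFlow

/-! ### Polynomials of bounded degree and their coefficient vectors. -/

lemma contDiff_eval_mvPolynomial {d : ℕ} (p : MvPolynomial (Fin d) ℝ) :
    ContDiff ℝ ∞ fun y : Euc d => MvPolynomial.eval (fun i => y i) p := by
  induction p using MvPolynomial.induction_on with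
  | C a => simpa using contDiff_const
  | add p q hp hq => simpa using hp.add hq
  | mul_X p i hp =>
    simp only [map_mul, MvPolynomial.eval_X]
    exact hp.mul (contDiff_piLp_apply 2)

/-- Affine factors of degree at most one are substituted into each monomial, so the total degree
does not rise. This lets every cell use coordinates centred at its own ball and scaled by `h`. -/
lemma exists_mvPolynomial_comp_affine {d r : ℕ} (p : MvPolynomial (Fin d) ℝ)
    (hp : p.totalDegree ≤ r) (s : ℝ) (b : Fin d → ℝ) :
    ∃ q : MvPolynomial (Fin d) ℝ, q.totalDegree ≤ r ∧
      ∀ x : Fin d → ℝ, MvPolynomial.eval x q = MvPolynomial.eval (fun i => s * x i + b i) p := by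
  refine ⟨∑ α ∈ p.support, MvPolynomial.C (p.coeff α) *
    ∏ i, (MvPolynomial.C s * MvPolynomial.X i + MvPolynomial.C (b i)) ^ α i, ?_, fun x => ?_⟩
  · refine MvPolynomial.totalDegree_finsetSum_le fun α hα => ?_
    refine (MvPolynomial.totalDegree_mul _ _).trans ?_
    rw [MvPolynomial.totalDegree_C, zero_add]
    refine (MvPolynomial.totalDegree_finsetProd _ _).trans ?_
    have h1 : ∀ i, ((MvPolynomial.C s * MvPolynomial.X i + MvPolynomial.C (b i) :
        MvPolynomial (Fin d) ℝ) ^ α i).totalDegree ≤ α i := fun i => by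
      refine (MvPolynomial.totalDegree_pow _ _).trans ?_
      have h2 : (MvPolynomial.C s * MvPolynomial.X i + MvPolynomial.C (b i) :
          MvPolynomial (Fin d) ℝ).totalDegree ≤ 1 := by
        refine (MvPolynomial.totalDegree_add _ _).trans (max_le ?_ (by simp))
        refine (MvPolynomial.totalDegree_mul _ _).trans ?_
        simp
      simpa using Nat.mul_le_mul_left (α i) h2
    calc _ ≤ ∑ i, α i := Finset.sum_le_sum fun i _ => h1 i
      _ = α.sum fun _ e => e := by rw [Finsupp.sum_fintype _ _ fun _ => rfl]
      _ ≤ p.totalDegree := MvPolynomial.le_totalDegree hα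
      _ ≤ r := hp
  · rw [MvPolynomial.eval_eq' (fun i => s * x i + b i) p, map_sum]
    refine Finset.sum_congr rfl fun α _ => ?_
    simp

/-- Coefficient vectors of polynomials of degree at most `r` in `d` variables. -/
abbrev PolyCoef (d r : ℕ) : Type :=
  Fin (Module.finrank ℝ (MvPolynomial.restrictTotalDegree (Fin d) ℝ r)) → ℝ

namespace PolyCoef

variable {d r : ℕ}

/-- The basis polynomials, as functions. -/
def basisFun (i : Fin (Module.finrank ℝ (MvPolynomial.restrictTotalDegree (Fin d) ℝ r)))
    (y : Euc d) : ℝ :=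
  MvPolynomial.eval (fun k => y k)
    (Module.finBasis ℝ (MvPolynomial.restrictTotalDegree (Fin d) ℝ r) i : MvPolynomial (Fin d) ℝ)

/-- Evaluation at a point. -/
def ev (y : Euc d) : PolyCoef d r →L[ℝ] ℝ :=
  ∑ i, basisFun i y • ContinuousLinearMap.proj i

/-- The gradient at a point. -/
def grad (y : Euc d) : PolyCoef d r →L[ℝ] Euc d :=
  ∑ i, (ContinuousLinearMap.proj i : PolyCoef d r →L[ℝ] ℝ).smulRight (gradient (basisFun i) y)

lemma contDiff_basisFun (i) : ContDiff ℝ ∞ (basisFun (d := d) (r := r) i) :=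
  contDiff_eval_mvPolynomial _

lemma continuous_ev : Continuous (ev : Euc d → PolyCoef d r →L[ℝ] ℝ) :=
  continuous_finsetSum _ fun i _ => (contDiff_basisFun i).continuous.smul continuous_const

lemma continuous_grad : Continuous (grad : Euc d → PolyCoef d r →L[ℝ] Euc d) := by
  refine continuous_finsetSum _ fun i _ => ?_
  have h : Continuous (gradient (basisFun (d := d) (r := r) i)) :=
    (InnerProductSpace.toDual ℝ (Euc d)).symm.continuous.comp
      ((contDiff_basisFun i).continuous_fderiv (by simp))
  exact ((ContinuousLinearMap.smulRightL ℝ (PolyCoef d r) (Euc d)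
    (ContinuousLinearMap.proj i)).continuous).comp h

lemma hasGradientAt_ev (q : PolyCoef d r) (y : Euc d) :
    HasGradientAt (fun y => ev y q) (grad y q) y := by
  have h : ∀ i, HasGradientAt (basisFun (r := r) i) (gradient (basisFun (r := r) i) y) y := fun i =>
    ((contDiff_basisFun (r := r) i).differentiable (by simp) y).hasGradientAt
  rw [hasGradientAt_iff_hasFDerivAt]
  have h2 : HasFDerivAt (fun y => ∑ i, basisFun i y * q i)
      (∑ i, q i • InnerProductSpace.toDual ℝ (Euc d) (gradient (basisFun i) y)) y :=
    HasFDerivAt.fun_sum fun i _ => (h i).hasFDerivAt.mul_const (q i)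
  have h3 : (fun y => ev y q) = fun y => ∑ i, basisFun i y * q i := by
    ext z; simp [ev]
  have h4 : InnerProductSpace.toDual ℝ (Euc d) (grad y q) =
      ∑ i, q i • InnerProductSpace.toDual ℝ (Euc d) (gradient (basisFun i) y) := by
    simp [grad, map_sum]
  rw [h3, h4]
  exact h2

lemma ev_eq (q : PolyCoef d r) (y : Euc d) : ev y q = MvPolynomial.eval (fun k => y k)
    (((Module.finBasis ℝ (MvPolynomial.restrictTotalDegree (Fin d) ℝ r)).equivFun.symm q :
      MvPolynomial.restrictTotalDegree (Fin d) ℝ r) : MvPolynomial (Fin d) ℝ) := by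
  simp only [Module.Basis.equivFun_symm_apply, ev, sum_apply]
  simp [basisFun, MvPolynomial.smul_eval, mul_comm]

lemma exists_ev_eq_eval {p : MvPolynomial (Fin d) ℝ} (hp : p.totalDegree ≤ r) :
    ∃ q : PolyCoef d r, ∀ y : Euc d, ev y q = MvPolynomial.eval (fun k => y k) p := by
  set b := Module.finBasis ℝ (MvPolynomial.restrictTotalDegree (Fin d) ℝ r)
  refine ⟨b.equivFun ⟨p, (MvPolynomial.mem_restrictTotalDegree _ _ p).2 hp⟩, fun y => ?_⟩
  rw [ev_eq, LinearEquiv.symm_apply_apply]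

lemma exists_totalDegree_le (q : PolyCoef d r) : ∃ p : MvPolynomial (Fin d) ℝ,
    p.totalDegree ≤ r ∧ ∀ y : Euc d, ev y q = MvPolynomial.eval (fun k => y k) p :=
  ⟨_, (MvPolynomial.mem_restrictTotalDegree _ _ _).1 (Subtype.property _), ev_eq q⟩

lemma exists_ev_eq_one : ∃ e : PolyCoef d r, ∀ y, ev y e = 1 := by
  obtain ⟨q, hq⟩ := exists_ev_eq_eval (d := d) (r := r) (p := 1) (by simp)
  exact ⟨q, fun y => by rw [hq, map_one]⟩

lemma grad_eq_zero {q : PolyCoef d r} {a : ℝ} (hq : ∀ y, ev y q = a) (y : Euc d) :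
    grad y q = 0 := by
  have h := hasGradientAt_ev q y
  have h2 : (fun y => ev y q) = fun _ => a := funext hq
  rw [h2] at h
  exact h.unique (hasGradientAt_const y a)

/-- An open set contains a box, that is, a product of infinite sets, and only the zero polynomial
vanishes there. -/
lemma eq_zero_of_ev_eq_zero {q : PolyCoef d r} {U : Set (Euc d)} (hU : IsOpen U)
    (hUn : U.Nonempty) (h : ∀ y ∈ U, ev y q = 0) : q = 0 := by
  obtain ⟨x, hx⟩ := hUn
  set b := Module.finBasis ℝ (MvPolynomial.restrictTotalDegree (Fin d) ℝ r)
  have hpre : (WithLp.toLp 2 : (Fin d → ℝ) → Euc d) ⁻¹' U ∈ nhds (WithLp.ofLp x) :=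
    (PiLp.continuous_toLp 2 fun _ : Fin d => ℝ).continuousAt.preimage_mem_nhds (hU.mem_nhds hx)
  obtain ⟨ε, hε, hball⟩ := Metric.mem_nhds_iff.1 hpre
  have key : ((b.equivFun.symm q : MvPolynomial.restrictTotalDegree (Fin d) ℝ r) :
      MvPolynomial (Fin d) ℝ) = 0 := by
    refine MvPolynomial.funext_set (fun i => Ioo (x i - ε) (x i + ε))
      (fun i => Ioo_infinite (by linarith)) fun z hz => ?_
    have hz' : z ∈ Metric.ball (WithLp.ofLp x) ε := by
      rw [Metric.mem_ball, dist_pi_lt_iff hε]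
      intro i
      have := hz i trivial
      rw [Real.dist_eq, abs_lt]
      constructor <;> linarith [this.1, this.2]
    have := h _ (hball hz')
    rw [ev_eq] at this
    simpa using this
  exact b.equivFun.symm.map_eq_zero_iff.1 (Subtype.ext key)

end PolyCoef

/-! ### Norm equivalence for polynomials on the reference ball. -/

/-- A positive homogeneous continuous function on a finite-dimensional space dominates a power of
the norm. -/
lemma exists_mul_norm_rpow_le {V : Type*} [NormedAddCommGroup V] [NormedSpace ℝ V]
    [FiniteDimensional ℝ V] {N : V → ℝ} {s : ℝ} (hs : 0 < s) (hN : Continuous N)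
    (hhom : ∀ (c : ℝ) v, 0 ≤ c → N (c • v) = c ^ s * N v) (hpos : ∀ v, v ≠ 0 → 0 < N v) :
    ∃ c : ℝ, 0 < c ∧ ∀ v, c * ‖v‖ ^ s ≤ N v := by
  have : ProperSpace V := FiniteDimensional.proper ℝ V
  have hN0 : N 0 = 0 := by
    have := hhom 0 0 le_rfl
    rwa [smul_zero, Real.zero_rpow hs.ne', zero_mul] at this
  rcases (Metric.sphere (0 : V) 1).eq_empty_or_nonempty with he | hne
  · refine ⟨1, one_pos, fun v => ?_⟩
    by_cases hv : v = 0
    · rw [hv, hN0, norm_zero, Real.zero_rpow hs.ne', mul_zero]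
    · have : ‖v‖⁻¹ • v ∈ Metric.sphere (0 : V) 1 := by
        simp [norm_smul, inv_mul_cancel₀ (norm_ne_zero_iff.2 hv)]
      rw [he] at this
      exact this.elim
  · obtain ⟨v₀, hv₀, hmin⟩ := (isCompact_sphere (0 : V) 1).exists_isMinOn hne hN.continuousOn
    refine ⟨N v₀, hpos _ (by rintro rfl; simp at hv₀), fun v => ?_⟩
    by_cases hv : v = 0
    · rw [hv, hN0, norm_zero, Real.zero_rpow hs.ne', mul_zero]
    · have hv' := norm_pos_iff.2 hv
      have hmem : ‖v‖⁻¹ • v ∈ Metric.sphere (0 : V) 1 := by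
        simp [norm_smul, inv_mul_cancel₀ hv'.ne']
      have h1 : N v₀ ≤ N (‖v‖⁻¹ • v) := hmin hmem
      have h2 := hhom ‖v‖ (‖v‖⁻¹ • v) hv'.le
      rw [smul_smul, mul_inv_cancel₀ hv'.ne', one_smul] at h2
      rw [h2, mul_comm]
      exact mul_le_mul_of_nonneg_left h1 (by positivity)

lemma eqOn_zero_of_setIntegral_eq_zero {d : ℕ} {F : Euc d → ℝ} (hF : Continuous F)
    (h0 : ∀ y, 0 ≤ F y) {σ : ℝ} (h : ∫ y in Metric.closedBall (0 : Euc d) σ, F y = 0) :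
    ∀ y ∈ Metric.ball (0 : Euc d) σ, F y = 0 := by
  have h1 : F =ᵐ[volume.restrict (Metric.closedBall (0 : Euc d) σ)] 0 :=
    (setIntegral_eq_zero_iff_of_nonneg_ae (ae_of_all _ h0)
      (hF.continuousOn.integrableOn_compact (isCompact_closedBall _ _))).1 h
  have h2 : F =ᵐ[volume.restrict (Metric.ball (0 : Euc d) σ)] 0 :=
    ae_restrict_of_ae_restrict_of_subset Metric.ball_subset_closedBall h1
  exact Measure.eqOn_open_of_ae_eq h2 Metric.isOpen_ball hF.continuousOn
    continuousOn_const

namespace PolyCoef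

variable {d : ℕ}

lemma exists_norm_le {F V : Type*} [NormedAddCommGroup F] [NormedSpace ℝ F] [NormedAddCommGroup V]
    [NormedSpace ℝ V] {L : Euc d → V →L[ℝ] F} (hL : Continuous L) :
    ∃ M : ℝ, 0 < M ∧ ∀ y ∈ Metric.closedBall (0 : Euc d) 1, ∀ v, ‖L y v‖ ≤ M * ‖v‖ := by
  obtain ⟨M, hM⟩ := (isCompact_closedBall (0 : Euc d) 1).exists_bound_of_continuousOn
    hL.continuousOn
  refine ⟨max M 1, lt_max_of_lt_right one_pos, fun y hy v => ?_⟩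
  exact ((L y).le_opNorm v).trans
    (mul_le_mul_of_nonneg_right ((hM y hy).trans (le_max_left _ _)) (norm_nonneg _))

/-- Comparison of a norm of coefficients with an integral over a ball. -/
lemma exists_mul_norm_rpow_le_integral {F V : Type*} [NormedAddCommGroup F] [NormedSpace ℝ F]
    [NormedAddCommGroup V] [NormedSpace ℝ V] [FiniteDimensional ℝ V] {L : Euc d → V →L[ℝ] F}
    (hL : Continuous L) {s σ : ℝ} (hs : 0 < s)
    (hinj : ∀ v, (∀ y ∈ Metric.ball (0 : Euc d) σ, L y v = 0) → v = 0) :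
    ∃ c : ℝ, 0 < c ∧ ∀ v, c * ‖v‖ ^ s ≤
      ∫ y in Metric.closedBall (0 : Euc d) σ, ‖L y v‖ ^ s := by
  have hcont : Continuous fun z : V × Euc d => ‖L z.2 z.1‖ ^ s :=
    (Real.continuous_rpow_const hs.le).comp
      ((hL.comp continuous_snd).clm_apply continuous_fst).norm
  refine exists_mul_norm_rpow_le hs ?_ (fun c v hc => ?_) fun v hv => ?_
  · exact continuous_parametric_integral_of_continuous hcont (isCompact_closedBall _ _)
  · rw [← integral_const_mul]
    refine integral_congr_ae (ae_of_all _ fun y => ?_)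
    simp only [map_smul, norm_smul, Real.norm_of_nonneg hc]
    exact Real.mul_rpow hc (norm_nonneg _)
  · refine lt_of_le_of_ne (integral_nonneg fun y => by positivity) fun h => hv ?_
    refine hinj v fun y hy => ?_
    have := eqOn_zero_of_setIntegral_eq_zero
      (hcont.comp (Continuous.prodMk_right v)) (fun y => Real.rpow_nonneg (norm_nonneg _) s) h.symm y hy
    have h2 : ‖L y v‖ ^ s = 0 := this
    rw [Real.rpow_eq_zero (norm_nonneg _) hs.ne'] at h2
    exact norm_eq_zero.1 h2

/-- Inverse inequality on the reference ball. -/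
lemma exists_grad_sq_le (d r : ℕ) {σ : ℝ} (hσ : 0 < σ) : ∃ C : ℝ, 0 < C ∧
    ∀ (q : PolyCoef d r), ∀ y ∈ Metric.closedBall (0 : Euc d) 1,
      ‖grad y q‖ ^ 2 ≤ C * ∫ z in Metric.closedBall (0 : Euc d) σ, (ev z q) ^ 2 := by
  obtain ⟨M, hM, hMle⟩ := exists_norm_le (d := d) (continuous_grad (r := r))
  obtain ⟨c, hc, hcle⟩ := exists_mul_norm_rpow_le_integral (d := d) (s := 2) (σ := σ)
    (continuous_ev (r := r)) two_pos fun v hv =>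
      eq_zero_of_ev_eq_zero Metric.isOpen_ball ⟨0, by simpa using hσ⟩ hv
  -- A cell, recentred and divided by `h`, lies in the unit ball and contains the ball of radius
  -- `σ`. Hence pointwise bounds `M` are taken on the former and integral lower bounds `c` on the
  -- latter.
  refine ⟨M ^ 2 / c, by positivity, fun q y hy => ?_⟩
  have h1 := hcle q
  simp only [Real.rpow_ofNat, Real.norm_eq_abs, sq_abs] at h1
  rw [div_mul_eq_mul_div, le_div_iff₀ hc]
  calc ‖grad y q‖ ^ 2 * c ≤ (M * ‖q‖) ^ 2 * c := by
        gcongr; exact hMle y hy q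
    _ = M ^ 2 * (c * ‖q‖ ^ 2) := by ring
    _ ≤ _ := by gcongr

/-- Sobolev–Poincaré inequality for polynomials on the reference ball. -/
lemma exists_sub_rpow_le (d r : ℕ) {σ b : ℝ} (hσ : 0 < σ) (hb : 0 < b) : ∃ C : ℝ, 0 < C ∧
    ∀ (q : PolyCoef d r), ∀ y ∈ Metric.closedBall (0 : Euc d) 1,
      |ev y q - ev 0 q| ^ b ≤ C * ∫ z in Metric.closedBall (0 : Euc d) σ, ‖grad z q‖ ^ b := by
  -- On polynomials vanishing at the origin the gradient is injective, so the integral of its power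
  -- controls the coefficients.
  set V := LinearMap.ker ((ev (0 : Euc d) : PolyCoef d r →L[ℝ] ℝ) : PolyCoef d r →ₗ[ℝ] ℝ) with hV
  obtain ⟨M, hM, hMle⟩ := exists_norm_le (d := d) (continuous_ev (r := r))
  have hL : Continuous fun y : Euc d => (grad y : PolyCoef d r →L[ℝ] Euc d).comp V.subtypeL :=
    continuous_grad.clm_comp continuous_const
  obtain ⟨c, hc, hcle⟩ := exists_mul_norm_rpow_le_integral (d := d) (s := b) (σ := σ) hL hb
    fun v hv => by
      have hv0 : ev (0 : Euc d) (v : PolyCoef d r) = 0 := v.2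
      refine Subtype.ext (eq_zero_of_ev_eq_zero (Metric.isOpen_ball (x := (0 : Euc d)) (ε := σ))
        ⟨0, by simpa using hσ⟩ fun y hy => ?_)
      rw [← hv0]
      refine Metric.isOpen_ball.is_const_of_fderiv_eq_zero (𝕜 := ℝ)
        (convex_ball (0 : Euc d) σ).isPreconnected (f := fun y => ev y (v : PolyCoef d r))
        (fun z _ => (hasGradientAt_ev _ z).differentiableAt.differentiableWithinAt)
        (fun z hz => ?_) hy (by simpa using hσ)
      rw [(hasGradientAt_ev _ z).hasFDerivAt.fderiv]
      have := hv z hz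
      simp only [ContinuousLinearMap.comp_apply, Submodule.subtypeL_apply] at this
      rw [this, map_zero]
      rfl
  obtain ⟨e, he⟩ := exists_ev_eq_one (d := d) (r := r)
  refine ⟨M ^ b / c, by positivity, fun q y hy => ?_⟩
  -- Subtracting the value at the origin keeps the gradient and puts the polynomial into `V`.
  set v : PolyCoef d r := q - ev (0 : Euc d) q • e with hv
  have hevv : ∀ z : Euc d, ev z v = ev z q - ev 0 q := fun z => by
    rw [hv, map_sub, map_smul, he, smul_eq_mul, mul_one]
  have hgv : ∀ z : Euc d, grad z v = grad z q := fun z => by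
    rw [hv, map_sub, map_smul, grad_eq_zero he, smul_zero, sub_zero]
  have hvV : v ∈ V := by
    change ev 0 v = 0
    rw [hevv, sub_self]
  have h1 := hcle ⟨v, hvV⟩
  simp only [ContinuousLinearMap.comp_apply, Submodule.subtypeL_apply, hgv] at h1
  have h2 := hMle y hy v
  rw [hevv, Real.norm_eq_abs] at h2
  have h3 : ‖(⟨v, hvV⟩ : V)‖ = ‖v‖ := rfl
  rw [h3] at h1
  rw [div_mul_eq_mul_div, le_div_iff₀ hc]
  calc |ev y q - ev 0 q| ^ b * c ≤ (M * ‖v‖) ^ b * c := by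
        gcongr
    _ = M ^ b * (c * ‖v‖ ^ b) := by rw [Real.mul_rpow hM.le (norm_nonneg _)]; ring
    _ ≤ _ := by gcongr

end PolyCoef

/-! ### Poincaré inequality for `H¹` functions on star-shaped sets. -/

/-- Jensen's inequality for the square of a lower Lebesgue integral. -/
lemma lintegral_sq_le {X : Type*} [MeasurableSpace X] {ν : Measure X} (hν : ν univ ≤ 1)
    {f : X → ENNReal} (hf : AEMeasurable f ν) : (∫⁻ x, f x ∂ν) ^ 2 ≤ ∫⁻ x, f x ^ 2 ∂ν := by
  have h := ENNReal.lintegral_mul_le_Lp_mul_Lq ν Real.HolderConjugate.two_two hf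
    (aemeasurable_const (b := (1 : ENNReal)))
  simp only [Pi.mul_apply, mul_one, ENNReal.rpow_ofNat, one_pow, lintegral_const, one_mul] at h
  have h1 : (ν univ) ^ (1 / 2 : ℝ) ≤ 1 := ENNReal.rpow_le_one hν (by norm_num)
  have h2 : ∫⁻ x, f x ∂ν ≤ (∫⁻ x, f x ^ 2 ∂ν) ^ (1 / 2 : ℝ) :=
    h.trans (mul_le_of_le_one_right' h1)
  calc (∫⁻ x, f x ∂ν) ^ 2 ≤ ((∫⁻ x, f x ^ 2 ∂ν) ^ (1 / 2 : ℝ)) ^ 2 := by gcongr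
    _ = ∫⁻ x, f x ^ 2 ∂ν := by
      rw [← ENNReal.rpow_natCast, ← ENNReal.rpow_mul]; norm_num

/-- The change of variables costs `s^(-d)`, which stays below `2^d` for `s ≥ 1/2`. -/
lemma lintegral_comp_smul_add {d : ℕ} {f : Euc d → ENNReal} (hf : Measurable f) {s : ℝ}
    (hs : 1 / 2 ≤ s) (v : Euc d) :
    ∫⁻ x, f (s • x + v) ≤ 2 ^ d * ∫⁻ x, f x := by
  have hs0 : 0 < s := by linarith
  have h1 : ∫⁻ x, f (s • x + v) = ∫⁻ z, f (z + v) ∂(Measure.map (fun x : Euc d => s • x) volume) :=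
    (lintegral_map (hf.comp (measurable_add_const v)) (measurable_const_smul s)).symm
  have h2 : Measure.map (fun x : Euc d => s • x) volume =
      ENNReal.ofReal |(s ^ d)⁻¹| • (volume : Measure (Euc d)) := by
    have := Measure.map_addHaar_smul (volume : Measure (Euc d)) hs0.ne'
    rwa [finrank_euclideanSpace_fin] at this
  rw [h1, h2, lintegral_smul_measure, lintegral_add_right_eq_self f v, smul_eq_mul]
  gcongr
  rw [abs_of_pos (by positivity), ← inv_pow]
  have h3 : s⁻¹ ≤ 2 := by
    rw [inv_le_comm₀ hs0 two_pos]; linarith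
  calc ENNReal.ofReal (s⁻¹ ^ d) ≤ ENNReal.ofReal (2 ^ d) :=
        ENNReal.ofReal_le_ofReal (pow_le_pow_left₀ (by positivity) h3 d)
    _ = 2 ^ d := by rw [ENNReal.ofReal_pow (by norm_num)]; norm_num

/-- The squared increment along a segment is controlled by the derivative on that segment. -/
lemma enorm_sub_sq_le_lintegral {d : ℕ} {φ : Euc d → ℝ} (hφ : ContDiff ℝ ∞ φ) {h : ℝ}
    {x y : Euc d} (hxy : ‖x - y‖ ≤ h) :
    ‖φ x - φ y‖ₑ ^ 2 ≤
      ENNReal.ofReal (h ^ 2) * ∫⁻ s in Icc (0 : ℝ) 1, ‖fderiv ℝ φ (y + s • (x - y))‖ₑ ^ 2 := by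
  have hh : 0 ≤ h := (norm_nonneg _).trans hxy
  have hline : Continuous fun s : ℝ => fderiv ℝ φ (y + s • (x - y)) :=
    (hφ.continuous_fderiv (by simp)).comp (by fun_prop)
  have hd : ∀ s : ℝ, HasDerivAt (fun s : ℝ => φ (y + s • (x - y)))
      (fderiv ℝ φ (y + s • (x - y)) (x - y)) s := fun s => by
    have h1 : HasDerivAt (fun s : ℝ => y + s • (x - y)) (x - y) s := by
      simpa using ((hasDerivAt_id s).smul_const (x - y)).const_add y
    exact (hφ.differentiable (by simp) _).hasFDerivAt.comp_hasDerivAt s h1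
  have hc : Continuous fun s : ℝ => fderiv ℝ φ (y + s • (x - y)) (x - y) :=
    hline.clm_apply continuous_const
  have h1 := intervalIntegral.integral_eq_sub_of_hasDerivAt (a := 0) (b := 1)
    (fun s _ => hd s) (hc.intervalIntegrable _ _)
  simp only [one_smul, add_sub_cancel, zero_smul, add_zero] at h1
  rw [intervalIntegral.integral_of_le zero_le_one, ← integral_Icc_eq_integral_Ioc] at h1
  have h2 : ‖φ x - φ y‖ₑ ≤
      ∫⁻ s in Icc (0 : ℝ) 1, ENNReal.ofReal h * ‖fderiv ℝ φ (y + s • (x - y))‖ₑ := by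
    rw [← h1]
    refine (enorm_integral_le_lintegral_enorm _).trans (lintegral_mono fun s => ?_)
    rw [← ofReal_norm, ← ofReal_norm, ← ENNReal.ofReal_mul hh, mul_comm]
    refine ENNReal.ofReal_le_ofReal ((ContinuousLinearMap.le_opNorm _ _).trans ?_)
    exact mul_le_mul_of_nonneg_left hxy (norm_nonneg _)
  rw [lintegral_const_mul _ hline.enorm.measurable] at h2
  calc ‖φ x - φ y‖ₑ ^ 2 ≤ (ENNReal.ofReal h *
        ∫⁻ s in Icc (0 : ℝ) 1, ‖fderiv ℝ φ (y + s • (x - y))‖ₑ) ^ 2 := by gcongr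
    _ = ENNReal.ofReal (h ^ 2) *
        (∫⁻ s in Icc (0 : ℝ) 1, ‖fderiv ℝ φ (y + s • (x - y))‖ₑ) ^ 2 := by
      rw [mul_pow, ENNReal.ofReal_pow hh]
    _ ≤ _ := by
      gcongr
      exact lintegral_sq_le (by simp) hline.enorm.measurable.aemeasurable

/-- A Poincaré inequality for smooth functions on a set which is star-shaped with respect to every
point of `B`. -/
lemma lintegral_lintegral_sub_sq_le_of_contDiff {d : ℕ} {φ : Euc d → ℝ} (hφ : ContDiff ℝ ∞ φ)
    {U B : Set (Euc d)} (hU : MeasurableSet U) (hB : MeasurableSet B) {h : ℝ}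
    (hstar : ∀ y ∈ B, StarConvex ℝ y U) (hdist : ∀ x ∈ U, ∀ y ∈ B, ‖x - y‖ ≤ h) :
    ∫⁻ x in U, ∫⁻ y in B, ‖φ x - φ y‖ₑ ^ 2 ≤
      ENNReal.ofReal (h ^ 2) * (2 ^ d * (volume U + volume B) *
        ∫⁻ z in U, ‖fderiv ℝ φ z‖ₑ ^ 2) := by
  set ψ : Euc d → ENNReal := U.indicator fun z => ‖fderiv ℝ φ z‖ₑ ^ 2 with hψ
  have hψm : Measurable ψ :=
    (((hφ.continuous_fderiv (by simp)).enorm.measurable).pow_const 2).indicator hU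
  have hψi : ∫⁻ z, ψ z = ∫⁻ z in U, ‖fderiv ℝ φ z‖ₑ ^ 2 := lintegral_indicator hU _
  rw [← hψi]
  set Ψ := ∫⁻ z, ψ z
  have hseg : ∀ x ∈ U, ∀ y ∈ B, ‖φ x - φ y‖ₑ ^ 2 ≤
      ENNReal.ofReal (h ^ 2) * ∫⁻ s in Icc (0 : ℝ) 1, ψ (y + s • (x - y)) := by
    intro x hx y hy
    refine (enorm_sub_sq_le_lintegral hφ (hdist x hx y hy)).trans (mul_le_mul_right ?_ _)
    refine setLIntegral_mono' measurableSet_Icc fun s hs => ?_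
    have : y + s • (x - y) ∈ U := (hstar y hy).add_smul_sub_mem hx hs.1 hs.2
    simp [hψ, this]
  have hm3 : Measurable fun z : (Euc d × ℝ) × Euc d => ψ (z.2 + z.1.2 • (z.1.1 - z.2)) := by
    refine hψm.comp (Continuous.measurable ?_)
    fun_prop
  calc ∫⁻ x in U, ∫⁻ y in B, ‖φ x - φ y‖ₑ ^ 2
      ≤ ∫⁻ x in U, ∫⁻ y in B, ENNReal.ofReal (h ^ 2) *
          ∫⁻ s in Icc (0 : ℝ) 1, ψ (y + s • (x - y)) :=
        setLIntegral_mono' hU fun x hx => setLIntegral_mono' hB fun y hy => hseg x hx y hy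
    _ = ENNReal.ofReal (h ^ 2) * ∫⁻ x in U, ∫⁻ y in B,
          ∫⁻ s in Icc (0 : ℝ) 1, ψ (y + s • (x - y)) := by
        simp_rw [lintegral_const_mul' _ _ ENNReal.ofReal_ne_top]
    _ = ENNReal.ofReal (h ^ 2) * ∫⁻ x in U, ∫⁻ s in Icc (0 : ℝ) 1,
          ∫⁻ y in B, ψ (y + s • (x - y)) := by
        congr 1
        refine lintegral_congr fun x => lintegral_lintegral_swap ?_
        refine (hψm.comp (Continuous.measurable ?_)).aemeasurable
        fun_prop
    _ = ENNReal.ofReal (h ^ 2) * ∫⁻ s in Icc (0 : ℝ) 1, ∫⁻ x in U,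
          ∫⁻ y in B, ψ (y + s • (x - y)) := by
        congr 1
        refine lintegral_lintegral_swap (Measurable.aemeasurable ?_)
        exact hm3.lintegral_prod_right'
    _ ≤ ENNReal.ofReal (h ^ 2) * ∫⁻ s in Icc (0 : ℝ) 1,
          2 ^ d * (volume U + volume B) * Ψ := by
        refine mul_le_mul_right (lintegral_mono fun s => ?_) _
        -- The point `(1-s) y + s x` is taken as a new variable in place of `y` for `s ≤ 1/2` and in
        -- place of `x` for `s ≥ 1/2`, so the dilation factor is never below `1/2`.
        rcases le_total s (1 / 2) with hs | hs
        · calc ∫⁻ x in U, ∫⁻ y in B, ψ (y + s • (x - y))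
              ≤ ∫⁻ x in U, 2 ^ d * Ψ := by
                refine lintegral_mono fun x => (setLIntegral_le_lintegral B _).trans ?_
                have := lintegral_comp_smul_add hψm (show 1 / 2 ≤ 1 - s by linarith) (s • x)
                refine le_trans (le_of_eq (lintegral_congr fun y => ?_)) this
                congr 1
                module
            _ = 2 ^ d * volume U * Ψ := by rw [setLIntegral_const]; ring
            _ ≤ _ := by gcongr; exact le_self_add
        · calc ∫⁻ x in U, ∫⁻ y in B, ψ (y + s • (x - y))
              = ∫⁻ y in B, ∫⁻ x in U, ψ (y + s • (x - y)) := by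
                refine lintegral_lintegral_swap ?_
                refine (hψm.comp (Continuous.measurable ?_)).aemeasurable
                fun_prop
            _ ≤ ∫⁻ y in B, 2 ^ d * Ψ := by
                refine lintegral_mono fun y => (setLIntegral_le_lintegral U _).trans ?_
                have := lintegral_comp_smul_add hψm hs ((1 - s) • y)
                refine le_trans (le_of_eq (lintegral_congr fun x => ?_)) this
                congr 1
                module
            _ = 2 ^ d * volume B * Ψ := by rw [setLIntegral_const]; ring
            _ ≤ _ := by gcongr; exact le_add_self
    _ = _ := by rw [setLIntegral_const]; simp

/-- Extension by zero of an `L²` function on a bounded set. -/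
lemma locallyIntegrable_indicator_L2 {d : ℕ} {Ω : Set (Euc d)} (hΩo : IsOpen Ω)
    (hΩb : Bornology.IsBounded Ω) (φ : L2 Ω) : LocallyIntegrable (Ω.indicator φ) volume := by
  have : IsFiniteMeasure (volume.restrict Ω) := ⟨by simpa using hΩb.measure_lt_top⟩
  have h : Integrable φ (volume.restrict Ω) := (Lp.memLp φ).integrable (by norm_num)
  exact ((integrable_indicator_iff hΩo.measurableSet).2 h).locallyIntegrable

lemma fderiv_convolution_lsmul_apply {E : Type*} [NormedAddCommGroup E] [NormedSpace ℝ E]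
    [FiniteDimensional ℝ E] [MeasurableSpace E] [BorelSpace E] {μ : Measure E} [μ.IsAddHaarMeasure]
    {ρ f : E → ℝ} (hρ : ContDiff ℝ 1 ρ) (hρs : HasCompactSupport ρ) (hf : LocallyIntegrable f μ)
    (z v : E) :
    fderiv ℝ (convolution ρ f (ContinuousLinearMap.lsmul ℝ ℝ) μ) z v =
      ∫ x, fderiv ℝ ρ (z - x) v * f x ∂μ := by
  have hL := (hρs.fderiv ℝ).convolutionExists_left
    (ContinuousLinearMap.precompL E (ContinuousLinearMap.lsmul ℝ ℝ : ℝ →L[ℝ] ℝ →L[ℝ] ℝ))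
    (hρ.continuous_fderiv one_ne_zero) hf z
  rw [(hρs.hasFDerivAt_convolution_left (ContinuousLinearMap.lsmul ℝ ℝ) hρ hf z).fderiv,
    convolution_eq_swap, ContinuousLinearMap.integral_apply hL.integrable_swap]
  refine integral_congr_ae (ae_of_all _ fun x => ?_)
  simp only [ContinuousLinearMap.precompL_apply, ContinuousLinearMap.lsmul_apply, smul_eq_mul]

/-- The derivative of a mollified function is controlled by the weak gradient. -/
lemma enorm_fderiv_convolution_le {d : ℕ} {Ω V : Set (Euc d)} (hΩo : IsOpen Ω)
    (hΩb : Bornology.IsBounded Ω) {φ : L2 Ω} {G : L2Vec Ω} (hw : IsWeakGradient Ω φ G)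
    (hV : MeasurableSet V) (hVΩ : V ⊆ Ω) (b : ContDiffBump (0 : Euc d)) {z : Euc d}
    (hz : Metric.closedBall z b.rOut ⊆ V) :
    ‖fderiv ℝ (convolution (b.normed volume) (Ω.indicator φ)
      (ContinuousLinearMap.lsmul ℝ ℝ) volume) z‖ₑ ≤
      ∫⁻ x in V, ‖b.normed volume (z - x)‖ₑ * ‖G x‖ₑ := by
  set ρ := b.normed (volume : Measure (Euc d)) with hρ
  have hρc : ContDiff ℝ ∞ ρ := b.contDiff_normed
  have hρs : HasCompactSupport ρ := b.hasCompactSupport_normed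
  have hloc := locallyIntegrable_indicator_L2 hΩo hΩb φ
  have hsupp : ∀ x, x ∉ V → ρ (z - x) = 0 := fun x hx => by
    by_contra h
    have h1 : z - x ∈ Function.support ρ := h
    rw [hρ, b.support_normed_eq, Metric.mem_ball, dist_zero_right] at h1
    exact hx (hz (by rw [Metric.mem_closedBall, dist_comm, dist_eq_norm]; exact h1.le))
  set bound := ∫⁻ x in V, ‖ρ (z - x)‖ₑ * ‖G x‖ₑ with hbound
  have key : ∀ v : Euc d, ‖fderiv ℝ (convolution ρ (Ω.indicator φ)
      (ContinuousLinearMap.lsmul ℝ ℝ) volume) z v‖ₑ ≤ bound * ‖v‖ₑ := by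
    intro v
    have hη : ∀ x, fderiv ℝ (fun x => ρ (z - x)) x v = - fderiv ℝ ρ (z - x) v := fun x => by
      have h1 : HasFDerivAt (fun x : Euc d => z - x) (-ContinuousLinearMap.id ℝ (Euc d)) x := by
        simpa using (hasFDerivAt_id x).const_sub z
      have h2 := ((hρc.differentiable (by simp) (z - x)).hasFDerivAt.comp x h1).fderiv
      have h3 : (fun x => ρ (z - x)) = ρ ∘ fun x => z - x := rfl
      rw [h3, h2]
      simp
    have hηs : tsupport (fun x => ρ (z - x)) ⊆ Metric.closedBall z b.rOut := by
      refine closure_minimal (fun x hx => ?_) Metric.isClosed_closedBall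
      have h1 : z - x ∈ Function.support ρ := hx
      rw [hρ, b.support_normed_eq, Metric.mem_ball, dist_zero_right] at h1
      rw [Metric.mem_closedBall, dist_comm, dist_eq_norm]
      exact h1.le
    -- The reflected and translated bump is an admissible test function, since its support lies in
    -- the ball about `z`, inside `V ⊆ Ω`.
    have hweak := hw (fun x => ρ (z - x)) (hρc.comp (contDiff_const.sub contDiff_id))
      ((isCompact_closedBall z b.rOut).of_isClosed_subset (isClosed_tsupport _) hηs)
      (hηs.trans (hz.trans hVΩ)) v
    have h1 : fderiv ℝ (convolution ρ (Ω.indicator φ)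
        (ContinuousLinearMap.lsmul ℝ ℝ) volume) z v = ∫ x in Ω, ρ (z - x) * ⟪G x, v⟫ := by
      rw [fderiv_convolution_lsmul_apply (hρc.of_le (by simp)) hρs hloc]
      have h2 : ∀ x, fderiv ℝ ρ (z - x) v * Ω.indicator φ x =
          Ω.indicator (fun x => φ x * fderiv ℝ ρ (z - x) v) x := fun x => by
        by_cases hx : x ∈ Ω
        · simp [hx, mul_comm]
        · simp [hx]
      simp_rw [h2]
      rw [integral_indicator hΩo.measurableSet]
      simp_rw [hη, mul_neg] at hweak
      rw [integral_neg] at hweak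
      exact neg_injective hweak
    rw [h1]
    refine (enorm_integral_le_lintegral_enorm _).trans ?_
    rw [hbound, ← lintegral_mul_const' _ _ enorm_ne_top]
    have h4 : ∫⁻ x in V, ‖ρ (z - x)‖ₑ * ‖G x‖ₑ * ‖v‖ₑ =
        ∫⁻ x in Ω, V.indicator (fun x => ‖ρ (z - x)‖ₑ * ‖G x‖ₑ * ‖v‖ₑ) x := by
      rw [lintegral_indicator hV, Measure.restrict_restrict hV, inter_eq_left.2 hVΩ]
    rw [h4]
    refine lintegral_mono fun x => ?_
    by_cases hx : x ∈ V
    · rw [indicator_of_mem hx, enorm_mul, mul_assoc]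
      gcongr
      rw [← ofReal_norm, ← ofReal_norm, ← ofReal_norm, ← ENNReal.ofReal_mul (norm_nonneg _)]
      exact ENNReal.ofReal_le_ofReal (norm_inner_le_norm _ _)
    · simp [hx, hsupp x hx]
  by_cases hb : bound = ⊤
  · rw [hb]; exact le_top
  · rw [← ofReal_norm, ← ENNReal.ofReal_toReal hb]
    refine ENNReal.ofReal_le_ofReal (ContinuousLinearMap.opNorm_le_bound _ ENNReal.toReal_nonneg
      fun v => ?_)
    have h := ENNReal.toReal_mono (ENNReal.mul_ne_top hb enorm_ne_top) (key v)
    rwa [ENNReal.toReal_mul, toReal_enorm, toReal_enorm] at h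

/-- Mollification does not increase the `L²`-norm of the gradient. -/
lemma lintegral_enorm_fderiv_convolution_sq_le {d : ℕ} {Ω V U : Set (Euc d)} (hΩo : IsOpen Ω)
    (hΩb : Bornology.IsBounded Ω) {φ : L2 Ω} {G : L2Vec Ω} (hw : IsWeakGradient Ω φ G)
    (hV : MeasurableSet V) (hVΩ : V ⊆ Ω) (b : ContDiffBump (0 : Euc d)) (hU : MeasurableSet U)
    (hUV : ∀ z ∈ U, Metric.closedBall z b.rOut ⊆ V) :
    ∫⁻ z in U, ‖fderiv ℝ (convolution (b.normed volume) (Ω.indicator φ)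
      (ContinuousLinearMap.lsmul ℝ ℝ) volume) z‖ₑ ^ 2 ≤ ∫⁻ x in V, ‖G x‖ₑ ^ 2 := by
  set ρ := b.normed (volume : Measure (Euc d)) with hρ
  have hρm : Measurable fun x => ‖ρ x‖ₑ := b.continuous_normed.enorm.measurable
  have hρ1 : ∫⁻ x, ‖ρ x‖ₑ = 1 := by
    have h1 : ∀ x, ‖ρ x‖ₑ = ENNReal.ofReal (ρ x) := fun x =>
      Real.enorm_of_nonneg (b.nonneg_normed x)
    simp_rw [h1]
    rw [← ofReal_integral_eq_lintegral_ofReal b.integrable_normed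
      (ae_of_all _ b.nonneg_normed), b.integral_normed, ENNReal.ofReal_one]
  have hGm : AEMeasurable (fun x => ‖G x‖ₑ) (volume.restrict V) :=
    ((Lp.aestronglyMeasurable G).mono_measure (Measure.restrict_mono_set _ hVΩ)).enorm
  have hjensen : ∀ z ∈ U, ‖fderiv ℝ (convolution ρ (Ω.indicator φ)
      (ContinuousLinearMap.lsmul ℝ ℝ) volume) z‖ₑ ^ 2 ≤
        ∫⁻ x in V, ‖ρ (z - x)‖ₑ * ‖G x‖ₑ ^ 2 := by
    intro z hz
    have hw1 : Measurable fun x => ‖ρ (z - x)‖ₑ := hρm.comp (measurable_const.sub measurable_id)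
    -- The bump as a density gives mass at most one, so Jensen's inequality applies; Tonelli's
    -- theorem then integrates the bump out.
    set ν := (volume.restrict V).withDensity fun x => ‖ρ (z - x)‖ₑ with hν
    have hν1 : ν univ ≤ 1 := by
      rw [hν, withDensity_apply _ MeasurableSet.univ, Measure.restrict_univ]
      refine (setLIntegral_le_lintegral _ _).trans ?_
      rw [lintegral_sub_left_eq_self (fun x => ‖ρ x‖ₑ) z, hρ1]
    have hGν : AEMeasurable (fun x => ‖G x‖ₑ) ν := hGm.mono_ac (withDensity_absolutelyContinuous _ _)
    have h1 := enorm_fderiv_convolution_le hΩo hΩb hw hV hVΩ b (hUV z hz)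
    calc _ ≤ (∫⁻ x in V, ‖ρ (z - x)‖ₑ * ‖G x‖ₑ) ^ 2 := by gcongr
      _ = (∫⁻ x, ‖G x‖ₑ ∂ν) ^ 2 := by
        rw [hν, lintegral_withDensity_eq_lintegral_mul₀ hw1.aemeasurable hGm]
        rfl
      _ ≤ ∫⁻ x, ‖G x‖ₑ ^ 2 ∂ν := lintegral_sq_le hν1 hGν
      _ = _ := by
        rw [hν, lintegral_withDensity_eq_lintegral_mul₀ hw1.aemeasurable (hGm.pow_const 2)]
        rfl
  calc _ ≤ ∫⁻ z in U, ∫⁻ x in V, ‖ρ (z - x)‖ₑ * ‖G x‖ₑ ^ 2 := setLIntegral_mono' hU hjensen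
    _ ≤ ∫⁻ z, ∫⁻ x in V, ‖ρ (z - x)‖ₑ * ‖G x‖ₑ ^ 2 := setLIntegral_le_lintegral _ _
    _ = ∫⁻ x in V, ∫⁻ z, ‖ρ (z - x)‖ₑ * ‖G x‖ₑ ^ 2 := by
        have h1 : Measurable fun q : Euc d × Euc d => ‖ρ (q.1 - q.2)‖ₑ :=
          hρm.comp (measurable_fst.sub measurable_snd)
        have h2 : AEMeasurable (fun q : Euc d × Euc d => ‖G q.2‖ₑ ^ 2)
            (volume.prod (volume.restrict V)) := (hGm.pow_const 2).comp_snd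
        exact lintegral_lintegral_swap (h1.aemeasurable.mul h2)
    _ = ∫⁻ x in V, ‖G x‖ₑ ^ 2 := by
        refine lintegral_congr fun x => ?_
        have hx : Measurable fun z => ‖ρ (z - x)‖ₑ := hρm.comp (measurable_id.sub measurable_const)
        rw [lintegral_mul_const _ hx]
        have := lintegral_sub_right_eq_self (μ := volume) (fun z : Euc d => ‖ρ z‖ₑ) x
        rw [this, hρ1, one_mul]

section WeakPoincare

variable {d : ℕ} {Ω T : Set (Euc d)} {φ : L2 Ω} {G : L2Vec Ω} {c : Euc d} {ρ h : ℝ}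

/-- The points whose closed `δ`-neighbourhood lies in `T`. -/
def innerCore {d : ℕ} (T : Set (Euc d)) (δ : ℝ) : Set (Euc d) :=
  {x | Metric.closedBall x δ ⊆ T}

lemma isClosed_innerCore (hT : IsClosed T) (δ : ℝ) : IsClosed (innerCore T δ) := by
  have : innerCore T δ = ⋂ e ∈ Metric.closedBall (0 : Euc d) δ, (fun x => x + e) ⁻¹' T := by
    ext x
    simp only [innerCore, mem_ofPred_eq, mem_iInter, mem_preimage]
    constructor
    · intro hx e he
      exact hx (by simpa using he)
    · intro hx y hy
      have := hx (y - x) (by simpa [dist_eq_norm] using hy)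
      simpa using this
  rw [this]
  exact isClosed_biInter fun e _ => hT.preimage (by fun_prop)

lemma innerCore_subset {δ : ℝ} (hδ : 0 ≤ δ) : innerCore T δ ⊆ T := fun _ hx =>
  hx (Metric.mem_closedBall_self hδ)

lemma innerCore_anti {δ δ' : ℝ} (h : δ ≤ δ') : innerCore T δ' ⊆ innerCore T δ := fun _ hx =>
  (Metric.closedBall_subset_closedBall h).trans hx

/-- Any perturbation by at most `δ` of a point of the segment is obtained by translating both
endpoints. The translate of `y` stays in the large ball because `ρ/2 + δ ≤ ρ`, and that of `x` stays
in `T` because `x` is in the core. -/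
lemma starConvex_innerCore {δ : ℝ} (hδ : δ ≤ ρ / 2)
    (hstar : ∀ y ∈ Metric.closedBall c ρ, StarConvex ℝ y T) {y : Euc d}
    (hy : y ∈ Metric.closedBall c (ρ / 2)) : StarConvex ℝ y (innerCore T δ) := by
  intro x hx a b ha hb hab z hz
  have h1 : y + (z - (a • y + b • x)) ∈ Metric.closedBall c ρ := by
    rw [Metric.mem_closedBall, dist_eq_norm] at hy hz ⊢
    calc ‖y + (z - (a • y + b • x)) - c‖ = ‖(y - c) + (z - (a • y + b • x))‖ := by congr 1; abel
      _ ≤ ρ / 2 + δ := (norm_add_le _ _).trans (add_le_add hy hz)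
      _ ≤ ρ := by linarith
  have h2 : x + (z - (a • y + b • x)) ∈ T := by
    apply hx
    rw [Metric.mem_closedBall, dist_eq_norm] at hz ⊢
    rwa [add_sub_cancel_left]
  have h3 := hstar _ h1 h2 ha hb hab
  have h4 : a • (y + (z - (a • y + b • x))) + b • (x + (z - (a • y + b • x))) = z := by
    rw [smul_add, smul_add, add_add_add_comm, ← add_smul, hab, one_smul, add_sub_cancel]
  rwa [h4] at h3

/-- A double-integral form of the Poincaré inequality on the inner core of a star-shaped set. -/
lemma lintegral_innerCore_sub_sq_le (hΩo : IsOpen Ω) (hΩb : Bornology.IsBounded Ω)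
    (hw : IsWeakGradient Ω φ G) (hT : IsClosed T) (hTΩ : interior T ⊆ Ω)
    (hball : Metric.closedBall c ρ ⊆ T)
    (hstar : ∀ y ∈ Metric.closedBall c ρ, StarConvex ℝ y T) (hdiam : ∀ x ∈ T, ∀ y ∈ T, ‖x - y‖ ≤ h)
    {δ : ℝ} (hδ : 0 < δ) (hδρ : δ ≤ ρ / 2) :
    ∫⁻ x in innerCore T δ, ∫⁻ y in Metric.closedBall c (ρ / 2),
      ‖Ω.indicator φ x - Ω.indicator φ y‖ₑ ^ 2 ≤
    ENNReal.ofReal (h ^ 2) * (2 ^ d * (volume T + volume (Metric.closedBall c (ρ / 2))) *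
        ∫⁻ z in interior T, ‖G z‖ₑ ^ 2) := by
  set U := innerCore T δ with hU
  set B := Metric.closedBall c (ρ / 2) with hB
  have hUm : MeasurableSet U := (isClosed_innerCore hT δ).measurableSet
  have hBm : MeasurableSet B := Metric.isClosed_closedBall.measurableSet
  -- The outer radius is less than `δ`, so mollification on the core uses values in the interior of
  -- `T` only; the fixed ratio 2 of the radii is what almost everywhere convergence requires.
  let b : ℕ → ContDiffBump (0 : Euc d) := fun n =>
    { rIn := δ / (2 * (n + 2))
      rOut := δ / (n + 2)
      rIn_pos := by positivity
      rIn_lt_rOut := by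
        apply div_lt_div_of_pos_left hδ (by positivity)
        linarith [(Nat.cast_nonneg n : (0 : ℝ) ≤ n)] }
  have hr : ∀ n, (b n).rOut = δ / (n + 2) := fun n => rfl
  have hconv := ContDiffBump.ae_convolution_tendsto_right_of_locallyIntegrable (φ := b)
    (l := Filter.atTop) (K := 2) (μ := volume) (g := Ω.indicator φ)
    (by
      simp_rw [hr]
      have := (tendsto_const_nhds (x := δ)).div_atTop
        (Filter.tendsto_atTop_add_const_right _ (2 : ℝ) tendsto_natCast_atTop_atTop)
      exact this)
    (Filter.Eventually.of_forall fun n => by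
      change δ / (n + 2) ≤ 2 * (δ / (2 * (n + 2)))
      apply le_of_eq; field_simp)
    (locallyIntegrable_indicator_L2 hΩo hΩb φ)
  set F : ℕ → Euc d → ℝ := fun n => convolution ((b n).normed volume) (Ω.indicator φ)
    (ContinuousLinearMap.lsmul ℝ ℝ) volume with hF
  have hFc : ∀ n, ContDiff ℝ ∞ (F n) := fun n =>
    (b n).hasCompactSupport_normed.contDiff_convolution_left _ (b n).contDiff_normed
      (locallyIntegrable_indicator_L2 hΩo hΩb φ)
  have hball2 : ∀ n, ∀ z ∈ U, Metric.closedBall z (b n).rOut ⊆ interior T := fun n z hz => by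
    refine Subset.trans ?_ (interior_mono (show Metric.closedBall z δ ⊆ T from hz))
    refine Subset.trans ?_ Metric.ball_subset_interior_closedBall
    refine Metric.closedBall_subset_ball ?_
    rw [hr]
    exact div_lt_self hδ (by linarith [(Nat.cast_nonneg n : (0 : ℝ) ≤ n)])
  have hFn : ∀ n, ∫⁻ x in U, ∫⁻ y in B, ‖F n x - F n y‖ₑ ^ 2 ≤
      ENNReal.ofReal (h ^ 2) * (2 ^ d * (volume T + volume B) *
        ∫⁻ z in interior T, ‖G z‖ₑ ^ 2) := fun n => by
    refine (lintegral_lintegral_sub_sq_le_of_contDiff (hFc n) hUm hBm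
      (fun y hy => starConvex_innerCore hδρ hstar hy) (fun x hx y hy =>
        hdiam x (innerCore_subset hδ.le hx) y
          (hball (Metric.closedBall_subset_closedBall (by linarith) hy)))).trans ?_
    refine mul_le_mul' le_rfl (mul_le_mul' ?_ ?_)
    · gcongr
      exact innerCore_subset hδ.le
    · exact lintegral_enorm_fderiv_convolution_sq_le hΩo hΩb hw isOpen_interior.measurableSet hTΩ
        (b n) hUm (hball2 n)
  have hmeas : ∀ n, Measurable fun q : Euc d × Euc d => ‖F n q.1 - F n q.2‖ₑ ^ 2 := fun n => by
    have h1 := (hFc n).continuous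
    have h2 : Continuous fun q : Euc d × Euc d => F n q.1 - F n q.2 := by fun_prop
    exact h2.enorm.measurable.pow_const 2
  have hconv' : ∀ᵐ x, Filter.Tendsto (fun n => F n x) Filter.atTop (nhds (Ω.indicator φ x)) := hconv
  clear hconv
  clear_value F
  -- Fatou's lemma is applied in `y` here and in `x` below.
  have hpt : ∀ᵐ x, ∫⁻ y in B, ‖Ω.indicator φ x - Ω.indicator φ y‖ₑ ^ 2 ≤
      Filter.liminf (fun n => ∫⁻ y in B, ‖F n x - F n y‖ₑ ^ 2) Filter.atTop := by
    filter_upwards [hconv'] with x hx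
    refine le_trans (lintegral_mono_ae ?_) (lintegral_liminf_le fun n =>
      (hmeas n).comp measurable_prodMk_left)
    filter_upwards [ae_restrict_of_ae hconv'] with y hy
    have h1 : Filter.Tendsto (fun n => ‖F n x - F n y‖ₑ ^ 2) Filter.atTop
        (nhds (‖Ω.indicator φ x - Ω.indicator φ y‖ₑ ^ 2)) :=
      ENNReal.Tendsto.pow (hx.sub hy).enorm
    exact h1.liminf_eq.ge
  calc _ ≤ ∫⁻ x in U, Filter.liminf (fun n => ∫⁻ y in B, ‖F n x - F n y‖ₑ ^ 2) Filter.atTop :=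
        lintegral_mono_ae (ae_restrict_of_ae hpt)
    _ ≤ Filter.liminf (fun n => ∫⁻ x in U, ∫⁻ y in B, ‖F n x - F n y‖ₑ ^ 2) Filter.atTop :=
        lintegral_liminf_le fun n => (hmeas n).lintegral_prod_right'
    _ ≤ _ := Filter.liminf_le_of_frequently_le' (Filter.Frequently.of_forall hFn)

/-- The Poincaré inequality on a cell which is star-shaped with respect to a ball. -/
theorem exists_const_lintegral_sub_sq_le (hΩo : IsOpen Ω) (hΩb : Bornology.IsBounded Ω)
    (hw : IsWeakGradient Ω φ G) (hT : IsClosed T) (hTΩ : interior T ⊆ Ω)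
    (hball : Metric.closedBall c ρ ⊆ T)
    (hstar : ∀ y ∈ Metric.closedBall c ρ, StarConvex ℝ y T) (hdiam : ∀ x ∈ T, ∀ y ∈ T, ‖x - y‖ ≤ h)
    (hρ : 0 < ρ) {κ : ℝ} (hκ : 0 ≤ κ) (hh : h ≤ κ * (ρ / 2)) :
    ∃ k : ℝ, ∫⁻ x in interior T, ‖φ x - k‖ₑ ^ 2 ≤
      ENNReal.ofReal (h ^ 2 * (2 ^ d * (κ ^ d + 1))) * ∫⁻ x in interior T, ‖G x‖ₑ ^ 2 := by
  set B := Metric.closedBall c (ρ / 2) with hB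
  have hBm : MeasurableSet B := Metric.isClosed_closedBall.measurableSet
  have hB0 : volume B ≠ 0 := (Metric.measure_closedBall_pos _ _ (by positivity)).ne'
  have hBtop : volume B ≠ ⊤ := measure_closedBall_lt_top.ne
  have hTB : volume T ≤ ENNReal.ofReal (κ ^ d) * volume B := by
    have h1 : T ⊆ Metric.closedBall c (κ * (ρ / 2)) := fun x hx => by
      rw [Metric.mem_closedBall, dist_eq_norm]
      exact (hdiam x hx c (hball (Metric.mem_closedBall_self hρ.le))).trans hh
    refine (measure_mono h1).trans (le_of_eq ?_)
    rw [hB, Measure.addHaar_closedBall_mul _ _ hκ (by positivity), finrank_euclideanSpace_fin]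
    rw [Measure.addHaar_closedBall_center _ c]
  set I := ∫⁻ x in interior T, ‖G x‖ₑ ^ 2 with hI
  set K := ENNReal.ofReal (h ^ 2) * (2 ^ d * (volume T + volume B) * I) with hK
  set ψ : Euc d → Euc d → ENNReal :=
    fun x y => ‖Ω.indicator φ x - Ω.indicator φ y‖ₑ ^ 2 with hψ
  have hφm : AEMeasurable (Ω.indicator φ) volume :=
    (locallyIntegrable_indicator_L2 hΩo hΩb φ).aestronglyMeasurable.aemeasurable
  have hψm : ∀ μ ν : Measure (Euc d), SFinite μ → SFinite ν → μ ≤ volume → ν ≤ volume →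
      AEMeasurable (Function.uncurry ψ) (μ.prod ν) := fun μ ν _ _ hμ hν => by
    have h1 : AEMeasurable (fun q : Euc d × Euc d => Ω.indicator φ q.1) (μ.prod ν) :=
      (hφm.mono_measure hμ).comp_fst
    have h2 : AEMeasurable (fun q : Euc d × Euc d => Ω.indicator φ q.2) (μ.prod ν) :=
      (hφm.mono_measure hν).comp_snd
    exact (h1.sub h2).enorm.pow_const 2
  -- The bound on the cores is independent of `δ`, and the cores increase to a set containing the
  -- interior.
  have hintg : ∫⁻ x in interior T, ∫⁻ y in B, ψ x y ≤ K := by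
    set δ : ℕ → ℝ := fun n => ρ / (n + 2) with hδ
    have hδ0 : ∀ n, 0 < δ n := fun n => by positivity
    have hδanti : Antitone δ := fun m n hmn =>
      div_le_div_of_nonneg_left hρ.le (by positivity) (by gcongr)
    have hδle : ∀ n, δ n ≤ ρ / 2 := fun n =>
      div_le_div_of_nonneg_left hρ.le two_pos (by linarith [(Nat.cast_nonneg n : (0 : ℝ) ≤ n)])
    have hcover : interior T ⊆ ⋃ n, innerCore T (δ n) := fun x hx => by
      obtain ⟨ε, hε, hεT⟩ := Metric.isOpen_iff.1 isOpen_interior x hx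
      have hlim : Filter.Tendsto δ Filter.atTop (nhds 0) :=
        (tendsto_const_nhds (x := ρ)).div_atTop
          (Filter.tendsto_atTop_add_const_right _ (2 : ℝ) tendsto_natCast_atTop_atTop)
      obtain ⟨n, hn⟩ := (hlim.eventually_lt_const hε).exists
      exact mem_iUnion.2 ⟨n, ((Metric.closedBall_subset_ball hn).trans hεT).trans interior_subset⟩
    calc ∫⁻ x in interior T, ∫⁻ y in B, ψ x y
        ≤ ∫⁻ x in ⋃ n, innerCore T (δ n), ∫⁻ y in B, ψ x y := lintegral_mono_set hcover
      _ = ⨆ n, ∫⁻ x in innerCore T (δ n), ∫⁻ y in B, ψ x y :=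
          setLIntegral_iUnion_of_directed _
            (directed_of_isDirected_le fun m n hmn => innerCore_anti (hδanti hmn))
      _ ≤ K := iSup_le fun n => lintegral_innerCore_sub_sq_le hΩo hΩb hw hT hTΩ hball hstar hdiam
            (hδ0 n) (hδle n)
  have hmI : AEMeasurable (Function.uncurry ψ)
      ((volume.restrict (interior T)).prod (volume.restrict B)) :=
    hψm _ _ inferInstance inferInstance Measure.restrict_le_self Measure.restrict_le_self
  rw [lintegral_lintegral_swap hmI] at hintg
  have hmB : AEMeasurable (fun y => ∫⁻ x in interior T, ψ x y) (volume.restrict B) :=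
    hmI.prod_swap.lintegral_prod_right'
  -- Some `y` in the ball does no worse than the average; its value is the required constant.
  obtain ⟨y, -, hy⟩ := exists_le_setLAverage hB0 hBtop hmB
  refine ⟨Ω.indicator φ y, ?_⟩
  have h1 : ∫⁻ x in interior T, ‖φ x - Ω.indicator φ y‖ₑ ^ 2 = ∫⁻ x in interior T, ψ x y := by
    refine setLIntegral_congr_fun isOpen_interior.measurableSet fun x hx => ?_
    simp only [hψ, indicator_of_mem (hTΩ hx)]
  rw [h1]
  refine hy.trans ?_
  rw [setLAverage_eq, ENNReal.div_le_iff hB0 hBtop]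
  refine hintg.trans ?_
  rw [hK]
  calc ENNReal.ofReal (h ^ 2) * (2 ^ d * (volume T + volume B) * I)
      ≤ ENNReal.ofReal (h ^ 2) * (2 ^ d * (ENNReal.ofReal (κ ^ d) * volume B + volume B) * I) := by
        gcongr
    _ = _ := by
        have h2 : (2 : ENNReal) ^ d = ENNReal.ofReal (2 ^ d) := by
          rw [ENNReal.ofReal_pow (by norm_num)]; norm_num
        rw [ENNReal.ofReal_mul (by positivity), ENNReal.ofReal_mul (by positivity),
          ENNReal.ofReal_add (by positivity) zero_le_one, ENNReal.ofReal_one, h2]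
        ring

end WeakPoincare

/-! ### Geometry of shape-regular triangulations and scaling to the reference ball. -/

/-- A compact set which is star-shaped with respect to a ball has a null boundary. -/
lemma volume_diff_interior_eq_zero {d : ℕ} {T : Set (Euc d)} (hT : IsCompact T) {c : Euc d} {ρ : ℝ}
    (hρ : 0 < ρ) (hstar : ∀ y ∈ Metric.closedBall c ρ, StarConvex ℝ y T) :
    volume (T \ interior T) = 0 := by
  -- Contraction towards `c` by `s < 1` maps `T` into its interior, since the ball of star centres
  -- leaves room of radius `(1-s)ρ`. Comparing volumes as `s → 1` shows that the interior has full
  -- measure.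
  have hsub : ∀ s ∈ Ioo (0 : ℝ) 1, AffineMap.homothety c s '' T ⊆ interior T := by
    rintro s ⟨hs0, hs1⟩ _ ⟨y, hy, rfl⟩
    have h1s : 0 < 1 - s := by linarith
    rw [mem_interior_iff_mem_nhds]
    refine Filter.mem_of_superset (Metric.ball_mem_nhds _ (mul_pos h1s hρ)) fun w hw => ?_
    rw [Metric.mem_ball, dist_eq_norm] at hw
    set z := AffineMap.homothety c s y with hz
    have hz' : z = s • (y - c) + c := by simp [hz, AffineMap.homothety_apply]
    have hv : c + (1 - s)⁻¹ • (w - z) ∈ Metric.closedBall c ρ := by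
      rw [Metric.mem_closedBall, dist_eq_norm, add_sub_cancel_left, norm_smul, norm_inv,
        Real.norm_of_nonneg h1s.le, inv_mul_le_iff₀ h1s]
      exact hw.le
    have h2 := hstar _ hv hy h1s.le hs0.le (by ring)
    have h3 : (1 - s) • (c + (1 - s)⁻¹ • (w - z)) + s • y = w := by
      rw [smul_add, smul_smul, mul_inv_cancel₀ h1s.ne', one_smul, hz']
      module
    rwa [h3] at h2
  have hTtop : volume T ≠ ⊤ := hT.measure_lt_top.ne
  have hle : volume T ≤ volume (interior T) := by
    have h1 : ∀ s ∈ Ioo (0 : ℝ) 1, ENNReal.ofReal (s ^ d) * volume T ≤ volume (interior T) :=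
      fun s hs => by
        have h2 := Measure.addHaar_image_homothety (volume : Measure (Euc d)) c s T
        rw [finrank_euclideanSpace_fin, abs_of_nonneg (pow_nonneg hs.1.le d)] at h2
        rw [← h2]
        exact measure_mono (hsub s hs)
    have hlim : Filter.Tendsto (fun s : ℝ => ENNReal.ofReal (s ^ d) * volume T)
        (nhdsWithin 1 (Iio 1)) (nhds (volume T)) := by
      have h2 : Filter.Tendsto (fun s : ℝ => s ^ d) (nhdsWithin 1 (Iio 1)) (nhds 1) := by
        have : Filter.Tendsto (fun s : ℝ => s ^ d) (nhds 1) (nhds (1 ^ d)) :=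
          (continuous_pow d).tendsto 1
        rw [one_pow] at this
        exact this.mono_left nhdsWithin_le_nhds
      have h3 := ENNReal.Tendsto.mul_const (ENNReal.tendsto_ofReal h2)
        (Or.inr hTtop : ENNReal.ofReal 1 ≠ 0 ∨ volume T ≠ ⊤)
      rwa [ENNReal.ofReal_one, one_mul] at h3
    refine le_of_tendsto hlim ?_
    filter_upwards [Ioo_mem_nhdsLT (zero_lt_one' ℝ)] with s hs using h1 s hs
  rw [measure_sdiff _root_.interior_subset isOpen_interior.measurableSet.nullMeasurableSet
    ((measure_mono _root_.interior_subset).trans_lt hT.measure_lt_top).ne, tsub_eq_zero_iff_le]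
  exact hle

lemma ae_le_of_subset {X : Type*} [MeasurableSpace X] {μ : Measure X} {s t : Set X} (h : s ⊆ t) :
    s ≤ᵐ[μ] t := ae_of_all _ h

namespace Triangulation

variable {d : ℕ} {Ω : Set (Euc d)}

/-- The cells are star-shaped with respect to balls of radius `σ h` about given centres, and have
diameter at most `h`. -/
structure IsShapeRegular (𝒯 : Triangulation Ω) (σ h : ℝ) (c : 𝒯.cells → Euc d) : Prop where
  sigma_pos : 0 < σ
  pos : 0 < h
  ball_subset : ∀ T, Metric.closedBall (c T) (σ * h) ⊆ T
  star : ∀ T, ∀ y ∈ Metric.closedBall (c T) (σ * h), StarConvex ℝ y (T : Set (Euc d))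
  norm_sub_le : ∀ T : 𝒯.cells, ∀ x ∈ (T : Set (Euc d)), ∀ y ∈ (T : Set (Euc d)), ‖x - y‖ ≤ h

lemma diam_le_meshSize (𝒯 : Triangulation Ω) {T : Set (Euc d)} (hT : T ∈ 𝒯.cells) :
    Metric.diam T ≤ 𝒯.meshSize :=
  le_csSup (𝒯.cells.finite_toSet.image _).bddAbove ⟨T, hT, rfl⟩

/-- A ball of radius `σ h` fits into `Ω`, so two points at distance `σ h/2` give `h ≤ 2 diam Ω/σ`.
Without cells `h = 1` is taken, which explains the summand 1. -/
lemma exists_isShapeRegular (hd : 2 ≤ d) (hΩb : Bornology.IsBounded Ω) (𝒯 : Triangulation Ω)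
    {σ : ℝ} (hσ : 0 < σ) (hq : 𝒯.IsQuasiUniform σ) :
    ∃ h c, h ≤ 2 * Metric.diam Ω / σ + 1 ∧ 𝒯.IsShapeRegular σ h c := by
  have : Nonempty (Fin d) := ⟨⟨0, by omega⟩⟩
  have hdiam : 0 ≤ Metric.diam Ω := Metric.diam_nonneg
  rcases 𝒯.cells.eq_empty_or_nonempty with he | ⟨T₀, hT₀⟩
  · have : IsEmpty 𝒯.cells := by rw [he]; infer_instance
    exact ⟨1, isEmptyElim, le_add_of_nonneg_left (by positivity), hσ, one_pos,
      isEmptyElim, isEmptyElim, isEmptyElim⟩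
  · choose c hc using fun T : 𝒯.cells => hq T.1 T.2
    have hdist : ∀ T ∈ 𝒯.cells, ∀ x ∈ T, ∀ y ∈ T, ‖x - y‖ ≤ 𝒯.meshSize := fun T hT x hx y hy => by
      rw [← dist_eq_norm]
      exact (Metric.dist_le_diam_of_mem (𝒯.isCompact T hT).isBounded hx hy).trans
        (𝒯.diam_le_meshSize hT)
    have hpos : 0 < 𝒯.meshSize := by
      obtain ⟨x, hx⟩ := 𝒯.interior_nonempty T₀ hT₀
      obtain ⟨ε, hε, hεT⟩ := Metric.isOpen_iff.1 isOpen_interior x hx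
      obtain ⟨v, hv⟩ := exists_norm_eq (Euc d) (show 0 ≤ ε / 2 by positivity)
      have h1 : x + v ∈ T₀ := _root_.interior_subset (hεT (by
        rw [Metric.mem_ball, dist_eq_norm, add_sub_cancel_left, hv]; linarith))
      have h2 := hdist T₀ hT₀ _ h1 x (_root_.interior_subset hx)
      rw [add_sub_cancel_left, hv] at h2
      linarith
    refine ⟨𝒯.meshSize, c, ?_, hσ, hpos, fun T => (hc T).1, fun T => (hc T).2,
      fun T => hdist T.1 T.2⟩
    have hr : 0 < σ * 𝒯.meshSize := mul_pos hσ hpos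
    obtain ⟨v, hv⟩ := exists_norm_eq (Euc d) (show 0 ≤ σ * 𝒯.meshSize / 2 by positivity)
    have hintg : Metric.ball (c ⟨T₀, hT₀⟩) (σ * 𝒯.meshSize) ⊆ Ω :=
      (Metric.ball_subset_interior_closedBall.trans (interior_mono (hc ⟨T₀, hT₀⟩).1)).trans
        (𝒯.interior_subset T₀ hT₀)
    have h1 := Metric.dist_le_diam_of_mem hΩb
      (hintg (show c ⟨T₀, hT₀⟩ + v ∈ _ by
        rw [Metric.mem_ball, dist_eq_norm, add_sub_cancel_left, hv]; linarith))
      (hintg (Metric.mem_ball_self hr))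
    rw [dist_eq_norm, add_sub_cancel_left, hv] at h1
    have h2 : 𝒯.meshSize ≤ 2 * Metric.diam Ω / σ := by
      rw [le_div_iff₀ hσ]; linarith
    linarith

namespace IsShapeRegular

variable {𝒯 : Triangulation Ω} {σ h : ℝ} {c : 𝒯.cells → Euc d}

lemma ae_eq_interior (hr : 𝒯.IsShapeRegular σ h c) (T : 𝒯.cells) :
    interior (T : Set (Euc d)) =ᵐ[volume] (T : Set (Euc d)) :=
  (ae_le_of_subset _root_.interior_subset).antisymm (ae_le_set.2
    (volume_diff_interior_eq_zero (𝒯.isCompact T.1 T.2) (mul_pos hr.sigma_pos hr.pos) (hr.star T)))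

/-- The cells cover `Ω` and have null boundaries, so their disjoint interiors fill `Ω` up to a null
set. -/
lemma restrict_eq_sum (hr : 𝒯.IsShapeRegular σ h c) :
    volume.restrict Ω = ∑ T : 𝒯.cells, volume.restrict (interior (T : Set (Euc d))) := by
  have h1 : (⋃ T : 𝒯.cells, interior (T : Set (Euc d))) =ᵐ[volume] Ω := by
    refine Filter.EventuallyLE.antisymm (ae_le_of_subset
      (iUnion_subset fun T => 𝒯.interior_subset T.1 T.2)) (ae_le_set.2 ?_)
    refine measure_mono_null (t := ⋃ T : 𝒯.cells, (T : Set (Euc d)) \ interior T) ?_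
      (measure_iUnion_null fun T => volume_diff_interior_eq_zero (𝒯.isCompact T.1 T.2)
        (mul_pos hr.sigma_pos hr.pos) (hr.star T))
    rintro x ⟨hx, hx'⟩
    obtain ⟨T, hT, hxT⟩ := mem_iUnion₂.1 (𝒯.covers hx)
    exact mem_iUnion.2 ⟨⟨T, hT⟩, hxT, fun h => hx' (mem_iUnion.2 ⟨⟨T, hT⟩, h⟩)⟩
  rw [← Measure.restrict_congr_set h1, Measure.restrict_iUnion, Measure.sum_fintype]
  · intro T T' hTT'
    exact 𝒯.disjoint T.1 T.2 T'.1 T'.2 fun h => hTT' (Subtype.ext h)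
  · exact fun T => isOpen_interior.measurableSet

lemma ae_mem_interior (hr : 𝒯.IsShapeRegular σ h c) :
    ∀ᵐ x ∂(volume.restrict Ω), ∃ T : 𝒯.cells, x ∈ interior (T : Set (Euc d)) := by
  have h1 : ∀ᵐ x ∂(Measure.sum fun T : 𝒯.cells => volume.restrict (interior (T : Set (Euc d)))),
      ∃ T : 𝒯.cells, x ∈ interior (T : Set (Euc d)) := by
    rw [Measure.ae_sum_iff]
    exact fun T => (ae_restrict_mem isOpen_interior.measurableSet).mono fun x hx => ⟨T, hx⟩
  rwa [Measure.sum_fintype, ← hr.restrict_eq_sum] at h1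

lemma integral_eq_sum (hr : 𝒯.IsShapeRegular σ h c) {F : Euc d → ℝ}
    (hF : Integrable F (volume.restrict Ω)) :
    ∫ x in Ω, F x = ∑ T : 𝒯.cells, ∫ x in interior (T : Set (Euc d)), F x := by
  conv_lhs => rw [hr.restrict_eq_sum]
  refine integral_finsetSum_measure fun T _ => ?_
  exact hF.mono_measure (Measure.restrict_mono_set _ (𝒯.interior_subset T.1 T.2))

lemma lintegral_eq_sum (hr : 𝒯.IsShapeRegular σ h c) (F : Euc d → ENNReal) :
    ∫⁻ x in Ω, F x = ∑ T : 𝒯.cells, ∫⁻ x in interior (T : Set (Euc d)), F x := by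
  rw [hr.restrict_eq_sum, lintegral_finsetSum_measure]

lemma interior_subset_closedBall (hr : 𝒯.IsShapeRegular σ h c) (T : 𝒯.cells) :
    interior (T : Set (Euc d)) ⊆ Metric.closedBall (c T) h := fun x hx => by
  rw [Metric.mem_closedBall, dist_eq_norm]
  exact hr.norm_sub_le T x (_root_.interior_subset hx) _
    (hr.ball_subset T (Metric.mem_closedBall_self (mul_nonneg hr.sigma_pos.le hr.pos.le)))

lemma norm_reference_le (hr : 𝒯.IsShapeRegular σ h c) (T : 𝒯.cells) {x : Euc d}
    (hx : x ∈ interior (T : Set (Euc d))) : h⁻¹ • (x - c T) ∈ Metric.closedBall (0 : Euc d) 1 := by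
  have h1 := hr.interior_subset_closedBall T hx
  rw [Metric.mem_closedBall, dist_eq_norm] at h1
  rw [mem_closedBall_zero_iff, norm_smul, norm_inv, Real.norm_of_nonneg hr.pos.le,
    inv_mul_le_iff₀ hr.pos, mul_one]
  exact h1

lemma volume_interior_le (hr : 𝒯.IsShapeRegular σ h c) (T : 𝒯.cells) :
    volume.real (interior (T : Set (Euc d))) ≤
      h ^ d * volume.real (Metric.ball (0 : Euc d) 1) := by
  refine (measureReal_mono (hr.interior_subset_closedBall T)
    measure_closedBall_lt_top.ne).trans (le_of_eq ?_)
  rw [measureReal_def, Measure.addHaar_closedBall _ _ hr.pos.le, finrank_euclideanSpace_fin,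
    ENNReal.toReal_mul, ENNReal.toReal_ofReal (pow_nonneg hr.pos.le d), measureReal_def]

open scoped Pointwise in
/-- Scaling of integrals from the reference ball to a cell. -/
lemma integral_reference_le (hr : 𝒯.IsShapeRegular σ h c) (T : 𝒯.cells) {F : Euc d → ℝ}
    (hF : Continuous F) (hF0 : ∀ y, 0 ≤ F y) :
    h ^ d * ∫ y in Metric.closedBall (0 : Euc d) σ, F y ≤
      ∫ x in interior (T : Set (Euc d)), F (h⁻¹ • (x - c T)) := by
  have hcont : Continuous fun x => F (h⁻¹ • (x - c T)) := by fun_prop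
  have hi : IntegrableOn (fun x => F (h⁻¹ • (x - c T))) (T : Set (Euc d)) :=
    hcont.continuousOn.integrableOn_compact (𝒯.isCompact T.1 T.2)
  rw [setIntegral_congr_set (hr.ae_eq_interior T)]
  refine le_trans (le_of_eq ?_) (setIntegral_mono_set hi (ae_of_all _ fun x => hF0 _)
    (ae_le_of_subset (hr.ball_subset T)))
  have h1 : Metric.closedBall (c T) (σ * h) =
      (fun x => x - c T) ⁻¹' (h • Metric.closedBall (0 : Euc d) σ) := by
    rw [smul_closedBall _ _ hr.sigma_pos.le, smul_zero, Real.norm_of_nonneg hr.pos.le]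
    ext x
    simp [dist_eq_norm, mul_comm]
  have h2 := (measurePreserving_sub_right (volume : Measure (Euc d)) (c T)).setIntegral_preimage_emb
    (MeasurableEquiv.subRight (c T)).measurableEmbedding (fun x => F (h⁻¹ • x))
    (h • Metric.closedBall (0 : Euc d) σ)
  rw [h1, h2, Measure.setIntegral_comp_smul_of_pos _ _ _ (inv_pos.2 hr.pos),
    finrank_euclideanSpace_fin, smul_smul, inv_mul_cancel₀ hr.pos.ne', one_smul, smul_eq_mul,
    inv_pow, inv_inv]

end IsShapeRegular

end Triangulation

/-! ### Piecewise polynomials in scaled coordinates and their embedding into `L²`. -/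

namespace Triangulation

variable {d : ℕ} {Ω : Set (Euc d)}

/-- Coefficients of piecewise polynomials, with respect to scaled coordinates on every cell. -/
abbrev Coef (𝒯 : Triangulation Ω) (r : ℕ) : Type := 𝒯.cells → PolyCoef d r

/-- Evaluation of a piecewise polynomial, by zero outside the interiors of the cells. -/
def evalAt (𝒯 : Triangulation Ω) (r : ℕ) (h : ℝ) (c : 𝒯.cells → Euc d) (x : Euc d) :
    𝒯.Coef r →L[ℝ] ℝ :=
  ∑ T : 𝒯.cells, (interior (T : Set (Euc d))).indicator
    (fun x => (PolyCoef.ev (h⁻¹ • (x - c T))).comp (ContinuousLinearMap.proj T)) x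

/-- The elementwise gradient of a piecewise polynomial. -/
def gradAt (𝒯 : Triangulation Ω) (r : ℕ) (h : ℝ) (c : 𝒯.cells → Euc d) (x : Euc d) :
    𝒯.Coef r →L[ℝ] Euc d :=
  ∑ T : 𝒯.cells, (interior (T : Set (Euc d))).indicator
    (fun x => (h⁻¹ • PolyCoef.grad (h⁻¹ • (x - c T))).comp (ContinuousLinearMap.proj T)) x

section Evaluation

variable (𝒯 : Triangulation Ω) (r : ℕ) (h : ℝ) (c : 𝒯.cells → Euc d)

lemma sum_indicator_of_mem {F : Type*} [AddCommMonoid F] (L : 𝒯.cells → Euc d → F) {T : 𝒯.cells}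
    {x : Euc d} (hx : x ∈ interior (T : Set (Euc d))) :
    ∑ T : 𝒯.cells, (interior (T : Set (Euc d))).indicator (L T) x = L T x := by
  rw [Finset.sum_eq_single T, indicator_of_mem hx]
  · intro T' _ hT'
    refine indicator_of_notMem (fun hx' => ?_) _
    exact disjoint_left.1 (𝒯.disjoint T'.1 T'.2 T.1 T.2 fun h => hT' (Subtype.ext h)) hx' hx
  · simp

lemma evalAt_of_mem {T : 𝒯.cells} {x : Euc d} (hx : x ∈ interior (T : Set (Euc d)))
    (w : 𝒯.Coef r) : 𝒯.evalAt r h c x w = PolyCoef.ev (h⁻¹ • (x - c T)) (w T) := by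
  rw [evalAt, 𝒯.sum_indicator_of_mem _ hx]
  rfl

lemma gradAt_of_mem {T : 𝒯.cells} {x : Euc d} (hx : x ∈ interior (T : Set (Euc d)))
    (w : 𝒯.Coef r) : 𝒯.gradAt r h c x w = h⁻¹ • PolyCoef.grad (h⁻¹ • (x - c T)) (w T) := by
  rw [gradAt, 𝒯.sum_indicator_of_mem _ hx]
  rfl

lemma continuous_cellEval (T : 𝒯.cells) : Continuous fun x : Euc d =>
    ((PolyCoef.ev (h⁻¹ • (x - c T))).comp (ContinuousLinearMap.proj T) : 𝒯.Coef r →L[ℝ] ℝ) :=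
  (PolyCoef.continuous_ev.comp (by fun_prop)).clm_comp continuous_const

lemma continuous_cellGrad (T : 𝒯.cells) : Continuous fun x : Euc d =>
    ((h⁻¹ • PolyCoef.grad (h⁻¹ • (x - c T))).comp
      (ContinuousLinearMap.proj T) : 𝒯.Coef r →L[ℝ] Euc d) :=
  ((PolyCoef.continuous_grad.comp (by fun_prop)).const_smul h⁻¹).clm_comp continuous_const

lemma stronglyMeasurable_evalAt : StronglyMeasurable (𝒯.evalAt r h c) := by
  unfold evalAt
  exact Finset.stronglyMeasurable_fun_sum _ fun T _ =>
    (𝒯.continuous_cellEval r h c T).stronglyMeasurable.indicator isOpen_interior.measurableSet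

lemma stronglyMeasurable_gradAt : StronglyMeasurable (𝒯.gradAt r h c) := by
  unfold gradAt
  exact Finset.stronglyMeasurable_fun_sum _ fun T _ =>
    (𝒯.continuous_cellGrad r h c T).stronglyMeasurable.indicator isOpen_interior.measurableSet

/-- The bound depends on the mesh. This is harmless: it serves integrability and domination only and
enters no estimate. -/
lemma exists_norm_sum_indicator_le {F : Type*} [NormedAddCommGroup F]
    {L : 𝒯.cells → Euc d → F} (hL : ∀ T, Continuous (L T)) : ∃ M : ℝ, 0 ≤ M ∧ ∀ x,
      ‖∑ T : 𝒯.cells, (interior (T : Set (Euc d))).indicator (L T) x‖ ≤ M := by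
  choose M hM using fun T : 𝒯.cells =>
    (𝒯.isCompact T.1 T.2).exists_bound_of_continuousOn (hL T).continuousOn
  refine ⟨∑ T, |M T|, Finset.sum_nonneg fun T _ => abs_nonneg _, fun x => ?_⟩
  refine (norm_sum_le _ _).trans (Finset.sum_le_sum fun T _ => ?_)
  by_cases hx : x ∈ interior (T : Set (Euc d))
  · rw [indicator_of_mem hx]
    exact (hM T x (_root_.interior_subset hx)).trans (le_abs_self _)
  · rw [indicator_of_notMem hx, norm_zero]
    exact abs_nonneg _

lemma exists_norm_evalAt_le : ∃ M : ℝ, 0 ≤ M ∧ ∀ x, ‖𝒯.evalAt r h c x‖ ≤ M :=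
  𝒯.exists_norm_sum_indicator_le (𝒯.continuous_cellEval r h c)

lemma exists_norm_gradAt_le : ∃ M : ℝ, 0 ≤ M ∧ ∀ x, ‖𝒯.gradAt r h c x‖ ≤ M :=
  𝒯.exists_norm_sum_indicator_le (𝒯.continuous_cellGrad r h c)

lemma evalAt_mem_space (w : 𝒯.Coef r) : (fun x => 𝒯.evalAt r h c x w) ∈ 𝒯.space r := by
  intro T hT
  obtain ⟨p, hp, hpe⟩ := PolyCoef.exists_totalDegree_le (w ⟨T, hT⟩)
  obtain ⟨q, hq, hqe⟩ := exists_mvPolynomial_comp_affine p hp h⁻¹ fun i => -(h⁻¹ * c ⟨T, hT⟩ i)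
  refine ⟨q, hq, fun x hx => ?_⟩
  change 𝒯.evalAt r h c x w = _
  rw [𝒯.evalAt_of_mem r h c (T := ⟨T, hT⟩) hx, hpe, hqe]
  congr 2
  funext i
  simp [sub_eq_add_neg]

lemma exists_evalAt_eq {u : Euc d → ℝ} (hh : h ≠ 0) (hu : u ∈ 𝒯.space r) : ∃ w : 𝒯.Coef r,
    ∀ T : 𝒯.cells, ∀ x ∈ interior (T : Set (Euc d)), u x = 𝒯.evalAt r h c x w := by
  have key : ∀ T : 𝒯.cells, ∃ q : PolyCoef d r, ∀ x ∈ interior (T : Set (Euc d)),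
      u x = PolyCoef.ev (h⁻¹ • (x - c T)) q := fun T => by
    obtain ⟨p, hp, hpu⟩ := hu T.1 T.2
    obtain ⟨q, hq, hqe⟩ := exists_mvPolynomial_comp_affine p hp h fun i => c T i
    obtain ⟨q', hq'⟩ := PolyCoef.exists_ev_eq_eval hq
    refine ⟨q', fun x hx => ?_⟩
    rw [hpu x hx, hq', hqe]
    congr 2
    funext i
    simp [mul_inv_cancel_left₀ hh]
  choose w hw using key
  exact ⟨w, fun T x hx => by rw [hw T x hx, 𝒯.evalAt_of_mem r h c hx]⟩

lemma gradient_eq_gradAt {u : Euc d → ℝ} {w : 𝒯.Coef r} {T : 𝒯.cells}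
    (hu : ∀ x ∈ interior (T : Set (Euc d)), u x = 𝒯.evalAt r h c x w) {x : Euc d}
    (hx : x ∈ interior (T : Set (Euc d))) : gradient u x = 𝒯.gradAt r h c x w := by
  have h1 : HasGradientAt (fun x => PolyCoef.ev (h⁻¹ • (x - c T)) (w T))
      (h⁻¹ • PolyCoef.grad (h⁻¹ • (x - c T)) (w T)) x := by
    rw [hasGradientAt_iff_hasFDerivAt]
    have h2 : HasFDerivAt (fun x : Euc d => h⁻¹ • (x - c T))
        (h⁻¹ • ContinuousLinearMap.id ℝ (Euc d)) x :=
      ((hasFDerivAt_id x).sub_const (c T)).const_smul h⁻¹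
    have h3 := (PolyCoef.hasGradientAt_ev (w T) (h⁻¹ • (x - c T))).hasFDerivAt.comp x h2
    refine h3.congr_fderiv ?_
    ext v
    simp
  have h4 : u =ᶠ[nhds x] fun x => PolyCoef.ev (h⁻¹ • (x - c T)) (w T) := by
    filter_upwards [isOpen_interior.mem_nhds hx] with y hy
    rw [hu y hy, 𝒯.evalAt_of_mem r h c hy]
  rw [𝒯.gradAt_of_mem r h c hx]
  exact (h1.congr_of_eventuallyEq h4).gradient

lemma eq_zero_of_evalAt_eq_zero (hh : h ≠ 0) {w : 𝒯.Coef r}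
    (hw : ∀ T : 𝒯.cells, ∀ x ∈ interior (T : Set (Euc d)), 𝒯.evalAt r h c x w = 0) : w = 0 := by
  funext T
  have hcont : Continuous fun y : Euc d => h • y + c T := by fun_prop
  refine PolyCoef.eq_zero_of_ev_eq_zero (U := (fun y => h • y + c T) ⁻¹' interior (T : Set (Euc d)))
    (isOpen_interior.preimage hcont) ?_ fun y hy => ?_
  · obtain ⟨x, hx⟩ := 𝒯.interior_nonempty T.1 T.2
    exact ⟨h⁻¹ • (x - c T), by simpa [smul_smul, mul_inv_cancel₀ hh] using hx⟩
  · have := hw T _ hy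
    rw [𝒯.evalAt_of_mem r h c hy] at this
    simpa [smul_smul, inv_mul_cancel₀ hh] using this

end Evaluation

section Embedding

variable (𝒯 : Triangulation Ω) (r : ℕ) (h : ℝ) (c : 𝒯.cells → Euc d)

lemma memLp_evalAt (hΩb : Bornology.IsBounded Ω) (w : 𝒯.Coef r) :
    MemLp (fun x => 𝒯.evalAt r h c x w) 2 (volume.restrict Ω) := by
  have : IsFiniteMeasure (volume.restrict Ω) := ⟨by simpa using hΩb.measure_lt_top⟩
  obtain ⟨M, -, hM⟩ := 𝒯.exists_norm_evalAt_le r h c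
  refine MemLp.of_bound
    ((continuous_eval_const w).comp_stronglyMeasurable
      (𝒯.stronglyMeasurable_evalAt r h c)).aestronglyMeasurable
    (M * ‖w‖) (ae_of_all _ fun x => ?_)
  exact ((𝒯.evalAt r h c x).le_opNorm w).trans (mul_le_mul_of_nonneg_right (hM x) (norm_nonneg _))

/-- The embedding of the finite element space into `L²(Ω)`. -/
def toL2 (hΩb : Bornology.IsBounded Ω) : 𝒯.Coef r →L[ℝ] L2 Ω :=
  LinearMap.toContinuousLinearMap
    { toFun := fun w => (𝒯.memLp_evalAt r h c hΩb w).toLp _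
      map_add' := fun v w => by
        rw [← MemLp.toLp_add]
        congr 1
        funext x
        exact map_add _ v w
      map_smul' := fun a w => by
        rw [RingHom.id_apply, ← MemLp.toLp_const_smul]
        congr 1
        funext x
        exact map_smul _ a w }

variable (hΩb : Bornology.IsBounded Ω)

lemma coeFn_toL2 (w : 𝒯.Coef r) :
    𝒯.toL2 r h c hΩb w =ᵐ[volume.restrict Ω] fun x => 𝒯.evalAt r h c x w :=
  MemLp.coeFn_toLp (𝒯.memLp_evalAt r h c hΩb w)

lemma inner_toL2 (φ : L2 Ω) (w : 𝒯.Coef r) :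
    ⟪φ, 𝒯.toL2 r h c hΩb w⟫ = ∫ x in Ω, φ x * 𝒯.evalAt r h c x w := by
  rw [L2.inner_def]
  refine integral_congr_ae ?_
  filter_upwards [𝒯.coeFn_toL2 r h c hΩb w] with x hx
  rw [hx]
  simp [mul_comm]

lemma inner_toL2_toL2 (v w : 𝒯.Coef r) :
    ⟪𝒯.toL2 r h c hΩb v, 𝒯.toL2 r h c hΩb w⟫ =
      ∫ x in Ω, 𝒯.evalAt r h c x v * 𝒯.evalAt r h c x w := by
  rw [inner_toL2]
  refine integral_congr_ae ?_
  filter_upwards [𝒯.coeFn_toL2 r h c hΩb v] with x hx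
  rw [hx]

lemma norm_toL2_sq (w : 𝒯.Coef r) :
    ‖𝒯.toL2 r h c hΩb w‖ ^ 2 = ∫ x in Ω, 𝒯.evalAt r h c x w ^ 2 := by
  rw [← real_inner_self_eq_norm_sq, inner_toL2_toL2]
  simp_rw [sq]

lemma integrable_evalAt_sq (hΩb : Bornology.IsBounded Ω) (w : 𝒯.Coef r) :
    Integrable (fun x => 𝒯.evalAt r h c x w ^ 2) (volume.restrict Ω) :=
  (𝒯.memLp_evalAt r h c hΩb w).integrable_sq

end Embedding

end Triangulation

lemma enorm_Lp_two_sq {X F : Type*} [MeasurableSpace X] {μ : Measure X} [NormedAddCommGroup F]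
    (u : Lp F 2 μ) : ‖u‖ₑ ^ 2 = ∫⁻ x, ‖u x‖ₑ ^ 2 ∂μ := by
  have h := eLpNorm_nnreal_pow_eq_lintegral (μ := μ) (f := u) (p := 2) two_ne_zero
  rw [Lp.enorm_def]
  simpa using h

/-- Each `m i ^ (p-1)` is at most the same power of the sum. Used with `p = 2/β` to add up the cells
at no cost in their number. -/
lemma sum_rpow_le_rpow_sum {ι : Type*} (s : Finset ι) {m : ι → ℝ} (hm : ∀ i ∈ s, 0 ≤ m i) {p : ℝ}
    (hp : 1 < p) : ∑ i ∈ s, m i ^ p ≤ (∑ i ∈ s, m i) ^ p := by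
  rw [rpow_eq_rpow_sub_one_mul hp (Finset.sum_nonneg hm), Finset.mul_sum]
  refine Finset.sum_le_sum fun i hi => ?_
  rw [rpow_eq_rpow_sub_one_mul hp (hm i hi)]
  have h1 := Finset.single_le_sum hm hi
  have h2 := hm i hi
  have h3 : 0 ≤ p - 1 := by linarith
  gcongr

/-! ### Mesh-uniform inequalities: inverse, broken Poincaré, stability of the projection. -/

namespace Triangulation

variable {d : ℕ} {Ω : Set (Euc d)}

lemma gradAt_eq_zero (𝒯 : Triangulation Ω) (r : ℕ) (h : ℝ) (c : 𝒯.cells → Euc d) {n : 𝒯.Coef r}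
    (hn : ∀ T y, PolyCoef.grad y (n T) = 0) (x : Euc d) : 𝒯.gradAt r h c x n = 0 := by
  rw [gradAt, _root_.sum_apply]
  refine Finset.sum_eq_zero fun T _ => ?_
  by_cases hx : x ∈ interior (T : Set (Euc d))
  · rw [indicator_of_mem hx]
    simp [hn]
  · rw [indicator_of_notMem hx, _root_.zero_apply]

lemma integrable_norm_gradAt_rpow (𝒯 : Triangulation Ω) (r : ℕ) (h : ℝ) (c : 𝒯.cells → Euc d)
    (hΩb : Bornology.IsBounded Ω) (w : 𝒯.Coef r) {b : ℝ} (hb : 0 ≤ b) :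
    Integrable (fun x => ‖𝒯.gradAt r h c x w‖ ^ b) (volume.restrict Ω) := by
  have : IsFiniteMeasure (volume.restrict Ω) := ⟨by simpa using hΩb.measure_lt_top⟩
  obtain ⟨M, hM0, hM⟩ := 𝒯.exists_norm_gradAt_le r h c
  have hcont : Continuous fun L : 𝒯.Coef r →L[ℝ] Euc d => ‖L w‖ ^ b :=
    (Real.continuous_rpow_const hb).comp (continuous_eval_const w).norm
  refine Integrable.of_bound
    (hcont.comp_stronglyMeasurable (𝒯.stronglyMeasurable_gradAt r h c)).aestronglyMeasurable
    ((M * ‖w‖) ^ b) (ae_of_all _ fun x => ?_)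
  rw [Real.norm_of_nonneg (by positivity)]
  gcongr
  exact ((𝒯.gradAt r h c x).le_opNorm w).trans (mul_le_mul_of_nonneg_right (hM x) (norm_nonneg _))

namespace IsShapeRegular

variable {𝒯 : Triangulation Ω} {σ h : ℝ} {c : 𝒯.cells → Euc d}

lemma setIntegral_interior_le (hr : 𝒯.IsShapeRegular σ h c) (T : 𝒯.cells) {F : Euc d → ℝ} {M : ℝ}
    (hM : 0 ≤ M) (hF : ∀ x ∈ interior (T : Set (Euc d)), ‖F x‖ ≤ M) :
    ∫ x in interior (T : Set (Euc d)), F x ≤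
      M * (h ^ d * volume.real (Metric.ball (0 : Euc d) 1)) :=
  calc _ ≤ _ := le_abs_self _
    _ ≤ M * volume.real (interior (T : Set (Euc d))) :=
      norm_setIntegral_le_of_norm_le_const
        (((measure_mono _root_.interior_subset).trans_lt (𝒯.isCompact T.1 T.2).measure_lt_top)) hF
    _ ≤ _ := mul_le_mul_of_nonneg_left (hr.volume_interior_le T) hM

end IsShapeRegular

/-- The inverse inequality. -/
lemma exists_inverse_inequality (d r : ℕ) {σ : ℝ} (hσ : 0 < σ) : ∃ C : ℝ, 0 < C ∧
    ∀ {Ω : Set (Euc d)} (hΩb : Bornology.IsBounded Ω) {𝒯 : Triangulation Ω} {h : ℝ}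
      {c : 𝒯.cells → Euc d}, 𝒯.IsShapeRegular σ h c → ∀ w : 𝒯.Coef r,
      h ^ 2 * ∫ x in Ω, ‖𝒯.gradAt r h c x w‖ ^ 2 ≤ C * ‖𝒯.toL2 r h c hΩb w‖ ^ 2 := by
  obtain ⟨C, hC, hCle⟩ := PolyCoef.exists_grad_sq_le d r hσ
  set V := volume.real (Metric.ball (0 : Euc d) 1) with hV
  have hV0 : 0 ≤ V := measureReal_nonneg
  refine ⟨C * V + 1, by positivity, fun {Ω} hΩb {𝒯 h c} hr w => ?_⟩
  have hh := hr.pos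
  have hintg : Integrable (fun x => ‖𝒯.gradAt r h c x w‖ ^ 2) (volume.restrict Ω) := by
    simpa using 𝒯.integrable_norm_gradAt_rpow r h c hΩb w (b := 2) zero_le_two
  have h1 : ∀ T : 𝒯.cells, h ^ 2 * ∫ x in interior (T : Set (Euc d)), ‖𝒯.gradAt r h c x w‖ ^ 2 ≤
      C * V * ∫ x in interior (T : Set (Euc d)), 𝒯.evalAt r h c x w ^ 2 := fun T => by
    set J := ∫ z in Metric.closedBall (0 : Euc d) σ, (PolyCoef.ev z (w T)) ^ 2 with hJ
    have hJ0 : 0 ≤ J := integral_nonneg fun z => sq_nonneg _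
    -- The reference estimate is pointwise; integrating over the cell costs `h^d V`, and
    -- `integral_reference_le` returns the same power `h^d`.
    have h2 := hr.setIntegral_interior_le T (F := fun x => ‖𝒯.gradAt r h c x w‖ ^ 2)
      (M := h⁻¹ ^ 2 * (C * J)) (by positivity) fun x hx => by
        rw [𝒯.gradAt_of_mem r h c hx, norm_smul, mul_pow, norm_inv, Real.norm_of_nonneg hh.le,
          Real.norm_of_nonneg (by positivity)]
        gcongr
        exact hCle _ _ (hr.norm_reference_le T hx)
    have h3 := hr.integral_reference_le T (F := fun z => (PolyCoef.ev z (w T)) ^ 2)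
      (((ContinuousLinearMap.apply ℝ ℝ (w T)).continuous.comp PolyCoef.continuous_ev).pow 2)
      fun _ => sq_nonneg _
    have h4 : ∫ x in interior (T : Set (Euc d)), 𝒯.evalAt r h c x w ^ 2 =
        ∫ x in interior (T : Set (Euc d)), PolyCoef.ev (h⁻¹ • (x - c T)) (w T) ^ 2 :=
      setIntegral_congr_fun isOpen_interior.measurableSet fun x hx =>
        congrArg (· ^ 2) (𝒯.evalAt_of_mem r h c hx w)
    rw [h4]
    calc _ ≤ h ^ 2 * (h⁻¹ ^ 2 * (C * J) * (h ^ d * V)) := by gcongr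
      _ = C * V * (h ^ d * J) := by field_simp
      _ ≤ _ := by gcongr
  rw [hr.integral_eq_sum hintg, norm_toL2_sq,
    hr.integral_eq_sum (𝒯.integrable_evalAt_sq r h c hΩb w), Finset.mul_sum, Finset.mul_sum]
  refine Finset.sum_le_sum fun T _ => (h1 T).trans ?_
  have : 0 ≤ ∫ x in interior (T : Set (Euc d)), 𝒯.evalAt r h c x w ^ 2 :=
    integral_nonneg fun z => sq_nonneg _
  gcongr
  linarith

/-- The broken Sobolev–Poincaré inequality. -/
lemma exists_broken_poincare (d r : ℕ) {σ b H : ℝ} (hσ : 0 < σ) (hb : 0 < b) (hb2 : b < 2)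
    (hexp : 0 ≤ ((d : ℝ) + 2) * b / 2 - d) (hH : 0 ≤ H) : ∃ S : ℝ, 0 < S ∧
    ∀ {Ω : Set (Euc d)} (hΩb : Bornology.IsBounded Ω) {𝒯 : Triangulation Ω} {h : ℝ}
      {c : 𝒯.cells → Euc d}, 𝒯.IsShapeRegular σ h c → h ≤ H → ∀ w : 𝒯.Coef r, ∃ n : 𝒯.Coef r,
      (∀ x, 𝒯.gradAt r h c x n = 0) ∧
      ‖𝒯.toL2 r h c hΩb (w - n)‖ ^ b ≤ S * ∫ x in Ω, ‖𝒯.gradAt r h c x w‖ ^ b := by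
  obtain ⟨C, hC, hCle⟩ := PolyCoef.exists_sub_rpow_le d r hσ hb
  obtain ⟨e, he⟩ := PolyCoef.exists_ev_eq_one (d := d) (r := r)
  set V := volume.real (Metric.ball (0 : Euc d) 1) with hV
  have hV0 : 0 ≤ V := measureReal_nonneg
  -- The cell volumes contribute `h^(db/2)`, while scaling the gradient integral contributes
  -- `h^(b-d)`. The total exponent is `(d+2)b/2 - d ≥ 0`, so `h` may be replaced by `H`.
  refine ⟨V ^ (b / 2) * C * H ^ (((d : ℝ) + 2) * b / 2 - d) + 1, by positivity,
    fun {Ω} hΩb {𝒯 h c} hr hhH w => ?_⟩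
  have hh := hr.pos
  -- On each cell the constant removed is the value of the polynomial at the centre of the ball.
  refine ⟨fun T => PolyCoef.ev 0 (w T) • e, 𝒯.gradAt_eq_zero r h c fun T y => ?_, ?_⟩
  · rw [map_smul, PolyCoef.grad_eq_zero he, smul_zero]
  set n : 𝒯.Coef r := fun T => PolyCoef.ev 0 (w T) • e with hn
  set A : 𝒯.cells → ℝ := fun T => ∫ x in interior (T : Set (Euc d)), ‖𝒯.gradAt r h c x w‖ ^ b
    with hA
  have hA0 : ∀ T, 0 ≤ A T := fun T => integral_nonneg fun z => by positivity
  set m : 𝒯.cells → ℝ := fun T => C * (h ^ (b - d) * A T) with hm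
  have hm0 : ∀ T, 0 ≤ m T := fun T => by have := hA0 T; positivity
  have hcell : ∀ T : 𝒯.cells, ∫ x in interior (T : Set (Euc d)), 𝒯.evalAt r h c x (w - n) ^ 2 ≤
      m T ^ (2 / b) * (h ^ d * V) := fun T => by
    refine hr.setIntegral_interior_le T (by have := hm0 T; positivity) fun x hx => ?_
    have h1 : 𝒯.evalAt r h c x (w - n) =
        PolyCoef.ev (h⁻¹ • (x - c T)) (w T) - PolyCoef.ev 0 (w T) := by
      rw [𝒯.evalAt_of_mem r h c hx, Pi.sub_apply, map_sub, hn, map_smul, he, smul_eq_mul, mul_one]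
    have h2 := hCle (w T) _ (hr.norm_reference_le T hx)
    rw [← h1] at h2
    have h3 := hr.integral_reference_le T (F := fun z => ‖PolyCoef.grad z (w T)‖ ^ b)
      ((Real.continuous_rpow_const hb.le).comp
        ((continuous_eval_const (w T)).comp PolyCoef.continuous_grad).norm)
      fun _ => by positivity
    have h4 : A T = h⁻¹ ^ b * ∫ x in interior (T : Set (Euc d)),
        ‖PolyCoef.grad (h⁻¹ • (x - c T)) (w T)‖ ^ b := by
      rw [← integral_const_mul]
      refine setIntegral_congr_fun isOpen_interior.measurableSet fun x hx => ?_
      rw [𝒯.gradAt_of_mem r h c hx, norm_smul, norm_inv, Real.norm_of_nonneg hh.le,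
        Real.mul_rpow (by positivity) (norm_nonneg _)]
    have h5 : ∫ z in Metric.closedBall (0 : Euc d) σ, ‖PolyCoef.grad z (w T)‖ ^ b ≤
        h ^ (b - d) * A T := by
      rw [h4, Real.rpow_sub hh, Real.rpow_natCast, Real.inv_rpow hh.le]
      have : 0 < h ^ b := by positivity
      calc _ = (h ^ d)⁻¹ * (h ^ d * ∫ z in Metric.closedBall (0 : Euc d) σ,
              ‖PolyCoef.grad z (w T)‖ ^ b) := by field_simp
        _ ≤ (h ^ d)⁻¹ * ∫ x in interior (T : Set (Euc d)),
              ‖PolyCoef.grad (h⁻¹ • (x - c T)) (w T)‖ ^ b := by gcongr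
        _ = _ := by
          generalize ∫ x in interior (T : Set (Euc d)),
              ‖PolyCoef.grad (h⁻¹ • (x - c T)) (w T)‖ ^ b = I
          field_simp
    have h6 : |𝒯.evalAt r h c x (w - n)| ^ b ≤ m T := h2.trans (mul_le_mul_of_nonneg_left h5 hC.le)
    calc ‖𝒯.evalAt r h c x (w - n) ^ 2‖ = (|𝒯.evalAt r h c x (w - n)| ^ b) ^ (2 / b) := by
          rw [← Real.rpow_mul (abs_nonneg _), mul_div_cancel₀ _ hb.ne', Real.rpow_ofNat, norm_pow,
            Real.norm_eq_abs]
      _ ≤ _ := by gcongr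
  have hsum : ‖𝒯.toL2 r h c hΩb (w - n)‖ ^ 2 ≤ (∑ T, m T) ^ (2 / b) * (h ^ d * V) := by
    rw [norm_toL2_sq, hr.integral_eq_sum (𝒯.integrable_evalAt_sq r h c hΩb _)]
    refine (Finset.sum_le_sum fun T _ => hcell T).trans ?_
    rw [← Finset.sum_mul]
    gcongr
    exact sum_rpow_le_rpow_sum _ (fun T _ => hm0 T) (by rw [lt_div_iff₀ hb]; linarith)
  have hm_sum : 0 ≤ ∑ T, m T := Finset.sum_nonneg fun T _ => hm0 T
  have hA_sum : 0 ≤ ∑ T, A T := Finset.sum_nonneg fun T _ => hA0 T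
  rw [hr.integral_eq_sum (𝒯.integrable_norm_gradAt_rpow r h c hΩb w hb.le)]
  calc ‖𝒯.toL2 r h c hΩb (w - n)‖ ^ b = (‖𝒯.toL2 r h c hΩb (w - n)‖ ^ 2) ^ (b / 2) := by
        rw [← Real.rpow_natCast_mul (norm_nonneg _)]
        congr 1
        push_cast
        ring
    _ ≤ ((∑ T, m T) ^ (2 / b) * (h ^ d * V)) ^ (b / 2) := by gcongr
    _ = (∑ T, m T) * (h ^ ((d : ℝ) * (b / 2)) * V ^ (b / 2)) := by
        rw [Real.mul_rpow (by positivity) (by positivity), Real.mul_rpow (by positivity) hV0,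
          ← Real.rpow_mul hm_sum, ← Real.rpow_natCast_mul hh.le]
        rw [show 2 / b * (b / 2) = 1 by field_simp, Real.rpow_one]
    _ = V ^ (b / 2) * C * (h ^ ((d : ℝ) * (b / 2)) * h ^ (b - d)) * ∑ T, A T := by
        rw [hm, ← Finset.mul_sum, ← Finset.mul_sum]
        ring
    _ = V ^ (b / 2) * C * h ^ (((d : ℝ) + 2) * b / 2 - d) * ∑ T, A T := by
        rw [← Real.rpow_add hh]
        congr 3
        ring
    _ ≤ (V ^ (b / 2) * C * H ^ (((d : ℝ) + 2) * b / 2 - d) + 1) * ∑ T, A T := by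
        gcongr
        refine le_add_of_le_of_nonneg ?_ zero_le_one
        gcongr

/-- Approximation of `H¹` functions by piecewise constants. -/
lemma exists_norm_sub_toL2_sq_le {d r : ℕ} {Ω : Set (Euc d)} (hΩo : IsOpen Ω)
    (hΩb : Bornology.IsBounded Ω) {𝒯 : Triangulation Ω} {σ h : ℝ} {c : 𝒯.cells → Euc d}
    (hr : 𝒯.IsShapeRegular σ h c) {φ : L2 Ω} {G : L2Vec Ω} (hG : IsWeakGradient Ω φ G) :
    ∃ n : 𝒯.Coef r, (∀ x, 𝒯.gradAt r h c x n = 0) ∧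
      ‖φ - 𝒯.toL2 r h c hΩb n‖ ^ 2 ≤ h ^ 2 * (2 ^ d * ((2 / σ) ^ d + 1)) * ‖G‖ ^ 2 := by
  have hσ := hr.sigma_pos
  have hh := hr.pos
  obtain ⟨e, he⟩ := PolyCoef.exists_ev_eq_one (d := d) (r := r)
  -- Here `ρ = σ h`, and `κ = 2/σ` gives equality in `h ≤ κ (ρ/2)`.
  choose k hk using fun T : 𝒯.cells => exists_const_lintegral_sub_sq_le hΩo hΩb hG
    (𝒯.isCompact T.1 T.2).isClosed (𝒯.interior_subset T.1 T.2) (hr.ball_subset T) (hr.star T)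
    (hr.norm_sub_le T) (mul_pos hσ hh) (κ := 2 / σ) (by positivity)
    (by field_simp; exact le_rfl)
  refine ⟨fun T => k T • e, 𝒯.gradAt_eq_zero r h c fun T y => ?_, ?_⟩
  · rw [map_smul, PolyCoef.grad_eq_zero he, smul_zero]
  set n : 𝒯.Coef r := fun T => k T • e with hn
  set A := h ^ 2 * (2 ^ d * ((2 / σ) ^ d + 1)) with hA
  have hA0 : 0 ≤ A := by positivity
  have key : ‖φ - 𝒯.toL2 r h c hΩb n‖ₑ ^ 2 ≤ ENNReal.ofReal A * ‖G‖ₑ ^ 2 := by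
    have h1 : ∀ᵐ x ∂(volume.restrict Ω), (φ - 𝒯.toL2 r h c hΩb n) x =
        φ x - 𝒯.evalAt r h c x n := by
      filter_upwards [Lp.coeFn_sub φ (𝒯.toL2 r h c hΩb n), 𝒯.coeFn_toL2 r h c hΩb n] with x h1 h2
      rw [h1, Pi.sub_apply, h2]
    rw [enorm_Lp_two_sq, enorm_Lp_two_sq,
      lintegral_congr_ae (g := fun x => ‖φ x - 𝒯.evalAt r h c x n‖ₑ ^ 2)
        (h1.mono fun x hx => congrArg (‖·‖ₑ ^ 2) hx),
      hr.lintegral_eq_sum, hr.lintegral_eq_sum, Finset.mul_sum]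
    refine Finset.sum_le_sum fun T _ => ?_
    refine le_trans (le_of_eq ?_) (hk T)
    refine setLIntegral_congr_fun isOpen_interior.measurableSet fun x hx => ?_
    rw [𝒯.evalAt_of_mem r h c hx, hn, map_smul, he, smul_eq_mul, mul_one]
  have h2 := ENNReal.toReal_mono (by finiteness) key
  simpa [ENNReal.toReal_mul, ENNReal.toReal_ofReal hA0] using h2

/-- Elementwise `H¹`-stability of the `L²`-projection. -/
lemma exists_projection_stability (d r : ℕ) {σ : ℝ} (hσ : 0 < σ) : ∃ B : ℝ, 0 < B ∧
    ∀ {Ω : Set (Euc d)} (_ : IsOpen Ω) (hΩb : Bornology.IsBounded Ω) {𝒯 : Triangulation Ω} {h : ℝ}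
      {c : 𝒯.cells → Euc d}, 𝒯.IsShapeRegular σ h c → ∀ {φ : L2 Ω} {G : L2Vec Ω},
      IsWeakGradient Ω φ G → ∀ p : 𝒯.Coef r,
      (∀ w, ⟪𝒯.toL2 r h c hΩb p, 𝒯.toL2 r h c hΩb w⟫ = ⟪φ, 𝒯.toL2 r h c hΩb w⟫) →
      ∫ x in Ω, ‖𝒯.gradAt r h c x p‖ ^ 2 ≤ B * ‖G‖ ^ 2 := by
  obtain ⟨C, hC, hCle⟩ := exists_inverse_inequality d r hσ
  refine ⟨C * (2 ^ d * ((2 / σ) ^ d + 1)), by positivity,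
    fun {Ω} hΩo hΩb {𝒯 h c} hr {φ G} hG p hp => ?_⟩
  obtain ⟨n, hn, hφn⟩ := exists_norm_sub_toL2_sq_le (r := r) hΩo hΩb hr hG
  -- Subtracting a piecewise constant leaves the gradient unchanged. As `p - n` is the projection of
  -- `φ - n`, the factor `h²` of the approximation error cancels that of the inverse inequality.
  have h1 := hCle hΩb hr (p - n)
  simp_rw [map_sub, hn, sub_zero] at h1
  have h2 : ‖𝒯.toL2 r h c hΩb p - 𝒯.toL2 r h c hΩb n‖ ≤ ‖φ - 𝒯.toL2 r h c hΩb n‖ := by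
    have h3 : ⟪𝒯.toL2 r h c hΩb p - 𝒯.toL2 r h c hΩb n, φ - 𝒯.toL2 r h c hΩb p⟫ = 0 := by
      rw [← map_sub, inner_sub_right, real_inner_comm, real_inner_comm _ (𝒯.toL2 r h c hΩb (p - n)),
        hp, sub_eq_zero]
    refine (norm_le_norm_add_of_inner_eq_zero h3).trans_eq ?_
    congr 1
    abel
  have hh : 0 < h ^ 2 := pow_pos hr.pos 2
  refine le_of_mul_le_mul_left ?_ hh
  calc _ ≤ _ := h1
    _ ≤ C * ‖φ - 𝒯.toL2 r h c hΩb n‖ ^ 2 := by gcongr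
    _ ≤ C * (h ^ 2 * (2 ^ d * ((2 / σ) ^ d + 1)) * ‖G‖ ^ 2) := by gcongr
    _ = _ := by ring

end Triangulation

/-! ### From semidiscrete solutions to Galerkin flows. -/

namespace ProblemData

variable {d : ℕ} {Ω : Set (Euc d)} (D : ProblemData Ω)

lemma continuousOn_phi : ContinuousOn D.phi (Ici 0) := fun t ht =>
  (D.hasDeriv_phi t ht).continuousWithinAt

lemma hasDerivAt_phi {t : ℝ} (ht : 0 < t) : HasDerivAt D.phi (D.phi_t t) t :=
  (D.hasDeriv_phi t ht.le).hasDerivAt (Ici_mem_nhds ht)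

lemma continuousOn_fTilde : ContinuousOn D.fTilde (Ici 0) :=
  D.continuousOn_f.sub D.continuousOn_phi_t

lemma continuousOn_phiH1Sq : ContinuousOn D.phiH1Sq (Ici 0) :=
  (D.continuousOn_phi.norm.pow 2).add (D.continuousOn_grad_phi.norm.pow 2)

lemma continuousOn_phitH1Sq : ContinuousOn D.phitH1Sq (Ici 0) :=
  (D.continuousOn_phi_t.norm.pow 2).add (D.continuousOn_grad_phi_t.norm.pow 2)

end ProblemData

namespace Triangulation.IsShapeRegular

variable {d r : ℕ} {Ω : Set (Euc d)} {𝒯 : Triangulation Ω} {σ h : ℝ} {c : 𝒯.cells → Euc d}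

lemma toL2_injective (hr : 𝒯.IsShapeRegular σ h c) (hΩb : Bornology.IsBounded Ω) :
    Function.Injective (𝒯.toL2 r h c hΩb) := by
  rw [injective_iff_map_eq_zero]
  intro w hw
  refine 𝒯.eq_zero_of_evalAt_eq_zero r h c hr.pos.ne' fun T => ?_
  have h1 : (fun x => 𝒯.evalAt r h c x w) =ᵐ[volume.restrict Ω] fun _ => (0 : ℝ) := by
    have h2 := 𝒯.coeFn_toL2 r h c hΩb w
    rw [hw] at h2
    exact h2.symm.trans (Lp.coeFn_zero _ _ _)
  have h3 : ContinuousOn (fun x => 𝒯.evalAt r h c x w) (interior (T : Set (Euc d))) :=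
    (((continuous_eval_const w).comp (𝒯.continuous_cellEval r h c T)).continuousOn).congr
      fun x hx => 𝒯.evalAt_of_mem r h c hx w
  exact Measure.eqOn_open_of_ae_eq (ae_mono (Measure.restrict_mono_set _
    (𝒯.interior_subset T.1 T.2)) h1) isOpen_interior h3 continuousOn_const

lemma ae_of_forall_interior (hr : 𝒯.IsShapeRegular σ h c) {p : Euc d → Prop}
    (hp : ∀ T : 𝒯.cells, ∀ x ∈ interior (T : Set (Euc d)), p x) :
    ∀ᵐ x ∂(volume.restrict Ω), p x :=
  hr.ae_mem_interior.mono fun x ⟨T, hx⟩ => hp T x hx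

end Triangulation.IsShapeRegular

namespace IsSemidiscreteSolution

variable {d r : ℕ} {Ω : Set (Euc d)} {g : ForchheimerPoly} {𝒯 : Triangulation Ω}
  {D : ProblemData Ω} {rhoT rho : ℝ → Euc d → ℝ}

/-- A semidiscrete solution, in terms of its coefficients, is a Galerkin flow. -/
lemma exists_galerkinFlow (hsol : IsSemidiscreteSolution g 𝒯 r D rhoT rho)
    (hΩb : Bornology.IsBounded Ω) {σ h : ℝ} {c : 𝒯.cells → Euc d} (hr : 𝒯.IsShapeRegular σ h c)
    {S B : ℝ} (hB0 : 0 ≤ B)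
    (hS : ∀ w : 𝒯.Coef r, ∃ n : 𝒯.Coef r, (∀ x, 𝒯.gradAt r h c x n = 0) ∧
      ‖𝒯.toL2 r h c hΩb (w - n)‖ ^ g.beta ≤ S * ∫ x in Ω, ‖𝒯.gradAt r h c x w‖ ^ g.beta)
    (hB : ∀ {φ : L2 Ω} {G : L2Vec Ω}, IsWeakGradient Ω φ G → ∀ p : 𝒯.Coef r,
      (∀ w, ⟪𝒯.toL2 r h c hΩb p, 𝒯.toL2 r h c hΩb w⟫ = ⟪φ, 𝒯.toL2 r h c hΩb w⟫) →
      ∫ x in Ω, ‖𝒯.gradAt r h c x p‖ ^ 2 ≤ B * ‖G‖ ^ 2) :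
    ∃ 𝓕 : GalerkinFlow g (volume.restrict Ω) (Euc d) (L2 Ω) (𝒯.Coef r) S B,
      (∀ t, 0 ≤ t → gradPow Ω g.beta (rho t) = 𝓕.gradInt t) ∧
      (∀ t, 0 ≤ t → normSqL2 Ω (rhoT t) = ‖𝓕.j (𝓕.u t)‖ ^ 2) ∧
      (∀ t, 0 < t → normSqL2 Ω (timeDeriv rhoT t) = ‖𝓕.j (𝓕.u_t t)‖ ^ 2) ∧
      ‖𝓕.j (𝓕.u 0)‖ ≤ ‖D.rhoTilde0‖ ∧
      𝓕.f = D.fTilde ∧ 𝓕.P = D.phiH1Sq ∧ 𝓕.P_t = D.phitH1Sq := by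
  have hh := hr.pos
  set j := 𝒯.toL2 r h c hΩb with hj
  have hjinj : Function.Injective j := hr.toL2_injective hΩb
  obtain ⟨M, hM0, hM⟩ := 𝒯.exists_norm_gradAt_le r h c
  -- Coefficients at negative times are irrelevant and set to zero.
  have hu' : ∀ t, ∃ w : 𝒯.Coef r, 0 ≤ t → ∀ T : 𝒯.cells, ∀ x ∈ interior (T : Set (Euc d)),
      rhoT t x = 𝒯.evalAt r h c x w := fun t => by
    by_cases ht : 0 ≤ t
    · obtain ⟨w, hw⟩ := 𝒯.exists_evalAt_eq r h c hh.ne' (hsol.mem t ht)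
      exact ⟨w, fun _ => hw⟩
    · exact ⟨0, fun h => absurd h ht⟩
  choose u hu using hu'
  have hp' : ∀ t, ∃ w : 𝒯.Coef r, 0 ≤ t → ∀ T : 𝒯.cells, ∀ x ∈ interior (T : Set (Euc d)),
      (rho t - rhoT t) x = 𝒯.evalAt r h c x w := fun t => by
    by_cases ht : 0 ≤ t
    · obtain ⟨w, hw⟩ := 𝒯.exists_evalAt_eq r h c hh.ne' (hsol.proj t ht).1
      exact ⟨w, fun _ => hw⟩
    · exact ⟨0, fun h => absurd h ht⟩
  choose p hp using hp'
  have hpj : ∀ t, 0 ≤ t → ∀ w, ⟪j (p t), j w⟫ = ⟪D.phi t, j w⟫ := fun t ht w => by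
    rw [hj, 𝒯.inner_toL2_toL2, 𝒯.inner_toL2,
      ← (hsol.proj t ht).2 _ (𝒯.evalAt_mem_space r h c w)]
    exact integral_congr_ae (hr.ae_of_forall_interior fun T x hx => by
      beta_reduce; rw [hp t ht T x hx])
  -- regularity in time
  have hu_sep : ∀ v : 𝒯.Coef r, (∀ i : {x // ∃ T : 𝒯.cells, x ∈ interior (T : Set (Euc d))},
      (𝒯.evalAt r h c i : 𝒯.Coef r →ₗ[ℝ] ℝ) v = 0) → v = 0 := fun v hv =>
    𝒯.eq_zero_of_evalAt_eq_zero r h c hh.ne' fun T x hx => hv ⟨x, T, hx⟩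
  have hu_cont : ContinuousOn u (Ici 0) := continuousOn_of_separating _ hu_sep
    fun ⟨x, T, hx⟩ => (hsol.continuousOn T.1 T.2 x hx).congr fun t ht => (hu t ht T x hx).symm
  have hu_ev : ∀ t, 0 < t → ∀ T : 𝒯.cells, ∀ x ∈ interior (T : Set (Euc d)),
      (fun s => 𝒯.evalAt r h c x (u s)) =ᶠ[nhds t] fun s => rhoT s x := fun t ht T x hx =>
    Filter.mem_of_superset (Ioi_mem_nhds ht) fun s hs => (hu s (le_of_lt hs) T x hx).symm
  have hu_diff : ∀ t, 0 < t → HasDerivAt u (deriv u t) t := fun t ht =>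
    (differentiableAt_of_separating _ hu_sep fun ⟨x, T, hx⟩ =>
      (hsol.differentiableAt T.1 T.2 x hx t ht).congr_of_eventuallyEq
        (hu_ev t ht T x hx)).hasDerivAt
  have hu_t : ∀ t, 0 < t → ∀ T : 𝒯.cells, ∀ x ∈ interior (T : Set (Euc d)),
      timeDeriv rhoT t x = 𝒯.evalAt r h c x (deriv u t) := fun t ht T x hx => by
    rw [timeDeriv, ← (hu_ev t ht T x hx).deriv_eq]
    exact ((𝒯.evalAt r h c x).hasFDerivAt.comp_hasDerivAt t (hu_diff t ht)).deriv
  -- The projection is characterised by its pairings with `W_h`. These inherit the regularity of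
  -- `φ`, and they separate points.
  set ℓ : 𝒯.Coef r → Module.Dual ℝ (𝒯.Coef r) := fun w =>
    ((innerSL ℝ (j w)).comp j : 𝒯.Coef r →L[ℝ] ℝ) with hℓ
  have hℓ_eq : ∀ w v, ℓ w v = ⟪j w, j v⟫ := fun _ _ => rfl
  have hp_sep : ∀ v : 𝒯.Coef r, (∀ i, ℓ i v = 0) → v = 0 := fun v hv => by
    have := hv v
    rw [hℓ_eq, inner_self_eq_zero] at this
    exact hjinj (this.trans (map_zero j).symm)
  have hp_eq : ∀ t, 0 ≤ t → ∀ w, ℓ w (p t) = ⟪j w, D.phi t⟫ := fun t ht w => by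
    rw [hℓ_eq, real_inner_comm, hpj t ht, real_inner_comm]
  have hp_cont : ContinuousOn p (Ici 0) := continuousOn_of_separating ℓ hp_sep fun w =>
    (continuousOn_const.inner D.continuousOn_phi).congr fun t ht => hp_eq t ht w
  have hp_ev : ∀ t, 0 < t → ∀ w, (fun s => ℓ w (p s)) =ᶠ[nhds t] fun s => ⟪j w, D.phi s⟫ :=
    fun t ht w => Filter.mem_of_superset (Ioi_mem_nhds ht) fun s hs => hp_eq s (le_of_lt hs) w
  have hphi : ∀ t, 0 < t → ∀ w, HasDerivAt (fun s => ⟪j w, D.phi s⟫) ⟪j w, D.phi_t t⟫ t :=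
    fun t ht w => (innerSL ℝ (j w)).hasFDerivAt.comp_hasDerivAt t (D.hasDerivAt_phi ht)
  have hp_diff : ∀ t, 0 < t → HasDerivAt p (deriv p t) t := fun t ht =>
    (differentiableAt_of_separating ℓ hp_sep fun w =>
      (hphi t ht w).differentiableAt.congr_of_eventuallyEq (hp_ev t ht w)).hasDerivAt
  -- Differentiating the pairings shows that the time derivative of `πφ` is the projection of `φ_t`,
  -- so the stability bound applies to it as well.
  have hpj_t : ∀ t, 0 < t → ∀ w, ⟪j (deriv p t), j w⟫ = ⟪D.phi_t t, j w⟫ := fun t ht w => by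
    have h1 : HasDerivAt (fun s => ℓ w (p s)) (ℓ w (deriv p t)) t :=
      ((innerSL ℝ (j w)).comp j).hasFDerivAt.comp_hasDerivAt t (hp_diff t ht)
    have h2 := h1.unique ((hphi t ht w).congr_of_eventuallyEq (hp_ev t ht w))
    rw [hℓ_eq] at h2
    rw [real_inner_comm, h2, real_inner_comm]
  -- the elementwise gradient
  have hgrad : ∀ t, 0 ≤ t → ∀ T : 𝒯.cells, ∀ x ∈ interior (T : Set (Euc d)),
      gradient (rho t) x = 𝒯.gradAt r h c x (u t + p t) := fun t ht T x hx =>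
    𝒯.gradient_eq_gradAt r h c (fun y hy => by
      rw [map_add, ← hu t ht T y hy, ← hp t ht T y hy, Pi.sub_apply, add_sub_cancel]) hx
  refine ⟨{ D := 𝒯.gradAt r h c, bound := M, j := j, u := u, u_t := deriv u, p := p,
            p_t := deriv p, f := D.fTilde, P := D.phiH1Sq, P_t := D.phitH1Sq,
            stronglyMeasurable_D := 𝒯.stronglyMeasurable_gradAt r h c, norm_D_le := hM,
            j_injective := hjinj, poincare := hS, continuousOn_u := hu_cont,
            hasDerivAt_u := hu_diff, continuousOn_p := hp_cont, hasDerivAt_p := hp_diff,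
            continuousOn_f := D.continuousOn_fTilde, continuousOn_P := D.continuousOn_phiH1Sq,
            continuousOn_P_t := D.continuousOn_phitH1Sq,
            P_nonneg := fun t => by unfold ProblemData.phiH1Sq; positivity,
            P_t_nonneg := fun t => by unfold ProblemData.phitH1Sq; positivity,
            integral_p_le := fun t ht => ?_, integral_p_t_le := fun t ht => ?_,
            equation := fun t ht w => ?_ }, fun t ht => ?_, fun t ht => ?_, fun t ht => ?_, ?_,
    rfl, rfl, rfl⟩
  · refine (hB (D.isWeakGradient_phi t ht) (p t) (hpj t ht)).trans ?_
    exact mul_le_mul_of_nonneg_left (le_add_of_nonneg_left (sq_nonneg ‖D.phi t‖)) hB0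
  · refine (hB (D.isWeakGradient_phi_t t ht.le) (deriv p t) (hpj_t t ht)).trans ?_
    exact mul_le_mul_of_nonneg_left (le_add_of_nonneg_left (sq_nonneg ‖D.phi_t t‖)) hB0
  · rw [hj, 𝒯.inner_toL2_toL2, 𝒯.inner_toL2, ← hsol.equation t ht _ (𝒯.evalAt_mem_space r h c w)]
    congr 1
    · exact integral_congr_ae (hr.ae_of_forall_interior fun T x hx => by
      beta_reduce; rw [hu_t t ht T x hx])
    · refine integral_congr_ae (hr.ae_of_forall_interior fun T x hx => ?_)
      beta_reduce
      rw [hgrad t ht.le T x hx, real_inner_smul_left,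
        𝒯.gradient_eq_gradAt r h c (fun y _ => rfl) hx]
  · exact integral_congr_ae (hr.ae_of_forall_interior fun T x hx => by
      beta_reduce; rw [hgrad t ht T x hx])
  · refine Eq.trans ?_ (𝒯.norm_toL2_sq r h c hΩb (u t)).symm
    exact integral_congr_ae (hr.ae_of_forall_interior fun T x hx => by
      beta_reduce; rw [hu t ht T x hx])
  · refine Eq.trans ?_ (𝒯.norm_toL2_sq r h c hΩb (deriv u t)).symm
    exact integral_congr_ae (hr.ae_of_forall_interior fun T x hx => by
      beta_reduce; rw [hu_t t ht T x hx])
  -- The initial projection tested with itself; Cauchy–Schwarz then shows that it does not increase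
  -- the norm.
  · have h1 : ‖j (u 0)‖ ^ 2 = ⟪D.rhoTilde0, j (u 0)⟫ := by
      rw [hj, 𝒯.norm_toL2_sq, 𝒯.inner_toL2, ← hsol.init.2 _ (𝒯.evalAt_mem_space r h c (u 0))]
      exact integral_congr_ae (hr.ae_of_forall_interior fun T x hx => by
        beta_reduce; rw [hu 0 le_rfl T x hx, sq])
    have h2 := real_inner_le_norm D.rhoTilde0 (j (u 0))
    rcases (norm_nonneg (j (u 0))).eq_or_lt with h0 | h0
    · exact h0.symm.trans_le (norm_nonneg _)
    · change ‖j (u 0)‖ ≤ _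
      nlinarith

end IsSemidiscreteSolution

/-- With `β = 2 - a` the exponent equals `2 - a (d+2)/2`, so non-negativity is precisely the degree
condition. -/
lemma ForchheimerPoly.sobolev_exponent_nonneg {d : ℕ} (g : ForchheimerPoly)
    (hdeg : g.a ≤ 4 / ((d : ℝ) + 2)) : 0 ≤ ((d : ℝ) + 2) * g.beta / 2 - d := by
  have hd : (0 : ℝ) < (d : ℝ) + 2 := by positivity
  rw [le_div_iff₀ hd] at hdeg
  rw [ForchheimerPoly.beta]
  linarith

/-! ### Assembly of the theorem. -/

theorem theorem4p3 (d : ℕ) (hd : 2 ≤ d) (g : ForchheimerPoly)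
    (hdeg : g.a ≤ 4 / ((d : ℝ) + 2))
    (Ω : Set (Euc d)) (hΩo : IsOpen Ω) (hΩb : Bornology.IsBounded Ω)
    (r : ℕ) (σ : ℝ) (hσ : 0 < σ) :
    ∃ C : ℝ, 0 < C ∧
      ∀ 𝒯 : Triangulation Ω, 𝒯.IsQuasiUniform σ →
      ∀ (D : ProblemData Ω) (rhoT rho : ℝ → Euc d → ℝ),
        IsSemidiscreteSolution g 𝒯 r D rhoT rho →
        (∀ t : ℝ, 1 ≤ t →
          IntervalIntegrable (fun τ => gradPow Ω g.beta (rho τ)) volume (t - 1) t ∧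
          ∫ τ in (t - 1)..t, gradPow Ω g.beta (rho τ) ≤
            C * (1 + normSqL2 Ω (rhoT (t - 1)) +
              ∫ τ in (t - 1)..t, (D.phiH1Sq τ + ‖D.fTilde τ‖ ^ g.lam))) ∧
        (∀ t : ℝ, 1 ≤ t →
          IntervalIntegrable (fun τ => normSqL2 Ω (timeDeriv rhoT τ)) volume (t - 1 / 2) t ∧
          (∫ τ in (t - 1 / 2)..t, normSqL2 Ω (timeDeriv rhoT τ)) + gradPow Ω g.beta (rho t) ≤
            C * normSqL2 Ω (rhoT (t - 1)) +
              C * (1 + ∫ τ in (t - 1)..t,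
                (D.phiH1Sq τ + D.phitH1Sq τ + ‖D.fTilde τ‖ ^ g.lam))) ∧
        (∀ E : ℝ → ℝ, IsEnvelope (D.gFun g) E → ∀ t : ℝ, 1 ≤ t →
          gradPow Ω g.beta (rho t) ≤
            C * (1 + ‖D.rhoTilde0‖ ^ 2 + E t ^ (2 / g.beta) +
              ∫ τ in (t - 1)..t, D.phitH1Sq τ)) := by
  have hfin : IsFiniteMeasure (volume.restrict Ω) := ⟨by simpa using hΩb.measure_lt_top⟩
  have hb := g.one_lt_beta
  have hH0 : 0 ≤ 2 * Metric.diam Ω / σ + 1 := by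
    have : 0 ≤ Metric.diam Ω := Metric.diam_nonneg
    positivity
  -- `S`, `B` and `C` are fixed before the triangulation, the data and the solution, with `2 diam
  -- Ω/σ + 1` as the a priori bound for the mesh size.
  obtain ⟨S, hS, hpoinc⟩ := Triangulation.exists_broken_poincare d r hσ (by linarith) g.beta_lt_two
    (g.sobolev_exponent_nonneg hdeg) hH0
  obtain ⟨B, hB, hproj⟩ := Triangulation.exists_projection_stability d r hσ
  obtain ⟨C, hC, hest⟩ := GalerkinFlow.exists_estimates g (Euc d) (volume.restrict Ω) hS hB
  refine ⟨C, hC, fun 𝒯 hq D rhoT rho hsol => ?_⟩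
  obtain ⟨h, c, hhH, hr⟩ := Triangulation.exists_isShapeRegular hd hΩb 𝒯 hσ hq
  obtain ⟨𝓕, hgrad, hu, hu_t, hu0, hf, hP, hP_t⟩ := hsol.exists_galerkinFlow hΩb hr
    hB.le (hpoinc hΩb hr hhH) (hproj hΩo hΩb hr)
  have hforcing : ∀ τ, 𝓕.forcing τ = D.gFun g τ := fun τ => by
    rw [GalerkinFlow.forcing, hf, hP, ProblemData.gFun]
  have hgrad_int : ∀ t : ℝ, 1 ≤ t → EqOn (fun τ => gradPow Ω g.beta (rho τ)) 𝓕.gradInt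
      (uIcc (t - 1) t) := fun t ht τ hτ => by
    rw [uIcc_of_le (by linarith)] at hτ
    exact hgrad τ (by linarith [hτ.1])
  have hu_t_int : ∀ t : ℝ, 1 ≤ t → EqOn (fun τ => normSqL2 Ω (timeDeriv rhoT τ))
      (fun τ => ‖𝓕.j (𝓕.u_t τ)‖ ^ 2) (uIcc (t - 1 / 2) t) := fun t ht τ hτ => by
    rw [uIcc_of_le (by linarith)] at hτ
    exact hu_t τ (by linarith [hτ.1])
  refine ⟨fun t ht => ⟨?_, ?_⟩, fun t ht => ⟨?_, ?_⟩, fun E hE t ht => ?_⟩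
  · exact (GalerkinFlow.intervalIntegrable_of_Ici 𝓕.continuousOn_gradInt (by linarith) (by linarith)).congr
      ((hgrad_int t ht).symm.mono uIoc_subset_uIcc)
  · rw [intervalIntegral.integral_congr (hgrad_int t ht), hu _ (by linarith)]
    refine (hest 𝓕 t ht).1.trans_eq ?_
    have h1 : ∀ τ, 𝓕.forcing τ = D.phiH1Sq τ + ‖D.fTilde τ‖ ^ g.lam := fun τ => by
      rw [hforcing, ProblemData.gFun, add_comm]
    simp_rw [h1]
  · refine IntervalIntegrable.congr ((hu_t_int t ht).symm.mono uIoc_subset_uIcc) ?_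
    exact ContinuousOn.intervalIntegrable_of_Icc (by linarith)
      (𝓕.continuousOn_normSq_u_t.mono fun τ hτ => by
        rw [mem_Ioi]; linarith [hτ.1])
  · rw [intervalIntegral.integral_congr (hu_t_int t ht), hu _ (by linarith), hgrad t (by linarith)]
    refine (hest 𝓕 t ht).2.1.trans_eq ?_
    have h1 : ∀ τ, 𝓕.forcing τ + 𝓕.P_t τ =
        D.phiH1Sq τ + D.phitH1Sq τ + ‖D.fTilde τ‖ ^ g.lam := fun τ => by
      rw [hforcing, hP_t, ProblemData.gFun]; ring
    simp_rw [h1]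
    ring
  -- Monotonicity of the envelope makes its value at `t` a bound for the forcing on all of `[0, t]`.
  · have h1 := (hest 𝓕 t ht).2.2 (E t) fun s hs => by
      rw [hforcing]
      exact (hE.le s hs.1).trans (hE.monotoneOn hs.1 (hs.1.trans hs.2) hs.2)
    rw [hgrad t (by linarith)]
    refine h1.trans ?_
    rw [hP_t]
    gcongr

end
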